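/- Let $\gamma,\beta,\mu>0$. Consider on $[0,\infty)\times\mathbb{R}^3$ the linearized Navier–Stokes–Maxwell system for $U=[n,u,E,B]$ ($n$ scalar, $u,E,B$ three-component fields) $$ \begin{aligned} &\partial_t n+\gamma\nabla\cdot u=0,\qquad \partial_t u+\gamma\nabla n+\beta E-\mu\Delta u=0,\\ &\partial_t E-\nabla\times B-\beta u=0,\qquad \partial_t B+\nabla\times E=0,\\ &\nabla\cdot E=-\tfrac{\beta}{\gamma}n,\qquad \nabla\cdot B=0, \end{aligned} $$ with $U|_{t=0}=U_0=[n_0,u_0,E_0,B_0]$. A solution is a $U\in C([0,\infty);L^2(\mathbb{R}^3))$ (real- or complex-valued) that satisfies the evolution equations for $t>0$, and the two constraints for $t\ge 0$, in the sense of (tempered) distributions in $x$. Let $\hat f(k)=\int_{\mathbb{R}^3}e^{-ik\cdot x}f(x)\,dx$ be the Fourier transform, extended to $L^2$ by Plancherel's theorem. Then there are $0<\epsilon_0<1<L_0<\infty$, depending only on $\gamma,\beta,\mu$, such that for all $0<\epsilon\le\epsilon_0$ and $L\ge L_0$ there are constants $c,C>0$, depending only on $\gamma,\beta,\mu,\epsilon,L$,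 with the following property. For every solution $U$ and every $t\ge 0$, $$ \begin{pmatrix}|\hat n(t,k)|\\|\hat u(t,k)|\\|\hat E(t,k)|\\|\hat B(t,k)|\end{pmatrix}\le C\,\hat G^{\rm upp}(t,k)\begin{pmatrix}|\hat n_0(k)|\\|\hat u_0(k)|\\|\hat E_0(k)|\\|\hat B_0(k)|\end{pmatrix} $$ componentwise for almost every $k\in\mathbb{R}^3$; and if moreover $U_0$ and $U(t,\cdot)$ are integrable, so that the transforms are given pointwise by the integral, the same holds for every $k\in\mathbb{R}^3$. Here, for $|k|\le\epsilon$, $$ \hat G^{\rm upp}=\begin{pmatrix}1&|k|&0&0\\|k|&1&1&|k|\\0&1&1&|k|\\0&|k|&|k|&|k|^2\end{pmatrix}e^{-c|k|^2t}+\begin{pmatrix}0&0&0&0\\0&|k|^2&|k|^4&|k|\\0&|k|^4&|k|^6&|k|^3\\0&|k|&|k|^3&1\end{pmatrix}e^{-c|k|^4t}; $$ for $\epsilon\le|k|\le L$, $$ \hat G^{\rm upp}=\begin{pmatrix}1&1&0&0\\1&1&1&1\\0&1&1&1\\0&1&1&1\end{pmatrix}e^{-ct}; $$ and for $|k|\ge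 L$, $$ \begin{aligned} \hat G^{\rm upp}={}&\begin{pmatrix}1&|k|^{-1}&0&0\\|k|^{-1}&|k|^{-2}&|k|^{-2}&0\\0&|k|^{-2}&1&0\\0&0&0&0\end{pmatrix}e^{-ct}+\begin{pmatrix}|k|^{-2}&|k|^{-1}&0&0\\|k|^{-1}&1&|k|^{-2}&|k|^{-3}\\0&|k|^{-2}&|k|^{-2}&|k|^{-5}\\0&|k|^{-3}&|k|^{-5}&|k|^{-6}\end{pmatrix}e^{-c|k|^2t}\\ &+\begin{pmatrix}0&0&0&0\\0&|k|^{-4}&|k|^{-2}&|k|^{-2}\\0&|k|^{-2}&1&1\\0&|k|^{-2}&1&1\end{pmatrix}e^{-ct/|k|^2}. \end{aligned} $$ -/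

import Mathlib

open MeasureTheory SchwartzMap LineDeriv Laplacian FourierTransform
open scoped ENNReal

noncomputable section

namespace LinNSM

/-- Physical space (and frequency space), with the Euclidean norm. -/
abbrev R3 : Type := EuclideanSpace ℝ (Fin 3)

/-- Square-integrable scalar functions on space. -/
abbrev L2 : Type := Lp (α := R3) ℂ 2 (volume : Measure R3)

/-- The value at a fixed time of the unknown `[n, u, E, B]`; the vector fields are given by their
three components. -/
structure State where
  n : L2
  u : Fin 3 → L2
  E : Fin 3 → L2
  B : Fin 3 → L2

/-- The tempered distribution defined by a square-integrable function. -/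
def toDist (f : L2) : 𝓢'(R3, ℂ) := Lp.toTemperedDistribution f

/-- The distributional partial derivative with respect to the `i`-th coordinate. -/
def pd (i : Fin 3) (T : 𝓢'(R3, ℂ)) : 𝓢'(R3, ℂ) :=
  ∂_{(EuclideanSpace.single i (1 : ℝ) : R3)} T

/-- The distributional divergence of a vector field. -/
def divergence (F : Fin 3 → L2) : 𝓢'(R3, ℂ) := ∑ i, pd i (toDist (F i))

/-- The distributional curl of a vector field; the indices are taken modulo 3, so that the
component `i` is `∂_{i+1} F_{i+2} - ∂_{i+2} F_{i+1}`. -/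
def curl (F : Fin 3 → L2) (i : Fin 3) : 𝓢'(R3, ℂ) :=
  pd (i + 1) (toDist (F (i + 2))) - pd (i + 2) (toDist (F (i + 1)))

/-- `∂_t f = T` at time `t`, in the sense of tempered distributions in the space variable. -/
def TimeDeriv (f : ℝ → L2) (T : 𝓢'(R3, ℂ)) (t : ℝ) : Prop :=
  ∀ φ : 𝓢(R3, ℂ), HasDerivAt (fun s => toDist (f s) φ) (T φ) t

/-- `U = [n, u, E, B]` belongs to `C([0,∞); L²)`, has initial data `U₀`, and satisfies in the sense
of distributions the linearized Navier-Stokes-Maxwell system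
`∂_t n + γ ∇·u = 0`, `∂_t u + γ ∇n + β E - μ Δu = 0`, `∂_t E - ∇×B - β u = 0`, `∂_t B + ∇×E = 0`,
`∇·E = -(β/γ) n`, `∇·B = 0`. -/
structure IsSolution (γ β μ : ℝ) (U₀ : State) (U : ℝ → State) : Prop where
  init : U 0 = U₀
  cont_n : ContinuousOn (fun t => (U t).n) (Set.Ici 0)
  cont_u : ∀ i, ContinuousOn (fun t => (U t).u i) (Set.Ici 0)
  cont_E : ∀ i, ContinuousOn (fun t => (U t).E i) (Set.Ici 0)
  cont_B : ∀ i, ContinuousOn (fun t => (U t).B i) (Set.Ici 0)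
  eq_n : ∀ t > 0, TimeDeriv (fun s => (U s).n) (-((γ : ℂ) • divergence (U t).u)) t
  eq_u : ∀ t > 0, ∀ i, TimeDeriv (fun s => (U s).u i)
    (-((γ : ℂ) • pd i (toDist (U t).n)) - (β : ℂ) • toDist ((U t).E i)
      + (μ : ℂ) • Δ (toDist ((U t).u i))) t
  eq_E : ∀ t > 0, ∀ i, TimeDeriv (fun s => (U s).E i)
    (curl (U t).B i + (β : ℂ) • toDist ((U t).u i)) t
  eq_B : ∀ t > 0, ∀ i, TimeDeriv (fun s => (U s).B i) (-(curl (U t).E i)) t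
  div_E : ∀ t ≥ 0, divergence (U t).E = -(((β / γ : ℝ) : ℂ) • toDist (U t).n)
  div_B : ∀ t ≥ 0, divergence (U t).B = 0

/-- The Plancherel extension to square-integrable functions of the Fourier transform
`f̂(k) = ∫ exp(-i k·x) f(x) dx`. Mathlib normalizes the transform with the kernel
`exp(-2πi k·x)`, whence the rescaling of the frequency. -/
def hatL2 (f : L2) (k : R3) : ℂ := (𝓕 f : L2) ((2 * Real.pi)⁻¹ • k)

/-- The Fourier transform `f̂(k) = ∫ exp(-i k·x) f(x) dx` of an integrable function. -/
def hatL1 (f : L2) (k : R3) : ℂ :=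
  ∫ x : R3, Complex.exp (-(Complex.I * ((inner ℝ k x : ℝ) : ℂ))) * f x

/-- The Euclidean length of a vector with three complex components. -/
def vecNorm (w : Fin 3 → ℂ) : ℝ := Real.sqrt (∑ i, ‖w i‖ ^ 2)

/-- The vector `(|n̂|, |û|, |Ê|, |B̂|)` at the frequency `k`, for a given transform `hat`. -/
def amplitudes (hat : L2 → R3 → ℂ) (V : State) (k : R3) : Fin 4 → ℝ :=
  ![‖hat V.n k‖, vecNorm (fun i => hat (V.u i) k), vecNorm (fun i => hat (V.E i) k),
    vecNorm (fun i => hat (V.B i) k)]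

/-- All components of the state are integrable. -/
def AllIntegrable (V : State) : Prop :=
  Integrable (V.n : R3 → ℂ) ∧ (∀ i, Integrable (V.u i : R3 → ℂ)) ∧
    (∀ i, Integrable (V.E i : R3 → ℂ)) ∧ (∀ i, Integrable (V.B i : R3 → ℂ))

/-- The bounding matrix at low frequency, as a function of `κ = |k|`. -/
def GLow (c t κ : ℝ) : Matrix (Fin 4) (Fin 4) ℝ :=
  Real.exp (-(c * κ ^ 2 * t)) •
    !![1, κ, 0, 0;
       κ, 1, 1, κ;
       0, 1, 1, κ;
       0, κ, κ, κ ^ 2]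
  + Real.exp (-(c * κ ^ 4 * t)) •
    !![0, 0, 0, 0;
       0, κ ^ 2, κ ^ 4, κ;
       0, κ ^ 4, κ ^ 6, κ ^ 3;
       0, κ, κ ^ 3, 1]

/-- The bounding matrix at middle frequency. -/
def GMid (c t : ℝ) : Matrix (Fin 4) (Fin 4) ℝ :=
  Real.exp (-(c * t)) •
    !![1, 1, 0, 0;
       1, 1, 1, 1;
       0, 1, 1, 1;
       0, 1, 1, 1]

/-- The bounding matrix at high frequency, as a function of `κ = |k|`. -/
def GHigh (c t κ : ℝ) : Matrix (Fin 4) (Fin 4) ℝ :=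
  Real.exp (-(c * t)) •
    !![1, κ⁻¹, 0, 0;
       κ⁻¹, κ⁻¹ ^ 2, κ⁻¹ ^ 2, 0;
       0, κ⁻¹ ^ 2, 1, 0;
       0, 0, 0, 0]
  + Real.exp (-(c * κ ^ 2 * t)) •
    !![κ⁻¹ ^ 2, κ⁻¹, 0, 0;
       κ⁻¹, 1, κ⁻¹ ^ 2, κ⁻¹ ^ 3;
       0, κ⁻¹ ^ 2, κ⁻¹ ^ 2, κ⁻¹ ^ 5;
       0, κ⁻¹ ^ 3, κ⁻¹ ^ 5, κ⁻¹ ^ 6]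
  + Real.exp (-(c * t / κ ^ 2)) •
    !![0, 0, 0, 0;
       0, κ⁻¹ ^ 4, κ⁻¹ ^ 2, κ⁻¹ ^ 2;
       0, κ⁻¹ ^ 2, 1, 1;
       0, κ⁻¹ ^ 2, 1, 1]

/-- At the frequency `k` and time `t`, the componentwise inequality
`a ≤ C • (G *ᵥ a₀)` holds with the matrix `G` of each of the frequency regions
`|k| ≤ ε`, `ε ≤ |k| ≤ L`, `L ≤ |k|` that contain `k`. -/
def BoundAt (ε L c C t : ℝ) (a a₀ : R3 → Fin 4 → ℝ) (k : R3) : Prop :=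
  (‖k‖ ≤ ε → a k ≤ C • (GLow c t ‖k‖).mulVec (a₀ k)) ∧
  (ε ≤ ‖k‖ → ‖k‖ ≤ L → a k ≤ C • (GMid c t).mulVec (a₀ k)) ∧
  (L ≤ ‖k‖ → a k ≤ C • (GHigh c t ‖k‖).mulVec (a₀ k))

end LinNSM

end

/-! On the Fourier side the system is, for each frequency `k`, a linear ODE for ten scalars, and the
theorem is a bound on its solutions that is uniform in `k`. The proof has an analytic half
(solutions of the PDE are, frequency by frequency, solutions of the ODE) and an algebraic half
(bounds for the ODE).

Analytic half: the symbol is unbounded in `k` but continuous, so over each ball it acts on L² as a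
bounded operator. There the weak equation becomes a norm-differentiable one, its solution is the
operator exponential, and that exponential acts pointwise almost everywhere
(`exists_pointwise_solution`, `IsSolution.ae_fourierODE`). For integrable fields the transforms are
continuous, and bounds valid almost everywhere extend to every `k` (`boundAt_of_ae`).

Algebraic half: write κ = |k| and d = μκ². The Helmholtz splitting decouples the ODE into one
longitudinal system for (n, u∥, E∥) and three copies of one 3×3 system with real coefficients for
the transverse fields (u, E, b) (`FourierODE.exists_splitting`).

The longitudinal system with Gauss's law is a damped oscillator with damping d and squared frequency
β² + γ²κ². For bounded κ it decays like exp(-cκ²t); for large κ it is overdamped, with exponents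
close to γ²/μ and μκ².

The transverse system has a real eigenvalue -σ with (d - σ)(κ² + σ²) = β²σ, and on the complementary
invariant plane it is an oscillator with damping d - σ. For small κ, σ is close to μκ⁴/β² and d - σ
to μκ². For large κ, σ is close to μκ² and d - σ to β²/(μκ²), which is the regularity-loss rate. The
spectral projections are of rank one up to constants: (κ, κ³, 1) and (1, 1, κ) tensored with
themselves at low frequency, (1, κ⁻², κ⁻³) and (κ⁻², 1, 1) at high frequency. These give the entries
of the matrices. In between, a Lyapunov functional yields exponential decay. -/

noncomputable section

namespace LinNSM

open Filter Topology Set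
open scoped ContDiff

/-! ### Linear evolution equations with bounded generator -/

section LinearODE

variable {H : Type*} [NormedAddCommGroup H] [NormedSpace ℂ H] [CompleteSpace H]

/-- A function which is continuous on `[0, ∞)` with vanishing derivative on `(0, ∞)` is constant. -/
theorem eq_of_hasDerivAt_zero {F : Type*} [NormedAddCommGroup F] [NormedSpace ℝ F] {f : ℝ → F}
    (hc : ContinuousOn f (Ici 0)) (hd : ∀ t > 0, HasDerivAt f 0 t) {t : ℝ} (ht : 0 ≤ t) :
    f t = f 0 := by
  rcases ht.eq_or_lt with rfl | ht'
  · rfl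
  -- No derivative is available at 0, so constancy is obtained on [s, t] with s > 0, and then s
  -- tends to 0.
  have key : ∀ s ∈ Ioc 0 t, f t = f s := fun s hs =>
    constant_of_has_deriv_right_zero (hc.mono fun x hx => (hs.1.le.trans hx.1))
      (fun x hx => (hd x (hs.1.trans_le hx.1)).hasDerivWithinAt) t ⟨hs.2, le_rfl⟩
  have h1 : Tendsto f (𝓝[>] 0) (𝓝 (f 0)) :=
    (hc 0 self_mem_Ici).tendsto.mono_left (nhdsWithin_mono _ Ioi_subset_Ici_self)
  refine tendsto_nhds_unique (tendsto_const_nhds.congr' ?_) h1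
  filter_upwards [Ioc_mem_nhdsGT ht'] with s hs using key s hs

/-- Solutions of a linear equation with bounded generator are given by the exponential. -/
theorem eq_exp_smul_of_hasDerivAt (A : H →L[ℂ] H) {f : ℝ → H}
    (hc : ContinuousOn f (Ici 0)) (hd : ∀ t > 0, HasDerivAt f (A (f t)) t) {t : ℝ} (ht : 0 ≤ t) :
    f t = NormedSpace.exp (t • A) (f 0) := by
  have hE : ∀ s : ℝ, HasDerivAt (fun s : ℝ => NormedSpace.exp ((t - s) • A))
      (-(NormedSpace.exp ((t - s) • A) * A)) s := fun s => by
    have h := (hasDerivAt_exp_smul_const A (t - s)).scomp s ((hasDerivAt_id s).const_sub t)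
    exact h.congr_deriv (by simp)
  have hcE : Continuous (fun s : ℝ => NormedSpace.exp ((t - s) • A)) :=
    continuous_iff_continuousAt.2 fun s => (hE s).continuousAt
  -- The curve exp((t - s)A) f(s) is constant in s; compare s = t with s = 0.
  have h0 := eq_of_hasDerivAt_zero (f := fun s => NormedSpace.exp ((t - s) • A) (f s))
    (hcE.continuousOn.clm_apply hc) (fun s hs => by
      have h := ((ContinuousLinearMap.restrictScalarsL ℂ H H ℝ ℝ).hasFDerivAt.comp_hasDerivAt s
        (hE s)).clm_apply (hd s hs)
      refine h.congr_deriv ?_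
      change (-(NormedSpace.exp ((t - s) • A) * A)) (f s) + NormedSpace.exp ((t - s) • A) (A (f s))
        = 0
      simp) ht
  simpa using h0

/-- If the derivative of `f` is `g` when tested with a separating family of functionals, and both
are continuous, then `f` is differentiable in norm. -/
theorem hasDerivAt_of_weak {f g : ℝ → H} (P : Set (H →L[ℂ] ℂ))
    (hP : ∀ x, (∀ l ∈ P, l x = 0) → x = 0)
    (hf : ContinuousOn f (Ici 0)) (hg : ContinuousOn g (Ici 0))
    (hd : ∀ l ∈ P, ∀ t > 0, HasDerivAt (fun s => l (f s)) (l (g t)) t) {t : ℝ} (ht : 0 < t) :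
    HasDerivAt f (g t) t := by
  -- Extending `g` by its value at 0 makes it continuous on the whole line, so that its primitive is
  -- differentiable everywhere.
  set G : ℝ → H := fun s => g (max s 0) with hG
  have hGc : Continuous G := by
    refine hg.comp_continuous (by fun_prop) fun x => le_max_right x 0
  have hI : ∀ s : ℝ, HasDerivAt (fun s => f 0 + ∫ r in (0 : ℝ)..s, G r) (G s) s := fun s =>
    (intervalIntegral.integral_hasDerivAt_right (hGc.intervalIntegrable _ _)
      (hGc.stronglyMeasurableAtFilter _ _) hGc.continuousAt).const_add _
  have hGs : ∀ s > 0, G s = g s := fun s hs => by simp [hG, max_eq_left hs.le]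
  have heq : ∀ s ≥ 0, f s = f 0 + ∫ r in (0 : ℝ)..s, G r := by
    intro s hs
    rw [← sub_eq_zero]
    refine hP _ fun l hl => ?_
    have hIc : Continuous (fun s => f 0 + ∫ r in (0 : ℝ)..s, G r) :=
      continuous_iff_continuousAt.2 fun s => (hI s).continuousAt
    have := eq_of_hasDerivAt_zero (f := fun s => l (f s - (f 0 + ∫ r in (0 : ℝ)..s, G r)))
      (l.continuous.comp_continuousOn (hf.sub hIc.continuousOn)) (fun r hr => by
        have h1 := hd l hl r hr
        have h2 := (l.restrictScalars ℝ).hasFDerivAt.comp_hasDerivAt r (hI r)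
        have h3 := h1.sub h2
        refine (h3.congr_deriv (by simp [hGs r hr])).congr_of_eventuallyEq
          (Eventually.of_forall fun x => by simp [Function.comp_def])) hs
    simpa using this
  rw [← hGs t ht]
  refine (hI t).congr_of_eventuallyEq ?_
  filter_upwards [Ioi_mem_nhds ht] with s hs using heq s (le_of_lt hs)

/-- Used both for operators on L² and for matrices: with the same coefficients in the two series,
the exponentials can be compared term by term. -/
theorem hasSum_exp_smul_apply (A : H →L[ℂ] H) (t : ℝ) (v : H) :
    HasSum (fun n : ℕ => ((n.factorial⁻¹ : ℂ) * (t : ℂ) ^ n) • (A ^ n) v)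
      (NormedSpace.exp (t • A) v) := by
  have h := (ContinuousLinearMap.apply ℂ H v).hasSum
    (NormedSpace.exp_series_hasSum_exp' (𝕂 := ℂ) (t • A))
  refine h.congr_fun fun n => ?_
  have h2 : t • A = (t : ℂ) • A := by ext; simp
  simp [h2, smul_pow, mul_smul, -Complex.coe_smul]

end LinearODE

theorem exp_zero_smul_apply {H : Type*} [NormedAddCommGroup H] [NormedSpace ℂ H] (A : H →L[ℂ] H)
    (v : H) : NormedSpace.exp ((0 : ℝ) • A) v = v := by
  simp

end LinNSM

end

/-! ### Matrix multipliers on L² and the passage to pointwise equations -/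

noncomputable section

namespace LinNSM

open Filter Topology Set
open scoped ContDiff

section Multiplier

variable {X : Type*} [MeasurableSpace X] {ι : Type*} [Fintype ι]

/-- Multiplication by a bounded function, as an operator on square-integrable functions. -/
def mulL2 {ν : Measure X} (g : Lp ℂ ∞ ν) : Lp ℂ 2 ν →L[ℂ] Lp ℂ 2 ν :=
  ContinuousLinearMap.holderL ν ∞ 2 2 (ContinuousLinearMap.mul ℂ ℂ) g

theorem mulL2_coeFn {ν : Measure X} (g : Lp ℂ ∞ ν) (f : Lp ℂ 2 ν) :
    mulL2 g f =ᵐ[ν] fun x => g x * f x :=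
  ContinuousLinearMap.coeFn_holder _ g f

/-- The operator on vector-valued square-integrable functions given by a matrix of bounded
functions. -/
def matMulL2 {ν : Measure X} (g : ι → ι → Lp ℂ ∞ ν) :
    (ι → Lp ℂ 2 ν) →L[ℂ] (ι → Lp ℂ 2 ν) :=
  ContinuousLinearMap.pi fun i => ∑ j, mulL2 (g i j) ∘L ContinuousLinearMap.proj j

theorem matMulL2_coeFn {ν : Measure X} (g : ι → ι → Lp ℂ ∞ ν) (f : ι → Lp ℂ 2 ν) (i : ι) :
    matMulL2 g f i =ᵐ[ν] fun x => ∑ j, g i j x * f j x := by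
  have h1 : matMulL2 g f i = ∑ j, mulL2 (g i j) (f j) := by
    simp [matMulL2]
  rw [h1]
  refine (Lp.coeFn_finsetSum _ _).trans ?_
  have h2 : ∀ᵐ x ∂ν, ∀ j, mulL2 (g i j) (f j) x = g i j x * f j x :=
    ae_all_iff.2 fun j => mulL2_coeFn _ _
  filter_upwards [h2] with x hx
  simp [hx]

theorem matMulL2_pow_coeFn {ν : Measure X} {g : ι → ι → Lp ℂ ∞ ν} {m : X → Matrix ι ι ℂ}
    (hm : ∀ i j, g i j =ᵐ[ν] fun x => m x i j) (f : ι → Lp ℂ 2 ν) (n : ℕ) :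
    ∀ᵐ x ∂ν, (fun i => (matMulL2 g ^ n) f i x) =
      ((m x).mulVecLin.toContinuousLinearMap ^ n) (fun i => f i x) := by
  induction n with
  | zero => simp
  | succ n ih =>
    have h1 : ∀ᵐ x ∂ν, ∀ i, matMulL2 g ((matMulL2 g ^ n) f) i x =
        ∑ j, g i j x * (matMulL2 g ^ n) f j x := ae_all_iff.2 fun i => matMulL2_coeFn g _ i
    have h2 : ∀ᵐ x ∂ν, ∀ i j, g i j x = m x i j :=
      ae_all_iff.2 fun i => ae_all_iff.2 fun j => hm i j
    filter_upwards [ih, h1, h2] with x hx h1 h2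
    rw [pow_succ', pow_succ']
    ext i
    simp only [mul_apply_eq_comp]
    rw [← hx, h1]
    simp only [h2]
    rfl

/-- The exponential of a matrix multiplication operator acts as the pointwise exponential. -/
theorem exp_matMulL2_coeFn {ν : Measure X} {g : ι → ι → Lp ℂ ∞ ν} {m : X → Matrix ι ι ℂ}
    (hm : ∀ i j, g i j =ᵐ[ν] fun x => m x i j) (f : ι → Lp ℂ 2 ν) (t : ℝ) :
    ∀ᵐ x ∂ν, (fun i => NormedSpace.exp (t • matMulL2 g) f i x) =
      NormedSpace.exp (t • (m x).mulVecLin.toContinuousLinearMap) (fun i => f i x) := by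
  have key : ∀ i, ∀ᵐ x ∂ν, NormedSpace.exp (t • matMulL2 g) f i x =
      NormedSpace.exp (t • (m x).mulVecLin.toContinuousLinearMap) (fun i => f i x) i := by
    intro i
    set c : ℕ → ℂ := fun n => (n.factorial⁻¹ : ℂ) * (t : ℂ) ^ n
    set S : ℕ → Lp ℂ 2 ν := fun N => ∑ n ∈ Finset.range N, c n • (matMulL2 g ^ n) f i with hS
    have h1 : Tendsto S atTop (𝓝 (NormedSpace.exp (t • matMulL2 g) f i)) := by
      have h := ((ContinuousLinearMap.proj (R := ℂ) (φ := fun _ : ι => Lp ℂ 2 ν) i).hasSum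
        (hasSum_exp_smul_apply (matMulL2 g) t f)).tendsto_sum_nat
      refine h.congr fun n => ?_
      simp only [map_smul, ContinuousLinearMap.proj_apply]
      rfl
    -- The partial sums converge in L², hence almost everywhere along a subsequence; pointwise they
    -- are the partial sums of the matrix exponential, so the two limits agree.
    obtain ⟨ψ, hψ, hae⟩ := (tendstoInMeasure_of_tendsto_Lp h1).exists_seq_tendsto_ae
    have h2 : ∀ᵐ x ∂ν, ∀ n, (fun i => (matMulL2 g ^ n) f i x) =
        ((m x).mulVecLin.toContinuousLinearMap ^ n) (fun i => f i x) :=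
      ae_all_iff.2 fun n => matMulL2_pow_coeFn hm f n
    have h3 : ∀ᵐ x ∂ν, ∀ N, S N x =
        ∑ n ∈ Finset.range N, (c n • (matMulL2 g ^ n) f i : Lp ℂ 2 ν) x := by
      refine ae_all_iff.2 fun N => (Lp.coeFn_finsetSum _ _).trans ?_
      exact Eventually.of_forall fun x => by simp
    have h4 : ∀ᵐ x ∂ν, ∀ n, (c n • (matMulL2 g ^ n) f i : Lp ℂ 2 ν) x =
        c n * (matMulL2 g ^ n) f i x :=
      ae_all_iff.2 fun n => Lp.coeFn_smul _ _
    filter_upwards [hae, h2, h3, h4] with x hx h2 h3 h4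
    refine tendsto_nhds_unique hx ?_
    have h5 := ((ContinuousLinearMap.proj (R := ℂ) (φ := fun _ : ι => ℂ) i).hasSum
        (hasSum_exp_smul_apply ((m x).mulVecLin.toContinuousLinearMap) t
          (fun i => f i x))).tendsto_sum_nat.comp hψ.tendsto_atTop
    refine h5.congr fun N => ?_
    simp only [Function.comp_apply, h3, h4, map_smul, ← h2, ContinuousLinearMap.proj_apply,
      smul_eq_mul, c]
  filter_upwards [ae_all_iff.2 key] with x hx using funext hx

variable [NormedAddCommGroup X] [NormedSpace ℝ X] [FiniteDimensional ℝ X] [BorelSpace X]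
  {μ : Measure X} [IsLocallyFiniteMeasure μ]

/-- If a curve of vector-valued square-integrable functions satisfies, weakly, a linear evolution
equation given by a continuous matrix multiplier, then almost everywhere its values are the values
of a solution to the ordinary differential equation at the given point. -/
theorem exists_pointwise_solution {m : X → Matrix ι ι ℂ} (hm : Continuous m)
    {V : ℝ → ι → Lp ℂ 2 μ} (hV : ∀ i, ContinuousOn (fun t => V t i) (Ici 0))
    (hd : ∀ t > 0, ∀ i, ∀ φ : X → ℝ, ContDiff ℝ ∞ φ → HasCompactSupport φ →
      HasDerivAt (fun s => ∫ x, (φ x : ℂ) * V s i x ∂μ)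
        (∫ x, (φ x : ℂ) * ∑ j, m x i j * V t j x ∂μ) t) {t : ℝ} (ht : 0 ≤ t) :
    ∀ᵐ x ∂μ, ∃ y : ℝ → ι → ℂ, (∀ s, HasDerivAt y ((m x).mulVec (y s)) s) ∧
      (y 0 = fun i => V 0 i x) ∧ (y t = fun i => V t i x) := by
  -- Over a ball the continuous symbol is bounded, so the multiplier is a bounded operator;
  -- countably many balls cover the space.
  suffices H : ∀ R : ℕ, ∀ᵐ x ∂μ.restrict (Metric.ball 0 R), ∃ y : ℝ → ι → ℂ,
      (∀ s, HasDerivAt y ((m x).mulVec (y s)) s) ∧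
      (y 0 = fun i => V 0 i x) ∧ (y t = fun i => V t i x) by
    have H' := ae_all_iff.2 fun R => (ae_restrict_iff' Metric.isOpen_ball.measurableSet).1 (H R)
    filter_upwards [H'] with x hx
    obtain ⟨R, hR⟩ := exists_nat_gt ‖x‖
    exact hx R (by simpa using hR)
  intro R
  set B : Set X := Metric.ball 0 R
  set ν := μ.restrict B with hν
  have hBm : MeasurableSet B := Metric.isOpen_ball.measurableSet
  have : IsFiniteMeasure ν := ⟨by
    rw [hν, Measure.restrict_apply_univ]
    exact measure_ball_lt_top⟩
  have hg : ∀ i j, MemLp (fun x => m x i j) ∞ ν := by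
    intro i j
    have hc : Continuous fun x => m x i j := hm.matrix_elem i j
    obtain ⟨K, hK⟩ := (isCompact_closedBall (0 : X) R).exists_bound_of_continuousOn hc.continuousOn
    refine memLp_top_of_bound hc.aestronglyMeasurable K ?_
    filter_upwards [ae_restrict_mem hBm] with x hx using hK x (Metric.ball_subset_closedBall hx)
  set g : ι → ι → Lp ℂ ∞ ν := fun i j => (hg i j).toLp _
  have hgm : ∀ i j, g i j =ᵐ[ν] fun x => m x i j := fun i j => (hg i j).coeFn_toLp
  set r := LpToLpRestrictCLM X ℂ ℂ μ 2 B
  have hr : ∀ f : Lp ℂ 2 μ, r f =ᵐ[ν] f := fun f => LpToLpRestrictCLM_coeFn ℂ B f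
  set f : ℝ → ι → Lp ℂ 2 ν := fun s i => r (V s i) with hf
  have hfc : ContinuousOn f (Ici 0) :=
    continuousOn_pi.2 fun i => r.continuous.comp_continuousOn (hV i)
  have hφ : ∀ φ : X → ℝ, ContDiff ℝ ∞ φ → HasCompactSupport φ →
      MemLp (fun x => (φ x : ℂ)) 2 ν := fun φ h1 h2 =>
    (Complex.continuous_ofReal.comp h1.continuous).memLp_of_hasCompactSupport
      (h2.comp_left Complex.ofReal_zero)
  -- Test functions supported inside the ball see no difference between the restricted and the full
  -- measure, and they still separate points.
  set P : Set ((ι → Lp ℂ 2 ν) →L[ℂ] ℂ) := {l | ∃ i, ∃ φ : X → ℝ, ContDiff ℝ ∞ φ ∧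
    HasCompactSupport φ ∧ tsupport φ ⊆ B ∧ ∀ x, l x = ∫ ξ, (φ ξ : ℂ) * x i ξ ∂ν}
  have hset : ∀ φ : X → ℝ, tsupport φ ⊆ B → ∀ h : X → ℂ,
      ∫ x, (φ x : ℂ) * h x ∂ν = ∫ x, (φ x : ℂ) * h x ∂μ := fun φ hs h =>
    setIntegral_eq_integral_of_forall_compl_eq_zero fun x hx => by
      rw [image_eq_zero_of_notMem_tsupport fun h' => hx (hs h')]; simp
  have hmem : ∀ i (φ : X → ℝ), ContDiff ℝ ∞ φ → HasCompactSupport φ → tsupport φ ⊆ B →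
      ∃ l ∈ P, ∀ x : ι → Lp ℂ 2 ν, l x = ∫ ξ, (φ ξ : ℂ) * x i ξ ∂ν := by
    intro i φ h1 h2 h3
    have : ∀ x : ι → Lp ℂ 2 ν, ((ContinuousLinearMap.mul ℂ ℂ).lpPairing ν 2 2
        ((hφ φ h1 h2).toLp _) ∘L ContinuousLinearMap.proj i) x = ∫ ξ, (φ ξ : ℂ) * x i ξ ∂ν := by
      intro x
      rw [ContinuousLinearMap.comp_apply, ContinuousLinearMap.lpPairing_eq_integral]
      refine integral_congr_ae ?_
      filter_upwards [(hφ φ h1 h2).coeFn_toLp] with ξ hξ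
      simp [hξ]
    exact ⟨_, ⟨i, φ, h1, h2, h3, this⟩, this⟩
  have hsep : ∀ x : ι → Lp ℂ 2 ν, (∀ l ∈ P, l x = 0) → x = 0 := by
    intro x hx
    ext1 i
    rw [Pi.zero_apply, Lp.eq_zero_iff_ae_eq_zero]
    have hint : IntegrableOn (x i) B μ :=
      (Lp.memLp (x i)).integrable (by norm_num)
    have := Metric.isOpen_ball.ae_eq_zero_of_integral_contDiff_smul_eq_zero
      hint.locallyIntegrableOn (fun φ h1 h2 h3 => by
        obtain ⟨l, hl, hl'⟩ := hmem i φ h1 h2 h3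
        have h4 := hx l hl
        rw [hl', hset φ h3] at h4
        simpa using h4)
    exact (ae_restrict_iff' hBm).2 this
  have hfd : ∀ s > 0, HasDerivAt f (matMulL2 g (f s)) s := by
    intro s hs
    refine hasDerivAt_of_weak (g := fun s => matMulL2 g (f s)) P hsep hfc
      ((matMulL2 g).continuous.comp_continuousOn hfc) ?_ hs
    rintro l ⟨i, φ, h1, h2, h3, h4⟩ s hs
    have h5 := hd s hs i φ h1 h2
    rw [← hset φ h3] at h5
    have e1 : ∀ s, l (f s) = ∫ x, (φ x : ℂ) * V s i x ∂μ := fun s => by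
      rw [h4, ← hset φ h3]
      refine integral_congr_ae ?_
      filter_upwards [hr (V s i)] with x hx
      rw [← hx]
    have e2 : l (matMulL2 g (f s)) = ∫ x, (φ x : ℂ) * ∑ j, m x i j * V s j x ∂ν := by
      rw [h4]
      refine integral_congr_ae ?_
      filter_upwards [ae_all_iff.2 fun j => hr (V s j), ae_all_iff.2 fun j => hgm i j,
        matMulL2_coeFn g (f s) i] with x hx hx2 hx3
      rw [hx3]
      simp only [hx2, ← hx, hf]
    simp only [e1, e2]
    exact h5
  have hsol : f t = NormedSpace.exp (t • matMulL2 g) (f 0) :=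
      eq_exp_smul_of_hasDerivAt (matMulL2 g) hfc hfd ht
  filter_upwards [exp_matMulL2_coeFn hgm (f 0) t, ae_all_iff.2 fun j => hr (V t j),
    ae_all_iff.2 fun j => hr (V 0 j)] with x hx h1 h2
  refine ⟨fun s => NormedSpace.exp (s • (m x).mulVecLin.toContinuousLinearMap)
    (fun i => V 0 i x), fun s => ?_, ?_, ?_⟩
  · have h := (hasDerivAt_exp_smul_const' (𝕂 := ℝ) (m x).mulVecLin.toContinuousLinearMap s)
    have h' := ((ContinuousLinearMap.apply ℂ (ι → ℂ) (fun i => V 0 i x)).restrictScalars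
      ℝ).hasFDerivAt.comp_hasDerivAt s h
    exact h'
  · exact exp_zero_smul_apply _ _
  · rw [← hsol] at hx
    simp only [hf, h1, h2] at hx
    exact hx.symm

end Multiplier

end LinNSM

end

/-! ### The Fourier transform of the system -/

noncomputable section

namespace LinNSM

open Filter Topology Set
open scoped ContDiff

/-- The Fourier transform of the tempered distribution `T` is the function `h`. -/
def HasFourier (T : 𝓢'(R3, ℂ)) (h : R3 → ℂ) : Prop :=
  ∀ ψ : 𝓢(R3, ℂ), Integrable (fun ξ => ψ ξ * h ξ) ∧ T (𝓕 ψ) = ∫ ξ, ψ ξ * h ξ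

namespace HasFourier

variable {T T' : 𝓢'(R3, ℂ)} {h h' : R3 → ℂ}

theorem congr (hT : HasFourier T h) (H : ∀ ξ, h' ξ = h ξ) : HasFourier T h' := by
  rwa [show h' = h from funext H]

theorem add (hT : HasFourier T h) (hT' : HasFourier T' h') :
    HasFourier (T + T') (fun ξ => h ξ + h' ξ) := fun ψ => by
  simp only [mul_add]
  refine ⟨(hT ψ).1.add (hT' ψ).1, ?_⟩
  rw [integral_add (hT ψ).1 (hT' ψ).1, ← (hT ψ).2, ← (hT' ψ).2]
  rfl

theorem smul (hT : HasFourier T h) (c : ℂ) : HasFourier (c • T) (fun ξ => c * h ξ) := fun ψ => by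
  simp only [mul_left_comm _ c]
  refine ⟨(hT ψ).1.const_mul c, ?_⟩
  rw [integral_const_mul, ← (hT ψ).2]
  rfl

theorem neg (hT : HasFourier T h) : HasFourier (-T) (fun ξ => -h ξ) := by
  intro ψ
  simp only [mul_neg, integral_neg, ← (hT ψ).2]
  exact ⟨(hT ψ).1.neg, rfl⟩

theorem sub (hT : HasFourier T h) (hT' : HasFourier T' h') :
    HasFourier (T - T') (fun ξ => h ξ - h' ξ) := by
  simpa [sub_eq_add_neg] using hT.add hT'.neg

theorem zero : HasFourier 0 (fun _ => 0) := fun ψ => by simp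

theorem sum {ι : Type*} (s : Finset ι) {T : ι → 𝓢'(R3, ℂ)} {h : ι → R3 → ℂ}
    (hT : ∀ i, HasFourier (T i) (h i)) :
    HasFourier (∑ i ∈ s, T i) (fun ξ => ∑ i ∈ s, h i ξ) := by
  classical
  induction s using Finset.induction_on with
  | empty => simpa using zero
  | insert a s ha ih => simpa [Finset.sum_insert ha] using (hT a).add ih

theorem pd (hT : HasFourier T h) (i : Fin 3) :
    HasFourier (pd i T) (fun ξ => Complex.I * ((2 * Real.pi * ξ i : ℝ) : ℂ) * h ξ) := fun ψ => by
  have hg : (fun ξ : R3 =>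
      ((inner ℝ ξ (EuclideanSpace.single i (1 : ℝ)) : ℝ) : ℂ)).HasTemperateGrowth := by
    fun_prop
  have h1 := hT ((2 * Real.pi * Complex.I) •
    SchwartzMap.smulLeftCLM ℂ
      (fun ξ : R3 => ((inner ℝ ξ (EuclideanSpace.single i (1 : ℝ)) : ℝ) : ℂ)) ψ)
  have h2 : ∀ ξ : R3, ((2 * Real.pi * Complex.I) • SchwartzMap.smulLeftCLM ℂ
      (fun ξ : R3 => ((inner ℝ ξ (EuclideanSpace.single i (1 : ℝ)) : ℝ) : ℂ)) ψ) ξ * h ξ =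
      ψ ξ * (Complex.I * ((2 * Real.pi * ξ i : ℝ) : ℂ) * h ξ) := by
    intro ξ
    rw [smul_apply, SchwartzMap.smulLeftCLM_apply_apply hg]
    simp [EuclideanSpace.inner_single_right]
    ring
  simp only [h2] at h1
  refine ⟨h1.1, ?_⟩
  rw [← h1.2, ← TemperedDistribution.fourier_apply, LinNSM.pd,
    TemperedDistribution.fourier_lineDerivOp_eq]
  simp

theorem laplacian (hT : HasFourier T h) :
    HasFourier (Δ T) (fun ξ => -((‖(2 * Real.pi) • ξ‖ ^ 2 : ℝ) : ℂ) * h ξ) := by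
  have h1 : Δ T = ∑ i, LinNSM.pd i (LinNSM.pd i T) := by
    rw [TemperedDistribution.laplacian_eq_sum (EuclideanSpace.basisFun (Fin 3) ℝ)]
    simp [LinNSM.pd]
  rw [h1]
  convert HasFourier.sum Finset.univ fun i => (hT.pd i).pd i using 2 with ξ
  rw [EuclideanSpace.real_norm_sq_eq]
  simp only [Fin.sum_univ_three]
  push_cast
  simp only [PiLp.smul_apply, smul_eq_mul]
  push_cast
  linear_combination (-(2 * Real.pi * ξ 0) ^ 2 - (2 * Real.pi * ξ 1) ^ 2 -
    (2 * Real.pi * ξ 2) ^ 2 : ℂ) * h ξ * Complex.I_sq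

/-- The Fourier transform is unique up to null sets. -/
theorem ae_eq (hT : HasFourier T h) (hT' : HasFourier T h') (hh : LocallyIntegrable h)
    (hh' : LocallyIntegrable h') : h =ᵐ[volume] h' := by
  refine ae_eq_of_integral_contDiff_smul_eq hh hh' fun g g1 g2 => ?_
  have hg₁ : HasCompactSupport (Complex.ofRealCLM ∘ g) := g2.comp_left rfl
  have hg₂ : ContDiff ℝ ∞ (Complex.ofRealCLM ∘ g) := by fun_prop
  have h1 := (hT (hg₁.toSchwartzMap hg₂)).2
  have h2 := (hT' (hg₁.toSchwartzMap hg₂)).2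
  rw [h1] at h2
  simpa using h2

end HasFourier

theorem hasFourier_toDist (f : L2) : HasFourier (toDist f) (𝓕 f : L2) := fun ψ => by
  constructor
  · have h1 := (Lp.memLp (𝓕 f : L2))
    have h2 := ψ.memLp 2 (volume : Measure R3)
    exact h2.integrable_mul h1
  · rw [← TemperedDistribution.fourier_apply, toDist, Lp.fourier_toTemperedDistribution_eq]
    simp

/-- The linearized system at a fixed frequency `k`: a system of ordinary differential equations,
with the two constraints at the initial time. -/
structure FourierODE (γ β μ : ℝ) (k : R3) (n : ℝ → ℂ) (u E B : ℝ → Fin 3 → ℂ) : Prop where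
  deriv_n : ∀ t, HasDerivAt n (-(γ * (Complex.I * ∑ i, k i * u t i))) t
  deriv_u : ∀ t i, HasDerivAt (fun s => u s i)
    (-(γ * (Complex.I * k i * n t)) - β * E t i - μ * ‖k‖ ^ 2 * u t i) t
  deriv_E : ∀ t i, HasDerivAt (fun s => E s i)
    (Complex.I * (k (i + 1) * B t (i + 2) - k (i + 2) * B t (i + 1)) + β * u t i) t
  deriv_B : ∀ t i, HasDerivAt (fun s => B s i)
    (-(Complex.I * (k (i + 1) * E t (i + 2) - k (i + 2) * E t (i + 1)))) t
  div_E : Complex.I * ∑ i, k i * E 0 i = -(β / γ * n 0)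
  div_B : ∑ i, k i * B 0 i = 0

/-- The index set for the ten scalar unknowns. -/
abbrev Comp : Type := Unit ⊕ (Fin 3 ⊕ (Fin 3 ⊕ Fin 3))

/-- The components of a state. -/
def State.comp (V : State) : Comp → L2 :=
  Sum.elim (fun _ => V.n) (Sum.elim V.u (Sum.elim V.E V.B))

/-- The symbol of the curl operator. -/
def curlSymbol (k : R3) (i j : Fin 3) : ℂ :=
  Complex.I * ((if j = i + 2 then (k (i + 1) : ℂ) else 0) -
    if j = i + 1 then (k (i + 2) : ℂ) else 0)

/-- The symbol of the linearized system. -/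
def symbol (γ β μ : ℝ) (k : R3) : Matrix Comp Comp ℂ :=
  Matrix.fromBlocks 0 (Matrix.fromCols (Matrix.of fun _ j => -(γ * (Complex.I * k j))) 0)
    (Matrix.fromRows (Matrix.of fun i _ => -(γ * (Complex.I * k i))) 0)
    (Matrix.fromBlocks (Matrix.diagonal fun _ => -(μ * ‖k‖ ^ 2 : ℂ))
      (Matrix.fromCols (Matrix.diagonal fun _ => -(β : ℂ)) 0)
      (Matrix.fromRows (Matrix.diagonal fun _ => (β : ℂ)) 0)
      (Matrix.fromBlocks 0 (Matrix.of (curlSymbol k)) (-Matrix.of (curlSymbol k)) 0))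

theorem continuous_symbol (γ β μ : ℝ) : Continuous (symbol γ β μ) := by
  have hc : ∀ i j, Continuous fun k => curlSymbol k i j := fun i j => by
    unfold curlSymbol
    split_ifs <;> fun_prop
  refine continuous_matrix fun i j => ?_
  rcases i with i | i | i | i <;> rcases j with j | j | j | j <;>
  simp only [symbol, Matrix.fromBlocks_apply₁₁, Matrix.fromBlocks_apply₁₂,
    Matrix.fromBlocks_apply₂₁, Matrix.fromBlocks_apply₂₂, Matrix.fromCols_apply_inl,
    Matrix.fromCols_apply_inr, Matrix.fromRows_apply_inl, Matrix.fromRows_apply_inr,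
    Matrix.of_apply, Matrix.diagonal_apply, Matrix.zero_apply, Matrix.neg_apply] <;>
  (try split_ifs) <;> first | exact hc _ _ | exact (hc _ _).neg | fun_prop

theorem curlSymbol_sum (k : R3) (w : Fin 3 → ℂ) (i : Fin 3) :
    ∑ j, curlSymbol k i j * w j =
      Complex.I * (k (i + 1) * w (i + 2) - k (i + 2) * w (i + 1)) := by
  simp [curlSymbol, mul_assoc, sub_mul, mul_sub, Finset.sum_sub_distrib, ite_mul]

variable {γ β μ : ℝ} {U₀ : State} {U : ℝ → State}

theorem hasFourier_curl (F : Fin 3 → L2) (i : Fin 3) :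
    HasFourier (curl F i)
      (fun ξ => ∑ j, curlSymbol ((2 * Real.pi) • ξ) i j * (𝓕 (F j) : L2) ξ) := by
  refine HasFourier.congr (((hasFourier_toDist (F (i + 2))).pd (i + 1)).sub
    ((hasFourier_toDist (F (i + 1))).pd (i + 2))) fun ξ => ?_
  rw [curlSymbol_sum]
  simp
  ring

theorem hasFourier_divergence (F : Fin 3 → L2) :
    HasFourier (divergence F) (fun ξ => Complex.I *
      ∑ j, (((2 * Real.pi) • ξ) j : ℝ) * (𝓕 (F j) : L2) ξ) := by
  refine HasFourier.congr (HasFourier.sum Finset.univ fun j =>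
    (hasFourier_toDist (F j)).pd j) fun ξ => ?_
  simp [Finset.mul_sum, mul_assoc]

theorem locallyIntegrable_continuous_mul {g : R3 → ℂ} (hg : Continuous g) (f : L2) :
    LocallyIntegrable (fun ξ => g ξ * f ξ) := by
  have hf : LocallyIntegrable f := (Lp.memLp f).locallyIntegrable (by norm_num)
  rw [← locallyIntegrableOn_univ] at hf ⊢
  exact hf.continuousOn_mul hg.continuousOn isOpen_univ.isLocallyClosed

theorem locallyIntegrable_fourier_divergence (F : Fin 3 → L2) :
    LocallyIntegrable (fun ξ => Complex.I *
      ∑ j, (((2 * Real.pi) • ξ) j : ℝ) * (𝓕 (F j) : L2) ξ) := by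
  simp only [Finset.mul_sum, ← mul_assoc]
  refine locallyIntegrable_finsetSum _ fun j _ => locallyIntegrable_continuous_mul ?_ _
  fun_prop

theorem IsSolution.ae_div_E (hU : IsSolution γ β μ U₀ U) :
    ∀ᵐ ξ : R3, Complex.I * ∑ j, (((2 * Real.pi) • ξ) j : ℝ) * (𝓕 ((U 0).E j) : L2) ξ =
      -(β / γ * (𝓕 (U 0).n : L2) ξ) := by
  have h1 := hasFourier_divergence (U 0).E
  rw [hU.div_E 0 le_rfl] at h1
  have h2 := ((hasFourier_toDist (U 0).n).smul ((β / γ : ℝ) : ℂ)).neg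
  refine (h1.ae_eq h2 (locallyIntegrable_fourier_divergence _)
    (locallyIntegrable_continuous_mul continuous_const _).neg).mono fun ξ hξ => ?_
  simpa using hξ

theorem IsSolution.ae_div_B (hU : IsSolution γ β μ U₀ U) :
    ∀ᵐ ξ : R3, ∑ j, (((2 * Real.pi) • ξ) j : ℝ) * (𝓕 ((U 0).B j) : L2) ξ = 0 := by
  have h1 := hasFourier_divergence (U 0).B
  rw [hU.div_B 0 le_rfl] at h1
  refine (h1.ae_eq HasFourier.zero (locallyIntegrable_fourier_divergence _)
    locallyIntegrable_zero).mono fun ξ hξ => ?_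
  simpa using hξ

/-- The equations are tested on `𝓕 ψ`: the transform moves over to the fields and each spatial
derivative becomes a factor in `symbol`, at the rescaled frequency 2πξ. -/
theorem IsSolution.hasDerivAt_fourier (hU : IsSolution γ β μ U₀ U) {t : ℝ} (ht : 0 < t) (i : Comp)
    (ψ : 𝓢(R3, ℂ)) :
    HasDerivAt (fun s => ∫ ξ, ψ ξ * (𝓕 ((U s).comp i) : L2) ξ)
      (∫ ξ, ψ ξ * ∑ j, symbol γ β μ ((2 * Real.pi) • ξ) i j * (𝓕 ((U t).comp j) : L2) ξ) t := by
  have key : ∀ (f : ℝ → L2) (T : 𝓢'(R3, ℂ)) (h h' : R3 → ℂ), TimeDeriv f T t → HasFourier T h →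
      (∀ ξ, h' ξ = h ξ) →
      HasDerivAt (fun s => ∫ ξ, ψ ξ * (𝓕 (f s) : L2) ξ) (∫ ξ, ψ ξ * h' ξ) t := by
    intro f T h h' h1 h2 h3
    simp only [h3]
    rw [← (h2 ψ).2]
    simpa only [(hasFourier_toDist _ ψ).2] using h1 (𝓕 ψ)
  rcases i with i | i | i | i
  · refine key _ _ _ _ (hU.eq_n t ht) (((hasFourier_divergence _).smul γ).neg) fun ξ => ?_
    simp [symbol, State.comp, Fintype.sum_sum_type, Finset.mul_sum, mul_assoc]
  · refine key _ _ _ _ (hU.eq_u t ht i) ((((((hasFourier_toDist _).pd i).smul γ).neg).sub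
      ((hasFourier_toDist _).smul β)).add ((hasFourier_toDist _).laplacian.smul μ)) fun ξ => ?_
    simp [symbol, State.comp, Fintype.sum_sum_type, Matrix.diagonal_apply]
    ring
  · refine key _ _ _ _ (hU.eq_E t ht i) ((hasFourier_curl _ i).add
      ((hasFourier_toDist _).smul β)) fun ξ => ?_
    simp [symbol, State.comp, Fintype.sum_sum_type, Matrix.diagonal_apply, ite_mul]
    ring
  · refine key _ _ _ _ (hU.eq_B t ht i) (hasFourier_curl _ i).neg fun ξ => ?_
    simp [symbol, State.comp, Fintype.sum_sum_type]

/-- For almost every frequency, the Fourier transform of a solution is given by a solution of the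
ordinary differential equation at this frequency. -/
theorem IsSolution.ae_fourierODE (hU : IsSolution γ β μ U₀ U) {t : ℝ} (ht : 0 ≤ t) :
    ∀ᵐ ξ : R3, ∃ (n : ℝ → ℂ) (u E B : ℝ → Fin 3 → ℂ),
      FourierODE γ β μ ((2 * Real.pi) • ξ) n u E B ∧
      ∀ s, s = 0 ∨ s = t → (n s = (𝓕 (U s).n : L2) ξ ∧ (u s = fun i => (𝓕 ((U s).u i) : L2) ξ) ∧
        (E s = fun i => (𝓕 ((U s).E i) : L2) ξ) ∧ (B s = fun i => (𝓕 ((U s).B i) : L2) ξ)) := by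
  have hF : Continuous (fun f : L2 => (𝓕 f : L2)) := continuous_fourier
  have h1 := exists_pointwise_solution (μ := (volume : Measure R3))
    (m := fun ξ => symbol γ β μ ((2 * Real.pi) • ξ))
    (V := fun s i => (𝓕 ((U s).comp i) : L2))
    ((continuous_symbol γ β μ).comp (continuous_const_smul _))
    (by
      rintro (i | i | i | i)
      · exact hF.comp_continuousOn hU.cont_n
      · exact hF.comp_continuousOn (hU.cont_u i)
      · exact hF.comp_continuousOn (hU.cont_E i)
      · exact hF.comp_continuousOn (hU.cont_B i))
    (by
      intro t ht i φ g1 g2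
      have hg₁ : HasCompactSupport (Complex.ofRealCLM ∘ φ) := g2.comp_left rfl
      have hg₂ : ContDiff ℝ ∞ (Complex.ofRealCLM ∘ φ) := by fun_prop
      exact hU.hasDerivAt_fourier ht i (hg₁.toSchwartzMap hg₂)) ht
  filter_upwards [h1, hU.ae_div_E, hU.ae_div_B] with ξ ⟨y, hy, hy0, hyt⟩ hE hB
  have hy' := fun s => hasDerivAt_pi.1 (hy s)
  refine ⟨fun s => y s (Sum.inl ()), fun s i => y s (Sum.inr (Sum.inl i)),
    fun s i => y s (Sum.inr (Sum.inr (Sum.inl i))), fun s i => y s (Sum.inr (Sum.inr (Sum.inr i))),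
    ⟨?_, ?_, ?_, ?_, ?_, ?_⟩, ?_⟩
  · intro s
    refine (hy' s _).congr_deriv ?_
    simp [symbol, Matrix.mulVec, dotProduct, Fintype.sum_sum_type, Finset.mul_sum, mul_assoc]
  · intro s i
    refine (hy' s _).congr_deriv ?_
    simp [symbol, Matrix.mulVec, dotProduct, Fintype.sum_sum_type, Matrix.diagonal_apply]
    ring
  · intro s i
    refine (hy' s _).congr_deriv ?_
    simp [symbol, Matrix.mulVec, dotProduct, Fintype.sum_sum_type, Matrix.diagonal_apply,
      curlSymbol_sum]
    ring
  · intro s i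
    refine (hy' s _).congr_deriv ?_
    simp [symbol, Matrix.mulVec, dotProduct, Fintype.sum_sum_type, curlSymbol_sum]
  · simp only [hy0]
    exact hE
  · simp only [hy0]
    exact hB
  · rintro s (rfl | rfl)
    · simp only [hy0]
      exact ⟨rfl, rfl, rfl, rfl⟩
    · simp only [hyt]
      exact ⟨rfl, rfl, rfl, rfl⟩

end LinNSM

end

/-! ### From almost every frequency to every frequency -/

noncomputable section

namespace LinNSM

open Filter Topology Set
open scoped ContDiff

theorem ae_comp_inv_two_pi_smul {p : R3 → Prop} (h : ∀ᵐ ξ : R3, p ξ) :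
    ∀ᵐ k : R3, p ((2 * Real.pi)⁻¹ • k) :=
  (Measure.quasiMeasurePreserving_smul (volume : Measure R3)
    (inv_ne_zero (by positivity : (2 * Real.pi) ≠ 0))).ae h

theorem hatL1_eq (f : L2) (k : R3) : hatL1 f k = 𝓕 (f : R3 → ℂ) ((2 * Real.pi)⁻¹ • k) := by
  rw [Real.fourier_eq', hatL1]
  congr 1
  ext x
  rw [smul_eq_mul]
  congr 2
  rw [inner_smul_right, real_inner_comm]
  push_cast
  field_simp

theorem continuous_hatL1 {f : L2} (hf : Integrable f) : Continuous (hatL1 f) := by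
  have h1 : hatL1 f = fun k => 𝓕 (f : R3 → ℂ) ((2 * Real.pi)⁻¹ • k) := funext (hatL1_eq f)
  have h2 : Continuous (𝓕 (f : R3 → ℂ)) :=
    VectorFourier.fourierIntegral_continuous Real.continuous_fourierChar
      (by exact continuous_inner) hf
  rw [h1]
  exact h2.comp (continuous_const_smul _)

/-- This is the multiplication formula, which moves the transform from the test function to `f`. -/
theorem hasFourier_toDist_of_integrable {f : L2} (hf : Integrable f) :
    HasFourier (toDist f) (𝓕 (f : R3 → ℂ)) := fun ψ => by
  have h2 : Continuous (𝓕 (f : R3 → ℂ)) :=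
    VectorFourier.fourierIntegral_continuous Real.continuous_fourierChar
      (by exact continuous_inner) hf
  constructor
  · refine ψ.integrable.mul_bdd (c := ∫ x, ‖f x‖) h2.aestronglyMeasurable ?_
    exact Eventually.of_forall fun ξ =>
      VectorFourier.norm_fourierIntegral_le_integral_norm _ _ _ _ _
  · have h := VectorFourier.integral_fourierIntegral_smul_eq_flip (μ := (volume : Measure R3))
      (ν := (volume : Measure R3)) (L := innerₗ R3) Real.continuous_fourierChar continuous_inner
      ψ.integrable hf
    rw [toDist, Lp.toTemperedDistribution_apply]
    simp only [smul_eq_mul, flip_innerₗ] at h ⊢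
    exact h

/-- Both functions represent the Fourier transform of the same tempered distribution, and such a
representative is unique up to null sets. -/
theorem hatL1_ae_eq_hatL2 {f : L2} (hf : Integrable f) : hatL1 f =ᵐ[volume] hatL2 f := by
  have h2 : Continuous (𝓕 (f : R3 → ℂ)) :=
    VectorFourier.fourierIntegral_continuous Real.continuous_fourierChar
      (by exact continuous_inner) hf
  have h := (hasFourier_toDist_of_integrable hf).ae_eq (hasFourier_toDist f) h2.locallyIntegrable
    ((Lp.memLp _).locallyIntegrable (by norm_num))
  filter_upwards [ae_comp_inv_two_pi_smul h] with k hk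
  rw [hatL1_eq, hk, hatL2]

variable {γ β μ : ℝ} {U₀ : State} {U : ℝ → State}

/-- A solution of the system at the frequency `k` has the given transforms at time `t`. -/
def Represents (hat : L2 → R3 → ℂ) (V : State) (k : R3) (n : ℂ) (u E B : Fin 3 → ℂ) : Prop :=
  hat V.n k = n ∧ (∀ i, hat (V.u i) k = u i) ∧ (∀ i, hat (V.E i) k = E i) ∧
    ∀ i, hat (V.B i) k = B i

theorem IsSolution.ae_represents (hU : IsSolution γ β μ U₀ U) {t : ℝ} (ht : 0 ≤ t) :
    ∀ᵐ k : R3, ∃ (n : ℝ → ℂ) (u E B : ℝ → Fin 3 → ℂ), FourierODE γ β μ k n u E B ∧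
      Represents hatL2 U₀ k (n 0) (u 0) (E 0) (B 0) ∧
      Represents hatL2 (U t) k (n t) (u t) (E t) (B t) := by
  filter_upwards [ae_comp_inv_two_pi_smul (hU.ae_fourierODE ht)] with k
    ⟨n, u, E, B, h, h'⟩
  rw [smul_inv_smul₀ (by positivity)] at h
  refine ⟨n, u, E, B, h, ?_, ?_⟩
  · rw [← hU.init]
    obtain ⟨h1, h2, h3, h4⟩ := h' 0 (Or.inl rfl)
    simp [Represents, hatL2, h1, h2, h3, h4]
  · obtain ⟨h1, h2, h3, h4⟩ := h' t (Or.inr rfl)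
    simp [Represents, hatL2, h1, h2, h3, h4]

/-- The vector of lengths of the four unknowns. -/
def lengths (n : ℂ) (u E B : Fin 3 → ℂ) : Fin 4 → ℝ := ![‖n‖, vecNorm u, vecNorm E, vecNorm B]

theorem amplitudes_eq_lengths {hat : L2 → R3 → ℂ} {V : State} {k : R3} {n : ℂ} {u E B : Fin 3 → ℂ}
    (h : Represents hat V k n u E B) : amplitudes hat V k = lengths n u E B := by
  obtain ⟨h1, h2, h3, h4⟩ := h
  simp [amplitudes, lengths, h1, h2, h3, h4]

theorem amplitudes_hatL1_ae_eq {V : State} (hV : AllIntegrable V) :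
    amplitudes hatL1 V =ᵐ[volume] amplitudes hatL2 V := by
  obtain ⟨h1, h2, h3, h4⟩ := hV
  filter_upwards [hatL1_ae_eq_hatL2 h1, ae_all_iff.2 fun i => hatL1_ae_eq_hatL2 (h2 i),
    ae_all_iff.2 fun i => hatL1_ae_eq_hatL2 (h3 i), ae_all_iff.2 fun i => hatL1_ae_eq_hatL2 (h4 i)]
    with k h1 h2 h3 h4
  simp [amplitudes, h1, h2, h3, h4]

theorem continuous_amplitudes_hatL1 {V : State} (hV : AllIntegrable V) :
    Continuous (amplitudes hatL1 V) := by
  obtain ⟨h1, h2, h3, h4⟩ := hV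
  have c1 := continuous_hatL1 h1
  have c2 := fun i => continuous_hatL1 (h2 i)
  have c3 := fun i => continuous_hatL1 (h3 i)
  have c4 := fun i => continuous_hatL1 (h4 i)
  refine continuous_pi fun i => ?_
  fin_cases i <;> simp [amplitudes, vecNorm] <;> fun_prop

/-- A closed condition which holds almost everywhere on an open set holds on its closure. -/
theorem le_of_ae_of_mem_closure {O S : Set R3} (hO : IsOpen O) {f g : R3 → Fin 4 → ℝ}
    (hOS : O ⊆ S) (hf : ContinuousOn f S) (hg : ContinuousOn g S)
    (h : ∀ᵐ k : R3, k ∈ O → f k ≤ g k) {k : R3} (hk : k ∈ closure O) (hkS : k ∈ S) : f k ≤ g k := by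
  have h1 : O ⊆ closure (O ∩ {k | k ∈ O → f k ≤ g k}) := by
    exact (Measure.dense_of_ae h).open_subset_closure_inter hO
  have h2 : k ∈ closure (O ∩ {k | k ∈ O → f k ≤ g k}) := closure_minimal h1 isClosed_closure hk
  have h3 : (𝓝[O ∩ {k | k ∈ O → f k ≤ g k}] k).NeBot := mem_closure_iff_nhdsWithin_neBot.1 h2
  have hsub : O ∩ {k | k ∈ O → f k ≤ g k} ⊆ S := fun x hx => hOS hx.1
  refine le_of_tendsto_of_tendsto ((hf k hkS).mono_left (nhdsWithin_mono _ hsub))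
    ((hg k hkS).mono_left (nhdsWithin_mono _ hsub)) ?_
  filter_upwards [self_mem_nhdsWithin] with x hx using hx.2 hx.1

theorem continuousOn_GHigh (c t : ℝ) : ContinuousOn (fun κ => GHigh c t κ) (Ioi 0) := by
  unfold GHigh
  refine continuousOn_pi.2 fun i => continuousOn_pi.2 fun j => ?_
  fin_cases i <;> fin_cases j <;> simp <;>
  fun_prop (disch := intro x hx; first | exact ne_of_gt hx | exact pow_ne_zero _ (ne_of_gt hx))

theorem continuous_GLow (c t : ℝ) : Continuous (fun κ => GLow c t κ) := by
  unfold GLow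
  refine continuous_pi fun i => continuous_pi fun j => ?_
  fin_cases i <;> fin_cases j <;> simp <;> fun_prop

/-- For continuous amplitudes, bounds almost everywhere are bounds everywhere. -/
theorem boundAt_of_ae {ε L c C t : ℝ} (hε : 0 < ε) (hεL : ε < L) {a a₀ : R3 → Fin 4 → ℝ}
    (ha : Continuous a) (ha₀ : Continuous a₀) (h : ∀ᵐ k : R3, BoundAt ε L c C t a a₀ k) (k : R3) :
    BoundAt ε L c C t a a₀ k := by
  -- A nonzero frequency is approached along its own ray, so closures of radial regions reduce to
  -- closures of sets of radii. The region boundaries are reached this way; the frequency 0 is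
  -- reached as a point of the low-frequency ball.
  have hcl : ∀ (I : Set ℝ) (k : R3), k ≠ 0 → (∀ s ∈ I, 0 < s) → ‖k‖ ∈ closure I →
      k ∈ closure {k : R3 | ‖k‖ ∈ I} := by
    intro I k hk hI h
    have hk' : ‖k‖ ≠ 0 := norm_ne_zero_iff.2 hk
    have h1 := map_mem_closure (f := fun s : ℝ => (s * ‖k‖⁻¹) • k) (t := {k : R3 | ‖k‖ ∈ I})
      (by fun_prop) h fun s hs => by
        simp only [mem_ofPred_eq, norm_smul, norm_mul, norm_inv, norm_norm]
        rw [mul_assoc, inv_mul_cancel₀ hk', mul_one, Real.norm_of_nonneg (hI s hs).le]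
        exact hs
    simpa [mul_inv_cancel₀ hk'] using h1
  have hne : ∀ k : R3, ε ≤ ‖k‖ → k ≠ 0 := fun k hk => norm_pos_iff.1 (hε.trans_le hk)
  refine ⟨fun hk => ?_, fun hk1 hk2 => ?_, fun hk => ?_⟩
  · refine le_of_ae_of_mem_closure (O := Metric.ball 0 ε) (S := univ)
      (f := a) (g := fun k => C • (GLow c t ‖k‖).mulVec (a₀ k)) Metric.isOpen_ball (subset_univ _)
      ha.continuousOn ?_ (h.mono fun k hk h' => hk.1 (mem_ball_zero_iff.1 h').le) ?_ (mem_univ _)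
    · exact (((((continuous_GLow c t).comp continuous_norm).matrix_mulVec ha₀)).const_smul
        C).continuousOn
    · rw [closure_ball _ hε.ne']
      simpa using hk
  · refine le_of_ae_of_mem_closure (O := {k : R3 | ‖k‖ ∈ Ioo ε L}) (S := univ)
      (f := a) (g := fun k => C • (GMid c t).mulVec (a₀ k)) (isOpen_Ioo.preimage continuous_norm)
      (subset_univ _) ha.continuousOn ?_ (h.mono fun k hk h' => hk.2.1 h'.1.le h'.2.le)
      (hcl _ k (hne k hk1) (fun s hs => hε.trans hs.1) ?_) (mem_univ _)
    · exact ((continuous_const.matrix_mulVec ha₀).const_smul C).continuousOn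
    · rw [closure_Ioo hεL.ne]
      exact ⟨hk1, hk2⟩
  -- The high-frequency matrix contains inverse powers of the radius, so continuity is only claimed
  -- away from the origin.
  · refine le_of_ae_of_mem_closure (O := {k : R3 | ‖k‖ ∈ Ioi L}) (S := {k : R3 | ‖k‖ ∈ Ioi 0})
      (f := a) (g := fun k => C • (GHigh c t ‖k‖).mulVec (a₀ k))
      (isOpen_Ioi.preimage continuous_norm)
      (fun k hk => (hε.trans hεL).trans hk) ha.continuousOn ?_
      (h.mono fun k hk h' => hk.2.2 (le_of_lt h'))
      (hcl _ k (hne k (hεL.le.trans hk)) (fun s hs => (hε.trans hεL).trans hs) ?_)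
      ((hε.trans hεL).trans_le hk)
    · have h1 : ContinuousOn (fun k : R3 => GHigh c t ‖k‖) {k : R3 | ‖k‖ ∈ Ioi 0} :=
        (continuousOn_GHigh c t).comp continuous_norm.continuousOn fun k hk => hk
      refine ContinuousOn.const_smul (continuousOn_pi.2 fun i => ?_) C
      exact continuousOn_finsetSum Finset.univ fun j _ =>
        (continuousOn_pi.1 (continuousOn_pi.1 h1 i) j).mul
        ((continuous_apply j).comp ha₀).continuousOn
    · rw [closure_Ioi]
      exact hk

/-- Bounds for the solutions of the ordinary differential equations at almost every frequency are
bounds for the solutions of the system of partial differential equations. -/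
theorem bounds_of_fourierODE {ε L c C : ℝ} (hε : 0 < ε) (hεL : ε < L)
    (H : ∀ k : R3, k ≠ 0 → ∀ n u E B, FourierODE γ β μ k n u E B → ∀ t, 0 ≤ t →
      BoundAt ε L c C t (fun _ => lengths (n t) (u t) (E t) (B t))
        (fun _ => lengths (n 0) (u 0) (E 0) (B 0)) k)
    (hU : IsSolution γ β μ U₀ U) {t : ℝ} (ht : 0 ≤ t) :
    (∀ᵐ k : R3, BoundAt ε L c C t (amplitudes hatL2 (U t)) (amplitudes hatL2 U₀) k) ∧
      (AllIntegrable U₀ → AllIntegrable (U t) → ∀ k : R3,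
        BoundAt ε L c C t (amplitudes hatL1 (U t)) (amplitudes hatL1 U₀) k) := by
  have h1 : ∀ᵐ k : R3, BoundAt ε L c C t (amplitudes hatL2 (U t)) (amplitudes hatL2 U₀) k := by
    have h0 : ∀ᵐ k : R3, k ≠ 0 := by
      simp [ae_iff]
    filter_upwards [hU.ae_represents ht, h0] with k ⟨n, u, E, B, h, hr0, hrt⟩ hk
    have h2 := H k hk n u E B h t ht
    simp only [BoundAt, amplitudes_eq_lengths hr0, amplitudes_eq_lengths hrt] at h2 ⊢
    exact h2
  refine ⟨h1, fun i0 it k => boundAt_of_ae hε hεL (continuous_amplitudes_hatL1 it)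
    (continuous_amplitudes_hatL1 i0) ?_ k⟩
  filter_upwards [h1, amplitudes_hatL1_ae_eq i0, amplitudes_hatL1_ae_eq it] with k hk e0 et
  simp only [BoundAt, e0, et] at hk ⊢
  exact hk

end LinNSM

end

/-! ### Decay estimates for oscillators and for the transverse system at middle frequency -/

noncomputable section

namespace LinNSM

open Filter Topology Set

section ScalarODE

theorem hasDerivAt_re {f : ℝ → ℂ} {f' : ℂ} {r t : ℝ} (h : HasDerivAt f f' t) (hr : f'.re = r) :
    HasDerivAt (fun s => (f s).re) r t :=
  (Complex.reCLM.hasFDerivAt.comp_hasDerivAt t h).congr_deriv hr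

theorem hasDerivAt_im {f : ℝ → ℂ} {f' : ℂ} {r t : ℝ} (h : HasDerivAt f f' t) (hr : f'.im = r) :
    HasDerivAt (fun s => (f s).im) r t :=
  (Complex.imCLM.hasFDerivAt.comp_hasDerivAt t h).congr_deriv hr

theorem norm_eq_of_hasDerivAt_mul {f : ℝ → ℂ} {c : ℂ} (h : ∀ t, HasDerivAt f (c * f t) t) (t : ℝ) :
    ‖f t‖ = Real.exp (c.re * t) * ‖f 0‖ := by
  have h1 : ∀ s, HasDerivAt (fun s : ℝ => Complex.exp (-(c * s)) * f s) 0 s := fun s => by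
    have h2 : HasDerivAt (fun s : ℝ => -(c * (s : ℂ))) (-c) s := by
      have h3 := ((Complex.ofRealCLM.hasDerivAt (x := s)).const_mul c).neg
      exact h3.congr_deriv (by simp)
    refine (h2.cexp.mul (h s)).congr_deriv ?_
    ring
  have h3 := is_const_of_deriv_eq_zero (fun s => (h1 s).differentiableAt)
    (fun s => (h1 s).deriv) t 0
  simp only [Complex.ofReal_zero, mul_zero, neg_zero, Complex.exp_zero, one_mul] at h3
  have h4 : f t = Complex.exp (c * t) * f 0 := by
    rw [← h3, ← mul_assoc, ← Complex.exp_add]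
    simp
  rw [h4, norm_mul, Complex.norm_exp]
  simp

theorem le_exp_mul_of_hasDerivAt_le {f f' : ℝ → ℝ} {r : ℝ} (h : ∀ t, HasDerivAt f (f' t) t)
    (h' : ∀ t, f' t ≤ -(r * f t)) {t : ℝ} (ht : 0 ≤ t) : f t ≤ Real.exp (-(r * t)) * f 0 := by
  have h1 : ∀ s, HasDerivAt (fun s : ℝ => Real.exp (r * s) * f s)
      (Real.exp (r * s) * (f' s + r * f s)) s := fun s => by
    have h2 : HasDerivAt (fun s : ℝ => r * s) r s := by
      simpa using (hasDerivAt_id s).const_mul r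
    refine (h2.exp.mul (h s)).congr_deriv ?_
    ring
  have h3 : Antitone (fun s : ℝ => Real.exp (r * s) * f s) := by
    refine antitone_of_deriv_nonpos (fun s => (h1 s).differentiableAt) fun s => ?_
    rw [(h1 s).deriv]
    exact mul_nonpos_of_nonneg_of_nonpos (Real.exp_pos _).le (by linarith [h' s])
  have h4 := h3 ht
  simp only [mul_zero, Real.exp_zero, one_mul] at h4
  rw [Real.exp_neg, ← div_eq_inv_mul, le_div_iff₀ (Real.exp_pos _)]
  linarith

/-- The damped oscillator `x'' + δ x' + ω² x = 0`, not overdamped. -/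
theorem oscillator_bound {x y : ℝ → ℂ} {δ ω : ℝ} (hω : 0 < ω) (hδ : δ ^ 2 ≤ 3 * ω ^ 2)
    (hx : ∀ t, HasDerivAt x (y t) t) (hy : ∀ t, HasDerivAt y (-(δ * y t) - ω ^ 2 * x t) t) (t : ℝ) :
    ‖y t‖ + ω * ‖x t‖ ≤ 5 * (Real.exp (-(δ / 2 * t)) * (‖y 0‖ + ω * ‖x 0‖)) := by
  -- The roots are -δ/2 ± iν, and the bound on `δ` keeps them apart: 2ν ≥ ω.
  set ν : ℝ := Real.sqrt (ω ^ 2 - δ ^ 2 / 4) with hν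
  have hν2 : ν ^ 2 = ω ^ 2 - δ ^ 2 / 4 := Real.sq_sqrt (by nlinarith)
  have hν0 : 0 ≤ ν := Real.sqrt_nonneg _
  have hνω : ω ≤ 2 * ν := by
    refine le_of_sq_le_sq ?_ (by positivity)
    nlinarith
  -- For τ = ±ν, the combination y + (δ/2 + iτ)x is an eigencoordinate with rate -δ/2 + iτ. Its
  -- modulus is therefore known exactly, and x and y are recovered from the two combinations.
  have key : ∀ τ : ℝ, τ ^ 2 = ν ^ 2 → ‖(δ / 2 + τ * Complex.I : ℂ)‖ = ω ∧
      ∀ s, ‖y s + (δ / 2 + τ * Complex.I) * x s‖ ≤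
        Real.exp (-(δ / 2 * s)) * (‖y 0‖ + ω * ‖x 0‖) := by
    intro τ hτ
    have hn : ‖(δ / 2 + τ * Complex.I : ℂ)‖ = ω := by
      have : ‖(δ / 2 + τ * Complex.I : ℂ)‖ ^ 2 = ω ^ 2 := by
        rw [← Complex.normSq_eq_norm_sq, Complex.normSq_apply]
        simp
        nlinarith
      exact (pow_left_inj₀ (norm_nonneg _) hω.le two_ne_zero).1 this
    refine ⟨hn, fun s => ?_⟩
    have h1 := norm_eq_of_hasDerivAt_mul (c := -(δ / 2) + τ * Complex.I)
      (f := fun s => y s + (δ / 2 + τ * Complex.I) * x s) (fun s => by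
        refine ((hy s).add ((hx s).const_mul _)).congr_deriv ?_
        have h2 : (τ : ℂ) ^ 2 = ω ^ 2 - δ ^ 2 / 4 := by
          rw [hν2] at hτ
          exact_mod_cast hτ
        linear_combination (x s) * h2 - τ ^ 2 * x s * Complex.I_sq) s
    rw [h1]
    have h3 : (-(δ / 2 : ℂ) + τ * Complex.I).re = -(δ / 2) := by simp
    rw [h3, neg_mul]
    gcongr
    refine (norm_add_le _ _).trans_eq ?_
    rw [norm_mul, hn]
  obtain ⟨hn, h1⟩ := key ν rfl
  obtain ⟨-, h2⟩ := key (-ν) (by ring)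
  set R := Real.exp (-(δ / 2 * t)) * (‖y 0‖ + ω * ‖x 0‖)
  have h3 : 2 * ν * ‖x t‖ ≤ 2 * R := by
    have : (2 * ν * Complex.I : ℂ) * x t = (y t + (δ / 2 + ν * Complex.I) * x t) -
        (y t + (δ / 2 + (-ν : ℝ) * Complex.I) * x t) := by
      push_cast
      ring
    have h4 : ‖(2 * ν * Complex.I : ℂ) * x t‖ = 2 * ν * ‖x t‖ := by
      simp [abs_of_nonneg hν0]
    rw [← h4, this]
    linarith [norm_sub_le (y t + (δ / 2 + ν * Complex.I) * x t)
      (y t + (δ / 2 + (-ν : ℝ) * Complex.I) * x t), h1 t, h2 t]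
  have h4 : ω * ‖x t‖ ≤ 2 * R :=
    (mul_le_mul_of_nonneg_right hνω (norm_nonneg _)).trans h3
  have h5 : ‖y t‖ ≤ R + ω * ‖x t‖ := by
    have : y t = (y t + (δ / 2 + ν * Complex.I) * x t) - (δ / 2 + ν * Complex.I) * x t := by ring
    rw [this, ← hn, ← norm_mul]
    exact (norm_sub_le _ _).trans (add_le_add_left (h1 t) _)
  linarith

/-- The damped oscillator `x'' + δ x' + s₁ s₂ x = 0`, overdamped with exponents `s₁ < s₂`. -/
theorem overdamped_bound {x y : ℝ → ℂ} {s₁ s₂ : ℝ} (hs₁ : 0 < s₁) (hs : s₁ < s₂)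
    (hx : ∀ t, HasDerivAt x (y t) t)
    (hy : ∀ t, HasDerivAt y (-((s₁ + s₂ : ℝ) * y t) - (s₁ * s₂ : ℝ) * x t) t) (t : ℝ) :
    (s₂ - s₁) * ‖x t‖ ≤ Real.exp (-(s₁ * t)) * (‖y 0‖ + s₂ * ‖x 0‖) +
      Real.exp (-(s₂ * t)) * (‖y 0‖ + s₁ * ‖x 0‖) ∧
    (s₂ - s₁) * ‖y t‖ ≤ s₁ * (Real.exp (-(s₁ * t)) * (‖y 0‖ + s₂ * ‖x 0‖)) +
      s₂ * (Real.exp (-(s₂ * t)) * (‖y 0‖ + s₁ * ‖x 0‖)) := by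
  -- With `a` and `b` the two exponents in either order, y + bx is an eigencoordinate decaying
  -- exactly like exp(-at).
  have key : ∀ a b : ℝ, 0 < b → a + b = s₁ + s₂ → a * b = s₁ * s₂ →
      ‖y t + b * x t‖ ≤ Real.exp (-(a * t)) * (‖y 0‖ + b * ‖x 0‖) := by
    intro a b hb h1 h2
    have h3 := norm_eq_of_hasDerivAt_mul (c := -(a : ℂ)) (f := fun s => y s + b * x s) (fun s => by
      refine ((hy s).add ((hx s).const_mul _)).congr_deriv ?_
      rw [← h1, ← h2]
      push_cast
      ring) t
    rw [h3]
    have h4 : (-(a : ℂ)).re = -a := by simp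
    rw [h4, neg_mul]
    gcongr
    refine (norm_add_le _ _).trans_eq ?_
    rw [norm_mul, Complex.norm_real, Real.norm_of_nonneg hb.le]
  have h1 := key s₁ s₂ (hs₁.trans hs) rfl rfl
  have h2 := key s₂ s₁ hs₁ (add_comm _ _) (mul_comm _ _)
  have hd : 0 ≤ s₂ - s₁ := by linarith
  have hn : ∀ r : ℝ, 0 ≤ r → ∀ z : ℂ, r * ‖z‖ = ‖(r : ℂ) * z‖ := fun r hr z => by
    rw [norm_mul, Complex.norm_real, Real.norm_of_nonneg hr]
  constructor
  · rw [hn _ hd]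
    have : ((s₂ - s₁ : ℝ) : ℂ) * x t = (y t + s₂ * x t) - (y t + s₁ * x t) := by
      push_cast
      ring
    rw [this]
    exact (norm_sub_le _ _).trans (add_le_add h1 h2)
  · rw [hn _ hd]
    have : ((s₂ - s₁ : ℝ) : ℂ) * y t =
        (s₂ : ℂ) * (y t + s₁ * x t) - (s₁ : ℂ) * (y t + s₂ * x t) := by
      push_cast
      ring
    rw [this]
    refine (norm_sub_le _ _).trans ?_
    have hs₂ : 0 ≤ s₂ := (hs₁.trans hs).le
    rw [← hn _ hs₁.le, ← hn _ hs₂, add_comm]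
    gcongr

/-- The damped oscillator `x' = ω y`, `y' = -ω x - δ y`, with bounded damping. -/
theorem damped_bound_real {x y : ℝ → ℝ} {δ ω η m : ℝ} (hm : 0 < m) (hη : 0 < η) (hδ : 0 < δ)
    (hmω : m ≤ ω) (hηω : η * ω ≤ 1 / 4) (hηδ : η * δ ^ 2 ≤ m / 2) (hηδ' : η * δ ≤ 1 / 2)
    (hx : ∀ t, HasDerivAt x (ω * y t) t) (hy : ∀ t, HasDerivAt y (-(ω * x t) - δ * y t) t)
    {t : ℝ} (ht : 0 ≤ t) :
    x t ^ 2 + y t ^ 2 ≤ 3 * (Real.exp (-(η * m / 2 * δ * t)) * (x 0 ^ 2 + y 0 ^ 2)) := by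
  -- The energy x² + y² only dissipates y. The small cross term adds dissipation of x; its weight is
  -- proportional to `δ`, so the total decay rate is proportional to `δ` as well.
  set V : ℝ → ℝ := fun t => x t ^ 2 + y t ^ 2 + 2 * (η * δ) * (x t * y t) with hV
  have hηδ0 : 0 < η * δ := mul_pos hη hδ
  have hxy : ∀ s, |η * δ * (2 * (x s * y s))| ≤ 1 / 2 * (x s ^ 2 + y s ^ 2) := fun s => by
    rw [abs_mul, abs_of_pos hηδ0]
    refine mul_le_mul hηδ' (abs_le'.2 ⟨?_, ?_⟩) (abs_nonneg _) (by norm_num)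
    · linarith [sq_nonneg (x s - y s)]
    · linarith [sq_nonneg (x s + y s)]
  have hlow : ∀ s, (x s ^ 2 + y s ^ 2) / 2 ≤ V s := fun s => by
    simp only [hV]
    linarith [(abs_le.1 (hxy s)).1]
  have hup : ∀ s, V s ≤ 3 / 2 * (x s ^ 2 + y s ^ 2) := fun s => by
    simp only [hV]
    linarith [(abs_le.1 (hxy s)).2]
  have hd : ∀ s, HasDerivAt V (2 * (x s * (ω * y s)) + 2 * (y s * (-(ω * x s) - δ * y s)) +
      2 * (η * δ) * (ω * y s * y s + x s * (-(ω * x s) - δ * y s))) s := fun s => by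
    refine ((((hx s).pow 2).add ((hy s).pow 2)).add
      (((hx s).mul (hy s)).const_mul (2 * (η * δ)))).congr_deriv ?_
    push_cast
    ring
  have h1 := le_exp_mul_of_hasDerivAt_le (r := η * m / 2 * δ) hd (fun s => by
    have hω : 0 < ω := hm.trans_le hmω
    have e1 : -(η * m / 2 * (3 / 2 * (x s ^ 2 + y s ^ 2))) ≤ -(η * m / 2 * V s) := by
      have := hup s
      gcongr
    have e2 : η * m ≤ 1 / 4 := (mul_le_mul_of_nonneg_left hmω hη.le).trans hηω
    have e3 : -(2 * (η * δ * (x s * y s))) ≤ η * m * x s ^ 2 + 1 / 2 * y s ^ 2 := by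
      have f1 : 0 ≤ η * (m * x s + δ * y s) ^ 2 := by positivity
      have f2 : η * δ ^ 2 * y s ^ 2 ≤ m / 2 * y s ^ 2 := by gcongr
      have f3 : m * (-(2 * (η * δ * (x s * y s)))) ≤ m * (η * m * x s ^ 2 + 1 / 2 * y s ^ 2) := by
        linarith
      exact le_of_mul_le_mul_left f3 hm
    have e4 : η * m * x s ^ 2 ≤ η * ω * x s ^ 2 := by gcongr
    have e5 : η * ω * y s ^ 2 ≤ 1 / 4 * y s ^ 2 := by gcongr
    have e6 : η * m * y s ^ 2 ≤ 1 / 4 * y s ^ 2 := by gcongr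
    have e7 : -2 * y s ^ 2 + 2 * (η * ω * y s ^ 2) - 2 * (η * ω * x s ^ 2) -
        2 * (η * δ * (x s * y s)) ≤ -(η * m / 2 * V s) := by
      have f0 : 0 ≤ η * m * x s ^ 2 := by positivity
      linarith [sq_nonneg (y s)]
    calc _ = δ * (-2 * y s ^ 2 + 2 * (η * ω * y s ^ 2) - 2 * (η * ω * x s ^ 2) -
        2 * (η * δ * (x s * y s))) := by ring
      _ ≤ δ * (-(η * m / 2 * V s)) := by gcongr
      _ = _ := by ring) ht
  have h2 := hlow t
  have h3 := mul_le_mul_of_nonneg_left (hup 0) (Real.exp_pos (-(η * m / 2 * δ * t))).le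
  linarith

/-- Unlike in `oscillator_bound`, nothing is assumed on the sign of the discriminant: the rate is
uniform through critical damping and as `δ` tends to 0. Since the coefficients are real, the
Lyapunov estimate applies to real and imaginary parts separately; passing from squares to norms
halves the rate. -/
theorem exists_damped_bound {m K : ℝ} (hm : 0 < m) (hK : 0 < K) :
    ∃ c, 0 < c ∧ ∀ {δ ω : ℝ} {x y : ℝ → ℂ}, 0 < δ → δ ≤ K → m ≤ ω → ω ≤ K →
      (∀ t, HasDerivAt x (ω * y t) t) → (∀ t, HasDerivAt y (-(ω * x t) - δ * y t) t) →
      ∀ t, 0 ≤ t → ‖x t‖ + ‖y t‖ ≤ 3 * (Real.exp (-(c * δ * t)) * (‖x 0‖ + ‖y 0‖)) := by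
  -- The first entry gives ηω ≤ 1/4 and ηδ ≤ 1/2, the second ηδ² ≤ m/2.
  set η : ℝ := min (1 / (4 * K)) (m / (2 * K ^ 2)) with hη
  have hη0 : 0 < η := lt_min (by positivity) (by positivity)
  have hη1 : η * K ≤ 1 / 4 :=
    (mul_le_mul_of_nonneg_right (min_le_left _ _) hK.le).trans_eq (by field_simp)
  have hη2 : η * K ^ 2 ≤ m / 2 :=
    (mul_le_mul_of_nonneg_right (min_le_right _ _) (by positivity)).trans_eq (by field_simp)
  refine ⟨η * m / 4, by positivity, fun {δ ω x y} hδ hδK hmω hωK hx hy t ht => ?_⟩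
  have h1 : η * ω ≤ 1 / 4 := (mul_le_mul_of_nonneg_left hωK hη0.le).trans hη1
  have h2 : η * δ ^ 2 ≤ m / 2 := le_trans (by gcongr) hη2
  have h3 : η * δ ≤ 1 / 2 := (mul_le_mul_of_nonneg_left hδK hη0.le).trans (by linarith)
  have hre := damped_bound_real (x := fun t => (x t).re) (y := fun t => (y t).re)
    hm hη0 hδ hmω h1 h2
    h3 (fun t => hasDerivAt_re (hx t) (by simp))
    (fun t => hasDerivAt_re (hy t) (by simp)) ht
  have him := damped_bound_real (x := fun t => (x t).im) (y := fun t => (y t).im)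
    hm hη0 hδ hmω h1 h2
    h3 (fun t => hasDerivAt_im (hx t) (by simp))
    (fun t => hasDerivAt_im (hy t) (by simp)) ht
  have hsq : ∀ z : ℂ, ‖z‖ ^ 2 = z.re ^ 2 + z.im ^ 2 := fun z => by
    rw [← Complex.normSq_eq_norm_sq, Complex.normSq_apply]
    ring
  have h4 : ‖x t‖ ^ 2 + ‖y t‖ ^ 2 ≤
      3 * (Real.exp (-(η * m / 2 * δ * t)) * (‖x 0‖ ^ 2 + ‖y 0‖ ^ 2)) := by
    simp only [hsq]
    linarith
  refine le_of_sq_le_sq ?_ (by positivity)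
  have h5 : Real.exp (-(η * m / 2 * δ * t)) = Real.exp (-(η * m / 4 * δ * t)) ^ 2 := by
    rw [← Real.exp_nat_mul]
    congr 1
    push_cast
    ring
  rw [h5] at h4
  have h6 : 0 ≤ Real.exp (-(η * m / 4 * δ * t)) ^ 2 * (‖x 0‖ * ‖y 0‖) := by positivity
  have h7 : 0 ≤ Real.exp (-(η * m / 4 * δ * t)) ^ 2 * (‖x 0‖ ^ 2 + ‖y 0‖ ^ 2) := by positivity
  have h8 : (‖x t‖ + ‖y t‖) ^ 2 ≤ 2 * (‖x t‖ ^ 2 + ‖y t‖ ^ 2) := by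
    linarith [sq_nonneg (‖x t‖ - ‖y t‖)]
  have h9 : (3 * (Real.exp (-(η * m / 4 * δ * t)) * (‖x 0‖ + ‖y 0‖))) ^ 2 =
      9 * (Real.exp (-(η * m / 4 * δ * t)) ^ 2 * (‖x 0‖ ^ 2 + ‖y 0‖ ^ 2)) +
        18 * (Real.exp (-(η * m / 4 * δ * t)) ^ 2 * (‖x 0‖ * ‖y 0‖)) := by ring
  rw [h9]
  linarith

/-- The system satisfied by the transverse components of velocity, electric and magnetic field. -/
structure Transverse (β κ d : ℝ) (u E b : ℝ → ℂ) : Prop where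
  deriv_u : ∀ t, HasDerivAt u (-(β * E t) - d * u t) t
  deriv_E : ∀ t, HasDerivAt E (κ * b t + β * u t) t
  deriv_b : ∀ t, HasDerivAt b (-(κ * E t)) t

/-- The left side is half the derivative of the functional in `transverse_bound_real`, with (x, y,
z) = (u, E, b). Viscosity controls only x². The `θ` term produces -βy², the `θ * η` term produces
-κz², and Young's inequality puts the mixed products mostly on x². The sum of these x² errors,
weighted by `θ`, is absorbed by dx². -/
theorem transverse_quadratic_form_bound {m K η θ β κ d : ℝ} (hm : 0 < m) (hK : 0 < K) (hη : 0 < η)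
    (hθ : 0 < θ) (hη1 : η ≤ 1 / 2) (hη2 : η * K ≤ m / 2) (hθη1 : θ * η ≤ 1 / 8)
    (hθ2 : θ * (K + K ^ 2 / m + 2 * K ^ 2 / (η * m)) ≤ m / 2)
    (hβ : m ≤ β) (hβK : β ≤ K) (hκ : m ≤ κ) (hκK : κ ≤ K) (hd : m ≤ d) (hdK : d ≤ K) (x y z : ℝ) :
    -(d * x ^ 2) + θ * (-(β * y ^ 2) - d * (x * y) + κ * (x * z) + β * x ^ 2) -
      θ * η * (κ * z ^ 2 + β * (x * z) - κ * y ^ 2) ≤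
      -(θ * η * m / 2 * (x ^ 2 + y ^ 2 + z ^ 2)) := by
  have hβ0 : 0 < β := hm.trans_le hβ
  have hκ0 : 0 < κ := hm.trans_le hκ
  have hd0 : 0 < d := hm.trans_le hd
  have f1 : -(d * (x * y)) ≤ m / 4 * y ^ 2 + K ^ 2 / m * x ^ 2 := by
    have : 0 ≤ (m / 2 * y + d * x) ^ 2 / m := by positivity
    have e : (m / 2 * y + d * x) ^ 2 / m = m / 4 * y ^ 2 + d * (x * y) + d ^ 2 / m * x ^ 2 := by
      field_simp
      ring
    have : d ^ 2 / m * x ^ 2 ≤ K ^ 2 / m * x ^ 2 := by gcongr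
    linarith
  have f2 : (κ - η * β) * (x * z) ≤ η * m / 2 * z ^ 2 + 2 * K ^ 2 / (η * m) * x ^ 2 := by
    have hk : |κ - η * β| ≤ 2 * K := by
      have : η * β ≤ m / 2 := (mul_le_mul_of_nonneg_left hβK hη.le).trans hη2
      have : 0 < η * β := by positivity
      rw [abs_le]
      constructor <;> linarith
    have hk2 : (κ - η * β) ^ 2 ≤ 4 * K ^ 2 := by
      rw [← sq_abs]
      calc _ ≤ (2 * K) ^ 2 := by gcongr
        _ = _ := by ring
    have : 0 ≤ (η * m * z - (κ - η * β) * x) ^ 2 / (2 * (η * m)) := by positivity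
    have e : (η * m * z - (κ - η * β) * x) ^ 2 / (2 * (η * m)) =
        η * m / 2 * z ^ 2 - (κ - η * β) * (x * z) + (κ - η * β) ^ 2 / (2 * (η * m)) * x ^ 2 := by
      field_simp
      ring
    have : (κ - η * β) ^ 2 / (2 * (η * m)) * x ^ 2 ≤ 4 * K ^ 2 / (2 * (η * m)) * x ^ 2 := by
      gcongr
    have e2 : 4 * K ^ 2 / (2 * (η * m)) = 2 * K ^ 2 / (η * m) := by
      field_simp
      norm_num
    rw [e2] at this
    linarith
  have f3 : β * x ^ 2 ≤ K * x ^ 2 := by gcongr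
  have f4 : m * y ^ 2 ≤ β * y ^ 2 := by gcongr
  have f5 : η * κ * y ^ 2 ≤ m / 2 * y ^ 2 := by
    have : η * κ ≤ m / 2 := (mul_le_mul_of_nonneg_left hκK hη.le).trans hη2
    gcongr
  have f6 : η * m * z ^ 2 ≤ η * κ * z ^ 2 := by gcongr
  have f7 : -(β * y ^ 2) - d * (x * y) + κ * (x * z) + β * x ^ 2 -
      η * (κ * z ^ 2 + β * (x * z) - κ * y ^ 2) ≤
      (K + K ^ 2 / m + 2 * K ^ 2 / (η * m)) * x ^ 2 - m / 4 * y ^ 2 - η * m / 2 * z ^ 2 := by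
    linarith only [f1, f2, f3, f4, f5, f6]
  have f8 : θ * (-(β * y ^ 2) - d * (x * y) + κ * (x * z) + β * x ^ 2 -
      η * (κ * z ^ 2 + β * (x * z) - κ * y ^ 2)) ≤
      m / 2 * x ^ 2 - θ * m / 4 * y ^ 2 - θ * η * m / 2 * z ^ 2 := by
    have g1 := mul_le_mul_of_nonneg_left f7 hθ.le
    have g2 := mul_le_mul_of_nonneg_right hθ2 (sq_nonneg x)
    linarith only [g1, g2]
  have f9 : m * x ^ 2 ≤ d * x ^ 2 := by gcongr
  have f10 : θ * η * m / 2 * y ^ 2 ≤ θ * m / 4 * y ^ 2 := by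
    have : θ * m * η ≤ θ * m * (1 / 2) := by gcongr
    have : θ * η * m / 2 ≤ θ * m / 4 := by linarith
    gcongr
  have f11 : θ * η * m / 2 * x ^ 2 ≤ m / 2 * x ^ 2 := by
    have : θ * η * m ≤ 1 * m := by gcongr; linarith
    have : θ * η * m / 2 ≤ m / 2 := by linarith
    gcongr
  linarith only [f8, f9, f10, f11]

/-- Only u is damped directly. The damping passes to E through the coupling `β` and from E to b
through `κ`, and the cross terms uE and Eb in the Lyapunov functional follow this chain. -/
theorem transverse_bound_real {m K η θ β κ d : ℝ} (hm : 0 < m) (hK : 0 < K) (hη : 0 < η)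
    (hθ : 0 < θ) (hη1 : η ≤ 1 / 2) (hη2 : η * K ≤ m / 2) (hθ1 : θ ≤ 1 / 4)
    (hθ2 : θ * (K + K ^ 2 / m + 2 * K ^ 2 / (η * m)) ≤ m / 2)
    (hβ : m ≤ β) (hβK : β ≤ K) (hκ : m ≤ κ) (hκK : κ ≤ K) (hd : m ≤ d) (hdK : d ≤ K)
    {u E b : ℝ → ℝ} (hu : ∀ t, HasDerivAt u (-(β * E t) - d * u t) t)
    (hE : ∀ t, HasDerivAt E (κ * b t + β * u t) t) (hb : ∀ t, HasDerivAt b (-(κ * E t)) t)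
    {t : ℝ} (ht : 0 ≤ t) :
    u t ^ 2 + E t ^ 2 + b t ^ 2 ≤
      3 * (Real.exp (-(θ * η * m / 2 * t)) * (u 0 ^ 2 + E 0 ^ 2 + b 0 ^ 2)) := by
  set V : ℝ → ℝ := fun t => u t ^ 2 + E t ^ 2 + b t ^ 2 + 2 * θ * (u t * E t) -
    2 * (θ * η) * (E t * b t) with hV
  have hθη : 0 < θ * η := mul_pos hθ hη
  have hθη1 : θ * η ≤ 1 / 8 :=
    (mul_le_mul hθ1 hη1 hη.le (by norm_num)).trans_eq (by norm_num)
  have h2 : ∀ x y : ℝ, 2 * (x * y) ≤ x ^ 2 + y ^ 2 ∧ -(2 * (x * y)) ≤ x ^ 2 + y ^ 2 := fun x y =>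
    ⟨by linarith [sq_nonneg (x - y)], by linarith [sq_nonneg (x + y)]⟩
  have hc : ∀ (r s : ℝ) (x y : ℝ), 0 ≤ r → r ≤ s → |r * (2 * (x * y))| ≤ s * (x ^ 2 + y ^ 2) :=
    fun r s x y hr hrs => by
      rw [abs_mul, abs_of_nonneg hr]
      exact mul_le_mul hrs (abs_le'.2 (h2 x y)) (abs_nonneg _) (hr.trans hrs)
  have hlow : ∀ s, (u s ^ 2 + E s ^ 2 + b s ^ 2) / 2 ≤ V s := fun s => by
    have e1 := abs_le.1 (hc θ _ (u s) (E s) hθ.le hθ1)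
    have e2 := abs_le.1 (hc (θ * η) _ (E s) (b s) hθη.le hθη1)
    simp only [hV]
    linarith [sq_nonneg (u s), sq_nonneg (E s), sq_nonneg (b s)]
  have hup : ∀ s, V s ≤ 3 / 2 * (u s ^ 2 + E s ^ 2 + b s ^ 2) := fun s => by
    have e1 := abs_le.1 (hc θ _ (u s) (E s) hθ.le hθ1)
    have e2 := abs_le.1 (hc (θ * η) _ (E s) (b s) hθη.le hθη1)
    simp only [hV]
    linarith [sq_nonneg (u s), sq_nonneg (E s), sq_nonneg (b s)]
  have hdV : ∀ s, HasDerivAt V (2 * (-(d * u s ^ 2) +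
      θ * (-(β * E s ^ 2) - d * (u s * E s) + κ * (u s * b s) + β * u s ^ 2) -
      θ * η * (κ * b s ^ 2 + β * (u s * b s) - κ * E s ^ 2))) s := fun s => by
    refine ((((((hu s).pow 2).add ((hE s).pow 2)).add ((hb s).pow 2)).add
      (((hu s).mul (hE s)).const_mul (2 * θ))).sub
      (((hE s).mul (hb s)).const_mul (2 * (θ * η)))).congr_deriv ?_
    push_cast
    ring
  have h1 := le_exp_mul_of_hasDerivAt_le (r := θ * η * m / 2) hdV (fun s => by
    have f1 := transverse_quadratic_form_bound hm hK hη hθ hη1 hη2 hθη1 hθ2 hβ hβK hκ hκK hd hdK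
      (u s) (E s) (b s)
    have f2 := mul_le_mul_of_nonneg_left (hup s) (by positivity : 0 ≤ θ * η * m / 2)
    have f3 : 0 ≤ θ * η * m / 2 * (u s ^ 2 + E s ^ 2 + b s ^ 2) := by positivity
    linarith) ht
  have h2 := hlow t
  have h3 := mul_le_mul_of_nonneg_left (hup 0) (Real.exp_pos (-(θ * η * m / 2 * t))).le
  linarith

/-- The weights are fixed in the order `η`, then `θ`, because the error constant `A` that `θ` must
beat contains 1/η. -/
theorem exists_transverse_bound {m K : ℝ} (hm : 0 < m) (hK : 0 < K) :
    ∃ c, 0 < c ∧ ∀ {β κ d : ℝ} {u E b : ℝ → ℂ}, m ≤ β → β ≤ K → m ≤ κ → κ ≤ K → m ≤ d → d ≤ K →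
      Transverse β κ d u E b → ∀ t, 0 ≤ t →
      ‖u t‖ + ‖E t‖ + ‖b t‖ ≤ 3 * (Real.exp (-(c * t)) * (‖u 0‖ + ‖E 0‖ + ‖b 0‖)) := by
  set η : ℝ := min (1 / 2) (m / (2 * K)) with hη
  have hη0 : 0 < η := lt_min (by positivity) (by positivity)
  have hη1 : η ≤ 1 / 2 := min_le_left _ _
  have hη2 : η * K ≤ m / 2 :=
    (mul_le_mul_of_nonneg_right (min_le_right _ _) hK.le).trans_eq (by field_simp)
  set A := K + K ^ 2 / m + 2 * K ^ 2 / (η * m) with hA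
  have hA0 : 0 < A := by positivity
  set θ : ℝ := min (1 / 4) (m / (2 * A)) with hθ
  have hθ0 : 0 < θ := lt_min (by positivity) (by positivity)
  have hθ1 : θ ≤ 1 / 4 := min_le_left _ _
  have hθ2 : θ * A ≤ m / 2 :=
    (mul_le_mul_of_nonneg_right (min_le_right _ _) hA0.le).trans_eq (by field_simp)
  refine ⟨θ * η * m / 4, by positivity, fun {β κ d u E b} hβ hβK hκ hκK hd hdK h t ht => ?_⟩
  have hre := transverse_bound_real (u := fun t => (u t).re) (E := fun t => (E t).re)
    (b := fun t => (b t).re) hm hK hη0 hθ0 hη1 hη2 hθ1 hθ2 hβ hβK hκ hκK hd hdK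
    (fun t => hasDerivAt_re (h.deriv_u t) (by simp))
    (fun t => hasDerivAt_re (h.deriv_E t) (by simp))
    (fun t => hasDerivAt_re (h.deriv_b t) (by simp)) ht
  have him := transverse_bound_real (u := fun t => (u t).im) (E := fun t => (E t).im)
    (b := fun t => (b t).im) hm hK hη0 hθ0 hη1 hη2 hθ1 hθ2 hβ hβK hκ hκK hd hdK
    (fun t => hasDerivAt_im (h.deriv_u t) (by simp))
    (fun t => hasDerivAt_im (h.deriv_E t) (by simp))
    (fun t => hasDerivAt_im (h.deriv_b t) (by simp)) ht
  have hsq : ∀ z : ℂ, ‖z‖ ^ 2 = z.re ^ 2 + z.im ^ 2 := fun z => by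
    rw [← Complex.normSq_eq_norm_sq, Complex.normSq_apply]
    ring
  have h4 : ‖u t‖ ^ 2 + ‖E t‖ ^ 2 + ‖b t‖ ^ 2 ≤
      3 * (Real.exp (-(θ * η * m / 2 * t)) * (‖u 0‖ ^ 2 + ‖E 0‖ ^ 2 + ‖b 0‖ ^ 2)) := by
    simp only [hsq]
    linarith
  refine le_of_sq_le_sq ?_ (by positivity)
  have h5 : Real.exp (-(θ * η * m / 2 * t)) = Real.exp (-(θ * η * m / 4 * t)) ^ 2 := by
    rw [← Real.exp_nat_mul]
    congr 1
    push_cast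
    ring
  rw [h5] at h4
  set e := Real.exp (-(θ * η * m / 4 * t)) ^ 2 with he
  have h6 : 0 ≤ e * (‖u 0‖ * ‖E 0‖ + ‖u 0‖ * ‖b 0‖ + ‖E 0‖ * ‖b 0‖) := by positivity
  have h7 : (3 * (Real.exp (-(θ * η * m / 4 * t)) * (‖u 0‖ + ‖E 0‖ + ‖b 0‖))) ^ 2 =
      9 * (e * (‖u 0‖ ^ 2 + ‖E 0‖ ^ 2 + ‖b 0‖ ^ 2)) +
        18 * (e * (‖u 0‖ * ‖E 0‖ + ‖u 0‖ * ‖b 0‖ + ‖E 0‖ * ‖b 0‖)) := by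
    rw [he]
    ring
  rw [h7]
  have h8 : (‖u t‖ + ‖E t‖ + ‖b t‖) ^ 2 ≤ 3 * (‖u t‖ ^ 2 + ‖E t‖ ^ 2 + ‖b t‖ ^ 2) := by
    linarith [sq_nonneg (‖u t‖ - ‖E t‖), sq_nonneg (‖u t‖ - ‖b t‖), sq_nonneg (‖E t‖ - ‖b t‖)]
  linarith

end ScalarODE

end LinNSM

end

/-! ### The transverse system at low frequency -/

noncomputable section

namespace LinNSM

open Filter Topology Set

section TransverseBounds

/-- The characteristic polynomial of the transverse system has a real root `-σ`. -/
theorem exists_root {β κ d : ℝ} (hβ : 0 < β) (hκ : 0 < κ) (hd : 0 < d) :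
    ∃ σ, 0 < σ ∧ σ ≤ d ∧ (d - σ) * (κ ^ 2 + σ ^ 2) = β ^ 2 * σ := by
  have h := intermediate_value_Icc hd.le
    (f := fun s => β ^ 2 * s - (d - s) * (κ ^ 2 + s ^ 2)) (by fun_prop)
  obtain ⟨σ, hσ, h0⟩ := h (show (0 : ℝ) ∈ _ from ⟨by simp; positivity, by simp; positivity⟩)
  refine ⟨σ, hσ.1.lt_of_ne ?_, hσ.2, by simpa [sub_eq_zero, eq_comm] using h0⟩
  rintro rfl
  simp at h0
  rcases h0 with h0 | h0 <;> linarith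

/-- The splitting of a transverse solution along the real eigenvector and the complementary
invariant plane. -/
theorem Transverse.exists_decomposition {β κ d σ S D : ℝ} {u E b : ℝ → ℂ}
    (h : Transverse β κ d u E b) (hσ : (d - σ) * S = β ^ 2 * σ)
    (hS : S = κ ^ 2 + σ ^ 2) (hD : D = S ^ 2 - β ^ 2 * σ ^ 2 + β ^ 2 * κ ^ 2) (hD0 : D ≠ 0) :
    ∃ q v F a : ℝ → ℂ, Transverse β κ d v F a ∧
      (∀ t, S * v t + β * σ * F t = β * κ * a t) ∧
      (∀ t, u t = v t + S * q t ∧ E t = F t - β * σ * q t ∧ b t = a t - β * κ * q t) ∧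
      (∀ t, D * q t = S * u t + β * σ * E t - β * κ * b t) ∧
      ∀ t, ‖q t‖ = Real.exp (-(σ * t)) * ‖q 0‖ := by
  have hσ' : (d - σ) * S = (β ^ 2 * σ : ℂ) := by exact_mod_cast hσ
  have hS' : (S : ℂ) = κ ^ 2 + σ ^ 2 := by exact_mod_cast hS
  have hD' : (D : ℂ) = S ^ 2 - β ^ 2 * σ ^ 2 + β ^ 2 * κ ^ 2 := by exact_mod_cast hD
  have hD0' : (D : ℂ) ≠ 0 := by exact_mod_cast hD0
  -- The eigenvalue -σ has right eigenvector (S, -βσ, -βκ) and left eigenvector (S, βσ, -βκ), whose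
  -- pairing is `D`. Thus `q` is the coordinate along the eigenvector, and the remainder lies in the
  -- kernel of the left eigenvector, which is the stated linear constraint.
  set q : ℝ → ℂ := fun t => (D : ℂ)⁻¹ * (S * u t + β * σ * E t - β * κ * b t) with hq
  have hq' : ∀ t, HasDerivAt q (-σ * q t) t := fun t => by
    refine (((((h.deriv_u t).const_mul (S : ℂ)).add ((h.deriv_E t).const_mul (β * σ : ℂ))).sub
      ((h.deriv_b t).const_mul (β * κ : ℂ))).const_mul (D : ℂ)⁻¹).congr_deriv ?_
    simp only [hq]
    linear_combination (D : ℂ)⁻¹ * (-hσ' * u t - hS' * β * E t)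
  refine ⟨q, fun t => u t - S * q t, fun t => E t + β * σ * q t, fun t => b t + β * κ * q t,
    ⟨fun t => ?_, fun t => ?_, fun t => ?_⟩, fun t => ?_, fun t => ⟨?_, ?_, ?_⟩, fun t => ?_,
    fun t => ?_⟩
  · refine ((h.deriv_u t).sub ((hq' t).const_mul _)).congr_deriv ?_
    linear_combination (-q t) * hσ'
  · refine ((h.deriv_E t).add ((hq' t).const_mul _)).congr_deriv ?_
    linear_combination β * q t * hS'
  · refine ((h.deriv_b t).add ((hq' t).const_mul _)).congr_deriv ?_
    ring
  · have : (D : ℂ) * q t = S * u t + β * σ * E t - β * κ * b t := by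
      simp only [hq, mul_inv_cancel_left₀ hD0']
    linear_combination -this + q t * hD'
  · ring
  · ring
  · ring
  · simp only [hq, mul_inv_cancel_left₀ hD0']
  · rw [norm_eq_of_hasDerivAt_mul (c := -(σ : ℂ)) hq' t]
    simp

theorem norm_real_mul {r : ℝ} (hr : 0 ≤ r) (z : ℂ) : ‖(r : ℂ) * z‖ = r * ‖z‖ := by
  rw [norm_mul, Complex.norm_real, Real.norm_of_nonneg hr]

/-- The norm estimates that follow from the splitting. -/
theorem Transverse.exists_decomposition_norm {β κ d σ S D : ℝ} {u E b : ℝ → ℂ}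
    (h : Transverse β κ d u E b) (hσ : (d - σ) * S = β ^ 2 * σ)
    (hS : S = κ ^ 2 + σ ^ 2) (hD : D = S ^ 2 - β ^ 2 * σ ^ 2 + β ^ 2 * κ ^ 2)
    (hβ : 0 < β) (hκ : 0 < κ) (hσ0 : 0 < σ) (hD0 : 0 < D) :
    ∃ q v F a : ℝ → ℂ, Transverse β κ d v F a ∧
      (∀ t, S * v t + β * σ * F t = β * κ * a t) ∧
      (∀ t, β * κ * ‖a t‖ ≤ S * ‖v t‖ + β * σ * ‖F t‖ ∧
        S * ‖v t‖ ≤ β * σ * ‖F t‖ + β * κ * ‖a t‖) ∧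
      (∀ t, ‖u t‖ ≤ ‖v t‖ + S * ‖q t‖ ∧ ‖E t‖ ≤ ‖F t‖ + β * σ * ‖q t‖ ∧
        ‖b t‖ ≤ ‖a t‖ + β * κ * ‖q t‖) ∧
      (∀ t, ‖v t‖ ≤ ‖u t‖ + S * ‖q t‖ ∧ ‖F t‖ ≤ ‖E t‖ + β * σ * ‖q t‖ ∧
        ‖a t‖ ≤ ‖b t‖ + β * κ * ‖q t‖) ∧
      (∀ t, D * ‖q t‖ ≤ S * ‖u t‖ + β * σ * ‖E t‖ + β * κ * ‖b t‖) ∧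
      ∀ t, ‖q t‖ = Real.exp (-(σ * t)) * ‖q 0‖ := by
  obtain ⟨q, v, F, a, hZ, hcon, hdec, hq, hqn⟩ := h.exists_decomposition hσ hS hD hD0.ne'
  have hS0 : 0 ≤ S := by rw [hS]; positivity
  have n1 : ∀ z : ℂ, S * ‖z‖ = ‖(S : ℂ) * z‖ := fun z => (norm_real_mul hS0 z).symm
  have n2 : ∀ z : ℂ, β * σ * ‖z‖ = ‖(β * σ : ℂ) * z‖ := fun z => by
    rw [← Complex.ofReal_mul, norm_real_mul (by positivity)]
  have n3 : ∀ z : ℂ, β * κ * ‖z‖ = ‖(β * κ : ℂ) * z‖ := fun z => by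
    rw [← Complex.ofReal_mul, norm_real_mul (by positivity)]
  refine ⟨q, v, F, a, hZ, hcon, fun t => ⟨?_, ?_⟩, fun t => ?_, fun t => ?_, fun t => ?_, hqn⟩
  · rw [n1, n2, n3, ← hcon]
    exact norm_add_le _ _
  · rw [n1, n2, n3, ← hcon, add_comm]
    exact norm_le_add_norm_add _ _
  · obtain ⟨h1, h2, h3⟩ := hdec t
    rw [n1, n2, n3, h1, h2, h3]
    exact ⟨norm_add_le _ _, norm_sub_le _ _, norm_sub_le _ _⟩
  · obtain ⟨h1, h2, h3⟩ := hdec t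
    rw [n1, n2, n3, eq_sub_of_add_eq h1.symm, eq_add_of_sub_eq h2.symm, eq_add_of_sub_eq h3.symm]
    exact ⟨norm_sub_le _ _, norm_add_le _ _, norm_add_le _ _⟩
  · rw [← norm_real_mul hD0.le, hq, n1, n2, n3]
    exact (norm_sub_le _ _).trans (add_le_add_left (norm_add_le _ _) _)

/-- For small κ the sum `S` is comparable to κ², so the root equation reads β²σ ≈ dκ² = μκ⁴. Hence σ
is of order κ⁴, negligible against d, and D is at least of order κ². -/
theorem low_root_bounds {β μ κ d σ S : ℝ} (hβ : 0 < β) (hμ : 0 < μ) (hκ : 0 < κ)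
    (hκ1 : κ ≤ 1 / 2) (hκ2 : κ ≤ β / 2) (hκ3 : μ * κ ≤ 1 / 2)
    (hd : d = μ * κ ^ 2) (hS : S = κ ^ 2 + σ ^ 2) (hσ0 : 0 < σ) (hσd : σ ≤ d)
    (hσ : (d - σ) * S = β ^ 2 * σ) :
    d ≤ β / 2 ∧ σ ≤ 2 * μ / β ^ 2 * κ ^ 4 ∧ S ≤ 2 * κ ^ 2 ∧
      3 / 4 * (β ^ 2 * κ ^ 2) ≤ S ^ 2 - β ^ 2 * σ ^ 2 + β ^ 2 * κ ^ 2 ∧ σ ≤ d / 3 ∧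
      μ / (2 * β ^ 2) * κ ^ 4 ≤ σ := by
  have hd0 : 0 < d := by rw [hd]; positivity
  have hS0 : 0 < S := by rw [hS]; positivity
  have hdβ : d ≤ β / 2 := by
    have : μ * κ * κ ≤ 1 / 2 * (β / 2) := mul_le_mul hκ3 hκ2 hκ.le (by norm_num)
    rw [hd]
    linarith
  have hdκ : d ≤ κ / 2 := by
    have : μ * κ * κ ≤ 1 / 2 * κ := by gcongr
    rw [hd]
    linarith
  have hσA' : 3 / 4 * (β ^ 2 * σ) ≤ μ * κ ^ 4 := by
    have h1 : σ * σ ≤ d * σ := mul_le_mul_of_nonneg_right hσd hσ0.le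
    have h2 : d * d ≤ β / 2 * (β / 2) := mul_le_mul hdβ hdβ hd0.le (by positivity)
    have h3 : (d - σ) * S ≤ d * S := mul_le_mul_of_nonneg_right (by linarith) hS0.le
    have h4 : d * (σ * σ) ≤ d * (d * σ) := mul_le_mul_of_nonneg_left h1 hd0.le
    have h5 : d * d * σ ≤ β / 2 * (β / 2) * σ := mul_le_mul_of_nonneg_right h2 hσ0.le
    have h6 : d * S = μ * κ ^ 4 + d * (σ * σ) := by rw [hS, hd]; ring
    linarith
  have hσA : σ ≤ 2 * μ / β ^ 2 * κ ^ 4 := by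
    rw [div_mul_eq_mul_div, le_div_iff₀ (by positivity)]
    have : 0 < μ * κ ^ 4 := by positivity
    linarith
  have hσκ : σ ≤ κ / 2 := hσd.trans hdκ
  have hσκ2 : σ ^ 2 ≤ κ ^ 2 / 4 := by nlinarith
  have hS2 : S ≤ 2 * κ ^ 2 := by nlinarith
  have hDlow : 3 / 4 * (β ^ 2 * κ ^ 2) ≤ S ^ 2 - β ^ 2 * σ ^ 2 + β ^ 2 * κ ^ 2 := by
    have : β ^ 2 * σ ^ 2 ≤ β ^ 2 * (κ ^ 2 / 4) := by gcongr
    nlinarith [sq_nonneg S]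
  have hσd3 : σ ≤ d / 3 := by
    have h1 : μ * κ ^ 4 ≤ d * (β ^ 2 / 4) := by
      have : κ ^ 2 ≤ β ^ 2 / 4 := by nlinarith
      calc μ * κ ^ 4 = d * κ ^ 2 := by rw [hd]; ring
        _ ≤ _ := by gcongr
    have h2 : β ^ 2 * σ ≤ β ^ 2 * (d / 3) := by linarith
    exact le_of_mul_le_mul_left h2 (by positivity)
  refine ⟨hdβ, hσA, hS2, hDlow, hσd3, ?_⟩
  rw [div_mul_eq_mul_div, div_le_iff₀ (by positivity)]
  have h2 : 0 ≤ (d - σ) * σ ^ 2 := mul_nonneg (by linarith) (sq_nonneg _)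
  have h3 : κ ^ 2 * σ ≤ β ^ 2 * σ := by
    gcongr
    linarith
  have h4 : d * κ ^ 2 = μ * κ ^ 4 := by rw [hd]; ring
  rw [hS] at hσ
  linarith

/-- The left eigenvector has entries of sizes κ², κ⁴ and κ, and dividing by D costs κ². The slow
amplitude therefore weighs the data, up to an overall factor κ, by (κ, κ³, 1). -/
theorem low_slow_mode_bound {β A κ σ S D x y z q R : ℝ} (hβ : 0 < β) (hA0 : 0 < A) (hκ : 0 < κ)
    (hσA : σ ≤ A * κ ^ 4) (hS2 : S ≤ 2 * κ ^ 2) (hDlow : 3 / 4 * (β ^ 2 * κ ^ 2) ≤ D)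
    (hx : 0 ≤ x) (hy : 0 ≤ y) (hz : 0 ≤ z) (hq : 0 ≤ q)
    (h1 : D * q ≤ S * x + β * σ * y + β * κ * z) (hR : R = κ * x + κ ^ 3 * y + z) :
    κ * q ≤ 2 * (2 + β * A + β) / β ^ 2 * R := by
  have hR0 : 0 ≤ R := by rw [hR]; positivity
  set M : ℝ := 2 * (2 + β * A + β) / β ^ 2 with hM
  have h2 : S * x + β * σ * y + β * κ * z ≤
      2 * κ ^ 2 * x + β * (A * κ ^ 4) * y + β * κ * z := by gcongr
  have h3 : 2 * κ ^ 2 * x + β * (A * κ ^ 4) * y + β * κ * z ≤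
      (2 + β * A + β) * (κ * R) := by
    have e1 : 0 ≤ κ ^ 2 * x := by positivity
    have e2 : 0 ≤ κ ^ 4 * y := by positivity
    have e3 : 0 ≤ κ * z := by positivity
    have e4 : 0 < β * A := by positivity
    rw [hR]
    nlinarith [mul_nonneg hβ.le e1, mul_nonneg hβ.le e2, mul_nonneg e4.le e1, mul_nonneg e4.le e3]
  have h4 : 3 / 4 * (β ^ 2 * κ ^ 2) * q ≤ D * q := by gcongr
  have h5 : M * β ^ 2 = 2 * (2 + β * A + β) := by rw [hM]; field_simp
  have h6 : (3 / 4 * β ^ 2 * κ) * (κ * q) ≤ (3 / 4 * β ^ 2 * κ) * (M * R) := by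
    have : 0 ≤ κ * R := by positivity
    have : 0 ≤ (2 + β * A + β) * (κ * R) := by positivity
    calc _ = 3 / 4 * (β ^ 2 * κ ^ 2) * q := by ring
      _ ≤ (2 + β * A + β) * (κ * R) := by linarith
      _ ≤ 3 / 4 * (2 * (2 + β * A + β)) * (κ * R) := by linarith
      _ = 3 / 4 * (M * β ^ 2) * (κ * R) := by rw [h5]
      _ = _ := by ring
  exact le_of_mul_le_mul_left h6 (by positivity)

/-- The constraint eliminates `a`, leaving a plasma oscillation for `v` with damping d - σ and
squared frequency comparable to β². -/
theorem low_fast_mode_bound {β κ d σ S : ℝ} {v F a : ℝ → ℂ} (hβ : 0 < β) (hκ : 0 < κ)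
    (hκ2 : κ ≤ β / 2) (hd0 : 0 < d) (hdβ : d ≤ β / 2) (hσ0 : 0 < σ) (hσd : σ ≤ d)
    (hS : S = κ ^ 2 + σ ^ 2) (hZ : Transverse β κ d v F a)
    (hcon : ∀ t, S * v t + β * σ * F t = β * κ * a t) (t : ℝ) :
    ‖v t‖ ≤ 30 * (Real.exp (-((d - σ) / 2 * t)) * (‖v 0‖ + ‖F 0‖)) ∧
      ‖F t‖ ≤ 30 * (Real.exp (-((d - σ) / 2 * t)) * (‖v 0‖ + ‖F 0‖)) := by
  set e₂ := Real.exp (-((d - σ) / 2 * t))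
  have hS0 : 0 < S := by rw [hS]; positivity
  -- This is the product of the two remaining characteristic roots.
  set w := S + β ^ 2 - σ * d with hw
  have hσd2 : σ * d ≤ β ^ 2 / 4 :=
    (mul_le_mul (hσd.trans hdβ) hdβ hd0.le (by positivity)).trans_eq (by ring)
  have hd2 : (d - σ) ^ 2 ≤ (β / 2) ^ 2 := by
    gcongr
    linarith
  have hκβ : κ ^ 2 ≤ (β / 2) ^ 2 := by gcongr
  have hσσ : σ ^ 2 ≤ σ * d := by
    rw [sq]
    gcongr
  have hw1 : 3 / 4 * β ^ 2 ≤ w := by linarith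
  have hw2 : w ≤ 2 * β ^ 2 := by
    rw [hw, hS]
    nlinarith
  set ω := Real.sqrt w with hω
  have hω2 : ω ^ 2 = w := Real.sq_sqrt (by linarith [sq_nonneg β])
  have hω0 : 0 < ω := Real.sqrt_pos.2 (by linarith [pow_pos hβ 2])
  have hω1 : β / 2 ≤ ω := le_of_sq_le_sq (by rw [hω2]; linarith [sq_nonneg β]) hω0.le
  have hω3 : ω ≤ 2 * β := le_of_sq_le_sq (by rw [hω2]; linarith [sq_nonneg β]) (by positivity)
  have hosc := oscillator_bound (x := v) (y := fun t => -(β * F t) - d * v t) (δ := d - σ) (ω := ω)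
    hω0 (by rw [hω2]; linarith) hZ.deriv_u (fun s => by
      refine (((hZ.deriv_E s).const_mul (β : ℂ)).neg.sub
        ((hZ.deriv_u s).const_mul (d : ℂ))).congr_deriv ?_
      have h1 : (ω : ℂ) ^ 2 = S + β ^ 2 - σ * d := by exact_mod_cast hω2
      rw [h1]
      push_cast
      linear_combination hcon s) t
  have hy : ∀ s, β * ‖F s‖ ≤ ‖-(β * F s) - d * v s‖ + d * ‖v s‖ ∧
      ‖-(β * F s) - d * v s‖ ≤ β * ‖F s‖ + d * ‖v s‖ := fun s => by
    rw [← norm_real_mul hβ.le, ← norm_real_mul hd0.le]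
    constructor
    · calc ‖(β : ℂ) * F s‖ = ‖(-(β * F s) - d * v s) + d * v s‖ := by
            rw [← norm_neg]
            congr 1
            ring
        _ ≤ _ := norm_add_le _ _
    · exact (norm_sub_le _ _).trans_eq (by rw [norm_neg])
  set W := ‖v 0‖ + ‖F 0‖ with hW
  have hW0 : 0 ≤ W := by positivity
  have hmain : ‖-(β * F t) - d * v t‖ + ω * ‖v t‖ ≤ 15 * β * (e₂ * W) := by
    refine hosc.trans ?_
    have h1 : ‖-(β * F 0) - d * v 0‖ + ω * ‖v 0‖ ≤ 3 * β * W := by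
      have e1 := (hy 0).2
      have e2 : d * ‖v 0‖ ≤ β / 2 * ‖v 0‖ := by gcongr
      have e3 : ω * ‖v 0‖ ≤ 2 * β * ‖v 0‖ := by gcongr
      have e4 : 0 ≤ β * ‖F 0‖ := by positivity
      have e5 : 0 ≤ β * ‖v 0‖ := by positivity
      rw [hW]
      linarith
    calc _ ≤ 5 * (e₂ * (3 * β * W)) := by gcongr
      _ = _ := by ring
  have hv : ‖v t‖ ≤ 30 * (e₂ * W) := by
    have h1 : β / 2 * ‖v t‖ ≤ ω * ‖v t‖ := by gcongr
    have h2 : β * ‖v t‖ ≤ β * (30 * (e₂ * W)) := by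
      linarith [norm_nonneg (-(β * F t) - d * v t)]
    exact le_of_mul_le_mul_left h2 hβ
  have hF : ‖F t‖ ≤ 30 * (e₂ * W) := by
    have h1 : d * ‖v t‖ ≤ ω * ‖v t‖ := by
      gcongr
      linarith
    have h2 : β * ‖F t‖ ≤ β * (30 * (e₂ * W)) := by
      have : 0 ≤ β * (e₂ * W) := by positivity
      linarith [(hy t).1]
    exact le_of_mul_le_mul_left h2 hβ
  exact ⟨hv, hF⟩

-- The slow eigenvector (S, -βσ, -βκ) is κ times a vector of size (κ, κ³, 1), and its dual weighs
-- the data by the same sizes, which explains the slow part. The fast part lives on the invariant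
-- plane, where the constraint makes the magnetic component smaller by a factor κ, whence the sizes
-- (1, 1, κ).
set_option maxHeartbeats 400000 in
theorem exists_transverse_low_bound {β μ : ℝ} (hβ : 0 < β) (hμ : 0 < μ) :
    ∃ ε₀ c₀ K, 0 < ε₀ ∧ 0 < c₀ ∧ 0 < K ∧ ∀ {c κ : ℝ} {u E b : ℝ → ℂ}, c ≤ c₀ → 0 < κ → κ ≤ ε₀ →
      Transverse β κ (μ * κ ^ 2) u E b → ∀ t, 0 ≤ t →
      ‖u t‖ ≤ K * (Real.exp (-(c * κ ^ 2 * t)) * (‖u 0‖ + ‖E 0‖ + κ * ‖b 0‖) +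
        κ * (Real.exp (-(c * κ ^ 4 * t)) * (κ * ‖u 0‖ + κ ^ 3 * ‖E 0‖ + ‖b 0‖))) ∧
      ‖E t‖ ≤ K * (Real.exp (-(c * κ ^ 2 * t)) * (‖u 0‖ + ‖E 0‖ + κ * ‖b 0‖) +
        κ ^ 3 * (Real.exp (-(c * κ ^ 4 * t)) * (κ * ‖u 0‖ + κ ^ 3 * ‖E 0‖ + ‖b 0‖))) ∧
      ‖b t‖ ≤ K * (κ * (Real.exp (-(c * κ ^ 2 * t)) * (‖u 0‖ + ‖E 0‖ + κ * ‖b 0‖)) +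
        Real.exp (-(c * κ ^ 4 * t)) * (κ * ‖u 0‖ + κ ^ 3 * ‖E 0‖ + ‖b 0‖)) := by
  set A : ℝ := 2 * μ / β ^ 2 with hA
  have hA0 : 0 < A := by positivity
  set M : ℝ := 2 * (2 + β * A + β) / β ^ 2 with hM
  have hM0 : 0 < M := by positivity
  set N : ℝ := 1 + (2 + β * A) * M with hN
  have hN0 : 0 < N := by positivity
  set P : ℝ := (2 + β * A) / β with hP
  have hP0 : 0 < P := by positivity
  -- The threshold collects the smallness conditions of `low_root_bounds`. In the rate, μ/4 serves
  -- the fast modes, since (d - σ)/2 ≥ d/3, and μ/(2β²) is the lower bound for σ/κ⁴.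
  refine ⟨min (1 / 2) (min (β / 2) (1 / (2 * μ))),
    min (μ / 4) (μ / (2 * β ^ 2)), 30 * N + 30 * P * N + (2 + β * A + β) * M, by positivity,
    by positivity, by positivity, fun {c κ u E b} hc hκ hκε h t ht => ?_⟩
  have hκ1 : κ ≤ 1 / 2 := hκε.trans (min_le_left _ _)
  have hκ2 : κ ≤ β / 2 := hκε.trans ((min_le_right _ _).trans (min_le_left _ _))
  have hκ3 : μ * κ ≤ 1 / 2 := by
    have : κ ≤ 1 / (2 * μ) :=
      hκε.trans ((min_le_right _ _).trans (min_le_right _ _))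
    exact (mul_le_mul_of_nonneg_left this hμ.le).trans_eq (by field_simp)
  set d := μ * κ ^ 2 with hd
  have hd0 : 0 < d := by positivity
  obtain ⟨σ, hσ0, hσd, hσ⟩ := exists_root hβ hκ hd0
  set S := κ ^ 2 + σ ^ 2 with hS
  have hS0 : 0 < S := by positivity
  set D := S ^ 2 - β ^ 2 * σ ^ 2 + β ^ 2 * κ ^ 2 with hD
  obtain ⟨hdβ, hσA, hS2, hDlow, hσd3, hσlow⟩ :=
    low_root_bounds hβ hμ hκ hκ1 hκ2 hκ3 hd hS hσ0 hσd hσ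
  have hD0 : 0 < D := lt_of_lt_of_le (by positivity) hDlow
  obtain ⟨q, v, F, a, hZ, hcon, hcon', hdec, hdec', hq, hqn⟩ :=
    h.exists_decomposition_norm hσ hS hD hβ hκ hσ0 hD0
  set R := κ * ‖u 0‖ + κ ^ 3 * ‖E 0‖ + ‖b 0‖ with hR
  set Q := ‖u 0‖ + ‖E 0‖ + κ * ‖b 0‖ with hQ
  have hR0 : 0 ≤ R := by positivity
  have hQ0 : 0 ≤ Q := by positivity
  have hκ13 : κ ^ 3 ≤ κ := by
    calc κ ^ 3 = κ * κ ^ 2 := by ring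
      _ ≤ κ * 1 := by gcongr; nlinarith
      _ = κ := mul_one _
  have hκR : κ * R ≤ Q := by
    have h1 : κ ^ 2 * ‖u 0‖ ≤ 1 * ‖u 0‖ := by gcongr; nlinarith
    have h2 : κ ^ 4 * ‖E 0‖ ≤ 1 * ‖E 0‖ := by
      gcongr
      exact pow_le_one₀ hκ.le (by linarith)
    rw [hR, hQ]
    linarith
  have hq0 : κ * ‖q 0‖ ≤ M * R := low_slow_mode_bound hβ hA0 hκ hσA hS2 hDlow (norm_nonneg _)
    (norm_nonneg _) (norm_nonneg _) (norm_nonneg _) (hq 0) hR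
  set e₁ := Real.exp (-(c * κ ^ 4 * t)) with he₁
  set e₂ := Real.exp (-(c * κ ^ 2 * t)) with he₂
  have hcσ : c * κ ^ 4 ≤ σ := by
    have h1 : c * κ ^ 4 ≤ μ / (2 * β ^ 2) * κ ^ 4 := by
      gcongr
      exact hc.trans (min_le_right _ _)
    exact h1.trans hσlow
  have hqt : κ * ‖q t‖ ≤ M * (e₁ * R) := by
    rw [hqn t]
    calc κ * (Real.exp (-(σ * t)) * ‖q 0‖) = Real.exp (-(σ * t)) * (κ * ‖q 0‖) := by ring
      _ ≤ e₁ * (M * R) := by rw [he₁]; gcongr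
      _ = _ := by ring
  set W := ‖v 0‖ + ‖F 0‖ with hW
  have hW0 : 0 ≤ W := by positivity
  have hexp : Real.exp (-((d - σ) / 2 * t)) ≤ e₂ := by
    rw [he₂]
    have h1 : c * κ ^ 2 ≤ μ / 4 * κ ^ 2 := by
      gcongr
      exact hc.trans (min_le_left _ _)
    have h2 : c * κ ^ 2 ≤ (d - σ) / 2 := by linarith
    gcongr
  obtain ⟨hv, hF⟩ : ‖v t‖ ≤ 30 * (e₂ * W) ∧ ‖F t‖ ≤ 30 * (e₂ * W) := by
    obtain ⟨h1, h2⟩ := low_fast_mode_bound hβ hκ hκ2 hd0 hdβ hσ0 hσd hS hZ hcon t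
    exact ⟨h1.trans (by gcongr), h2.trans (by gcongr)⟩
  -- The magnetic component is read off the constraint, where division by βκ leaves one factor κ.
  have ha : ‖a t‖ ≤ 30 * P * (κ * (e₂ * W)) := by
    have h1 := (hcon' t).1
    have h2 : S * ‖v t‖ + β * σ * ‖F t‖ ≤ 2 * κ ^ 2 * (30 * (e₂ * W)) +
        β * (A * κ ^ 2) * (30 * (e₂ * W)) := by
      gcongr
      refine hσA.trans ?_
      gcongr 1
      exact pow_le_pow_of_le_one hκ.le (by linarith) (by norm_num)
    have h3 : P * β = 2 + β * A := by rw [hP]; field_simp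
    have h4 : β * κ * ‖a t‖ ≤ β * κ * (30 * P * (κ * (e₂ * W))) := by
      calc _ ≤ _ := h1.trans h2
        _ = 30 * (2 + β * A) * κ ^ 2 * (e₂ * W) := by ring
        _ = 30 * (P * β) * κ ^ 2 * (e₂ * W) := by rw [h3]
        _ = _ := by ring
    exact le_of_mul_le_mul_left h4 (by positivity)
  have hslow : ∀ s (X : ℝ), κ * ‖q s‖ ≤ X → S * ‖q s‖ ≤ 2 * κ * X ∧
      β * σ * ‖q s‖ ≤ β * A * κ ^ 3 * X := fun s X hX => by
    constructor
    · calc S * ‖q s‖ ≤ 2 * κ ^ 2 * ‖q s‖ := by gcongr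
        _ = 2 * κ * (κ * ‖q s‖) := by ring
        _ ≤ _ := by gcongr
    · calc β * σ * ‖q s‖ ≤ β * (A * κ ^ 4) * ‖q s‖ := by gcongr
        _ = β * A * κ ^ 3 * (κ * ‖q s‖) := by ring
        _ ≤ _ := by gcongr
  -- The initial fast part is the data minus their slow part; the latter enters v and F with a
  -- factor κR at most, and κR ≤ Q.
  have hWQ : W ≤ N * Q := by
    obtain ⟨h3, h4, -⟩ := hdec' 0
    obtain ⟨h1, h2⟩ := hslow 0 _ hq0
    have h5 : 2 * κ * (M * R) ≤ 2 * M * Q := by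
      calc 2 * κ * (M * R) = 2 * M * (κ * R) := by ring
        _ ≤ _ := by gcongr
    have h6 : β * A * κ ^ 3 * (M * R) ≤ β * A * M * Q := by
      calc β * A * κ ^ 3 * (M * R) ≤ β * A * κ * (M * R) := by gcongr
        _ = β * A * M * (κ * R) := by ring
        _ ≤ _ := by gcongr
    have h7 : 0 ≤ κ * ‖b 0‖ := by positivity
    have h8 : N * Q = Q + 2 * M * Q + β * A * M * Q := by rw [hN]; ring
    rw [h8]
    linarith
  have hfast : e₂ * W ≤ N * (e₂ * Q) := by
    calc e₂ * W ≤ e₂ * (N * Q) := by gcongr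
      _ = _ := by ring
  obtain ⟨hu, hE, hb⟩ := hdec t
  obtain ⟨h1, h2⟩ := hslow t _ hqt
  set X := e₁ * R with hX
  set Y := e₂ * Q with hY
  have hX0 : 0 ≤ X := by positivity
  have hY0 : 0 ≤ Y := by positivity
  have hsum : ∀ {z z₁ z₂ : ℝ} (k₁ k₂ : ℝ), 0 ≤ k₁ → 0 ≤ k₂ →
      z₁ ≤ (30 * N + 30 * P * N) * (k₁ * Y) → z₂ ≤ (2 + β * A + β) * M * (k₂ * X) → z ≤ z₁ + z₂ →
      z ≤ (30 * N + 30 * P * N + (2 + β * A + β) * M) * (k₁ * Y + k₂ * X) := by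
    intro z z₁ z₂ k₁ k₂ hk₁ hk₂ g1 g2 g3
    have e1 : 0 ≤ (30 * N + 30 * P * N) * (k₂ * X) := by positivity
    have e2 : 0 ≤ (2 + β * A + β) * M * (k₁ * Y) := by positivity
    linarith
  refine ⟨?_, ?_, ?_⟩
  · have := hsum (z := ‖u t‖) (z₁ := ‖v t‖) (z₂ := S * ‖q t‖) 1 κ zero_le_one hκ.le ?_ ?_ ?_
    · simpa only [one_mul] using this
    · have : 0 ≤ 30 * P * N * Y := by positivity
      linarith
    · refine h1.trans ?_
      have : 0 ≤ (β * A + β) * M * (κ * X) := by positivity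
      linarith
    · exact hu
  · have := hsum (z := ‖E t‖) (z₁ := ‖F t‖) (z₂ := β * σ * ‖q t‖) 1 (κ ^ 3) zero_le_one
      (by positivity) ?_ ?_ ?_
    · simpa only [one_mul] using this
    · have : 0 ≤ 30 * P * N * Y := by positivity
      linarith
    · refine h2.trans ?_
      have : 0 ≤ (2 + β) * M * (κ ^ 3 * X) := by positivity
      linarith
    · exact hE
  · have := hsum (z := ‖b t‖) (z₁ := ‖a t‖) (z₂ := β * κ * ‖q t‖) κ 1 hκ.le zero_le_one ?_ ?_ ?_
    · simpa only [one_mul] using this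
    · refine ha.trans ?_
      have e1 : 30 * P * (κ * (e₂ * W)) ≤ 30 * P * (κ * (N * Y)) := by gcongr
      have : 0 ≤ 30 * N * (κ * Y) := by positivity
      linarith
    · have e1 : β * (κ * ‖q t‖) ≤ β * (M * X) := by gcongr
      have : 0 ≤ (2 + β * A) * M * X := by positivity
      linarith
    · exact hb

end TransverseBounds

end LinNSM

end

/-! ### The transverse system at high frequency -/

noncomputable section

namespace LinNSM

open Filter Topology Set

section TransverseHigh

/-- For large κ the root is close to d, so `S` is comparable to σ² and the root equation gives d - σ
of order β²/d. The lower bound on d - σ is the weak damping of the electromagnetic waves. The last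
two bounds express that the eigenvector, divided by `S`, has size (1, κ⁻², κ⁻³). -/
theorem high_root_bounds {β μ κ d σ S : ℝ} (hβ : 0 < β) (hμ : 0 < μ)
    (hκ1 : 1 ≤ κ) (hκ2 : 2 * β ≤ κ) (hκ3 : 2 ≤ μ * κ) (hκ4 : 2 * β ^ 2 ≤ μ * κ)
    (hd : d = μ * κ ^ 2) (hS : S = κ ^ 2 + σ ^ 2) (hσ0 : 0 < σ) (hσd : σ ≤ d)
    (hσ : (d - σ) * S = β ^ 2 * σ) :
    d / 2 ≤ σ ∧ 4 * β ^ 2 ≤ S ∧ d - σ ≤ κ ∧ β ^ 2 ≤ 2 * d * (d - σ) ∧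
      β * σ ≤ (2 * β / μ + 4 * β / μ ^ 2) * (κ⁻¹ ^ 2 * S) ∧
      β * κ ≤ (2 * β / μ + 4 * β / μ ^ 2) * (κ⁻¹ ^ 3 * S) := by
  have hκ0 : 0 < κ := one_pos.trans_le hκ1
  have hd0 : 0 < d := by rw [hd]; positivity
  have hS0 : 0 < S := by rw [hS]; positivity
  have hβκ : 4 * β ^ 2 ≤ κ ^ 2 := by
    calc 4 * β ^ 2 = (2 * β) ^ 2 := by ring
      _ ≤ κ ^ 2 := by gcongr
  have h1 : d / 2 ≤ σ := by
    have e1 : (d - σ) * κ ^ 2 ≤ (d - σ) * S := by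
      gcongr
      rw [hS]
      linarith [sq_nonneg σ]
    have e2 : β ^ 2 * σ ≤ κ ^ 2 / 4 * σ := by
      gcongr
      linarith
    have e3 : (d - σ) * κ ^ 2 ≤ σ / 4 * κ ^ 2 := by linarith
    have e4 : d - σ ≤ σ / 4 := le_of_mul_le_mul_right e3 (by positivity)
    linarith
  have h2 : σ ^ 2 ≤ S := by
    rw [hS]
    linarith [sq_nonneg κ]
  have hκσ : κ ≤ σ := by
    have : 2 * κ ≤ μ * κ * κ := by gcongr
    rw [hd] at h1
    linarith
  have h3 : (d - σ) * σ ≤ β ^ 2 := by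
    have : (d - σ) * σ ^ 2 ≤ (d - σ) * S := by
      gcongr
    have : (d - σ) * σ * σ ≤ β ^ 2 * σ := by linarith
    exact le_of_mul_le_mul_right this hσ0
  have h4 : S ≤ 2 * σ ^ 2 := by
    have : κ ^ 2 ≤ σ ^ 2 := by gcongr
    linarith
  refine ⟨h1, ?_, ?_, ?_, ?_, ?_⟩
  · rw [hS]
    linarith [sq_nonneg σ]
  · have e1 : (d - σ) * (d / 2) ≤ (d - σ) * σ := by
      gcongr
    have e2 : (d - σ) * κ * (μ * κ) ≤ 1 * (μ * κ) := by
      rw [hd] at e1 h3 ⊢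
      linarith
    have e3 : (d - σ) * κ ≤ 1 := le_of_mul_le_mul_right e2 (by positivity)
    have e4 : (d - σ) * 1 ≤ (d - σ) * κ := by
      gcongr
    linarith
  · have e1 : β ^ 2 * σ ≤ (d - σ) * (2 * σ ^ 2) := by
      rw [← hσ]
      gcongr
    have e2 : β ^ 2 * σ ≤ 2 * (d - σ) * σ * σ := by linarith
    have e3 : β ^ 2 ≤ 2 * (d - σ) * σ := le_of_mul_le_mul_right e2 hσ0
    have e4 : 2 * (d - σ) * σ ≤ 2 * (d - σ) * d := by
      gcongr
    linarith
  · calc β * σ ≤ 2 * β / μ * (κ⁻¹ ^ 2 * (d / 2 * σ * 1)) * (1 * 1)  := by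
          rw [hd]
          field_simp
          norm_num
      _ ≤ (2 * β / μ + 4 * β / μ ^ 2) * (κ⁻¹ ^ 2 * (σ * σ * 1)) * (1 * 1) := by
          gcongr
          have : 0 < 4 * β / μ ^ 2 := by positivity
          linarith
      _ ≤ (2 * β / μ + 4 * β / μ ^ 2) * (κ⁻¹ ^ 2 * S) := by
          rw [mul_one, mul_one, mul_one, ← sq]
          gcongr
  · calc β * κ = 4 * β / μ ^ 2 * (κ⁻¹ ^ 3 * (d / 2 * (d / 2))) := by
          rw [hd]
          field_simp
          norm_num
      _ ≤ (2 * β / μ + 4 * β / μ ^ 2) * (κ⁻¹ ^ 3 * (σ * σ)) := by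
          gcongr
          have : 0 < 2 * β / μ := by positivity
          linarith
      _ ≤ (2 * β / μ + 4 * β / μ ^ 2) * (κ⁻¹ ^ 3 * S) := by
          rw [← sq]
          gcongr

/-- Here the constraint eliminates `v`, and `a` solves a weakly damped wave equation whose frequency
is comparable to κ. Dividing by κ turns the oscillator energy into ‖F‖ + ‖a‖. -/
theorem high_wave_mode_bound {β κ d σ S : ℝ} {v F a : ℝ → ℂ} (hκ : 0 < κ) (hS0 : 0 < S)
    (hβS : 4 * β ^ 2 ≤ S) (hσd : σ ≤ d) (hδκ : d - σ ≤ κ) (hσ : (d - σ) * S = β ^ 2 * σ)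
    (hZ : Transverse β κ d v F a) (hcon : ∀ t, S * v t + β * σ * F t = β * κ * a t) (t : ℝ) :
    ‖F t‖ + ‖a t‖ ≤ 10 * (Real.exp (-((d - σ) / 2 * t)) * (‖F 0‖ + ‖a 0‖)) := by
  set e := Real.exp (-((d - σ) / 2 * t))
  -- The product of the two remaining roots is dκ²/σ, which equals κ²(1 + β²/S) by the root
  -- equation.
  set ω := κ * Real.sqrt (1 + β ^ 2 / S) with hω
  have hr : 0 ≤ β ^ 2 / S := by positivity
  have hr1 : β ^ 2 / S ≤ 1 := by
    rw [div_le_one hS0]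
    linarith [sq_nonneg β]
  have h1 : 1 ≤ Real.sqrt (1 + β ^ 2 / S) := Real.one_le_sqrt.2 (by linarith)
  have h2 : Real.sqrt (1 + β ^ 2 / S) ≤ 2 := Real.sqrt_le_iff.2 ⟨by norm_num, by linarith⟩
  have hω1 : κ ≤ ω := le_mul_of_one_le_right hκ.le h1
  have hω2 : ω ≤ κ * 2 := mul_le_mul_of_nonneg_left h2 hκ.le
  have hω3 : S * ω ^ 2 = κ ^ 2 * (S + β ^ 2) := by
    rw [hω, mul_pow, Real.sq_sqrt (by linarith)]
    field_simp
  have hω0 : 0 < ω := hκ.trans_le hω1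
  have hosc := oscillator_bound (x := a) (y := fun t => -(κ * F t)) (δ := d - σ) (ω := ω)
    hω0 (by
      have : (d - σ) ^ 2 ≤ ω ^ 2 := pow_le_pow_left₀ (by linarith) (hδκ.trans hω1) 2
      linarith [sq_nonneg ω]) hZ.deriv_b (fun s => by
      refine ((hZ.deriv_E s).const_mul (κ : ℂ)).neg.congr_deriv ?_
      have e1 : (S : ℂ) * ω ^ 2 = κ ^ 2 * (S + β ^ 2) := by exact_mod_cast hω3
      have e2 : ((d : ℂ) - σ) * S = β ^ 2 * σ := by exact_mod_cast hσ
      have e3 : (S : ℂ) ≠ 0 := by exact_mod_cast hS0.ne'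
      refine mul_left_cancel₀ e3 ?_
      push_cast
      linear_combination a s * e1 - κ * F s * e2 - β * κ * hcon s) t
  have hn : ∀ s, ‖-((κ : ℂ) * F s)‖ = κ * ‖F s‖ := fun s => by rw [norm_neg, norm_real_mul hκ.le]
  rw [hn, hn] at hosc
  have h3 : κ * (‖F t‖ + ‖a t‖) ≤ κ * (10 * (e * (‖F 0‖ + ‖a 0‖))) := by
    calc κ * (‖F t‖ + ‖a t‖) ≤ κ * ‖F t‖ + ω * ‖a t‖ := by
          rw [mul_add]
          gcongr
      _ ≤ 5 * (e * (κ * ‖F 0‖ + ω * ‖a 0‖)) := hosc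
      _ ≤ 5 * (e * (κ * 2 * ‖F 0‖ + κ * 2 * ‖a 0‖)) := by
          gcongr
          linarith
      _ = _ := by ring
  exact le_of_mul_le_mul_left h3 hκ

/-- The eigenvector now carries the parabolic mode, of size (1, κ⁻², κ⁻³) in the fields and in the
data. The invariant plane carries the waves, of size (κ⁻², 1, 1), their velocity being read off the
constraint. -/
theorem exists_transverse_high_bound {β μ : ℝ} (hβ : 0 < β) (hμ : 0 < μ) :
    ∃ L₀ c₀ K, 1 ≤ L₀ ∧ 0 < c₀ ∧ 0 < K ∧ ∀ {c κ : ℝ} {u E b : ℝ → ℂ}, c ≤ c₀ → L₀ ≤ κ →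
      Transverse β κ (μ * κ ^ 2) u E b → ∀ t, 0 ≤ t →
      ‖u t‖ ≤ K * (Real.exp (-(c * κ ^ 2 * t)) * (‖u 0‖ + κ⁻¹ ^ 2 * ‖E 0‖ + κ⁻¹ ^ 3 * ‖b 0‖) +
        κ⁻¹ ^ 2 * (Real.exp (-(c * t / κ ^ 2)) * (κ⁻¹ ^ 2 * ‖u 0‖ + ‖E 0‖ + ‖b 0‖))) ∧
      ‖E t‖ ≤ K * (κ⁻¹ ^ 2 *
          (Real.exp (-(c * κ ^ 2 * t)) * (‖u 0‖ + κ⁻¹ ^ 2 * ‖E 0‖ + κ⁻¹ ^ 3 * ‖b 0‖)) +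
        Real.exp (-(c * t / κ ^ 2)) * (κ⁻¹ ^ 2 * ‖u 0‖ + ‖E 0‖ + ‖b 0‖)) ∧
      ‖b t‖ ≤ K * (κ⁻¹ ^ 3 *
          (Real.exp (-(c * κ ^ 2 * t)) * (‖u 0‖ + κ⁻¹ ^ 2 * ‖E 0‖ + κ⁻¹ ^ 3 * ‖b 0‖)) +
        Real.exp (-(c * t / κ ^ 2)) * (κ⁻¹ ^ 2 * ‖u 0‖ + ‖E 0‖ + ‖b 0‖)) := by
  set A : ℝ := 2 * β / μ + 4 * β / μ ^ 2 with hA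
  have hA0 : 0 < A := by positivity
  set M : ℝ := 2 * (1 + A) with hM
  have hM0 : 0 < M := by positivity
  set N : ℝ := 10 * (1 + 2 * A * M) with hN
  have hN0 : 0 < N := by positivity
  -- The threshold collects the hypotheses of `high_root_bounds`. The rate entries come from σ ≥ d/2
  -- and from (d - σ)/2 ≥ β²/(4d).
  refine ⟨max 1 (max (2 * β) (max (2 / μ) (2 * β ^ 2 / μ))),
    min (μ / 2) (β ^ 2 / (4 * μ)), (1 + A) * (N + M), le_max_left _ _, by positivity,
    by positivity, fun {c κ u E b} hc hκL h t ht => ?_⟩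
  obtain ⟨hκ1, hκL⟩ := max_le_iff.1 hκL
  obtain ⟨hκ2, hκL⟩ := max_le_iff.1 hκL
  obtain ⟨hκ3, hκ4⟩ := max_le_iff.1 hκL
  rw [div_le_iff₀' hμ] at hκ3 hκ4
  obtain ⟨hc1, hc2⟩ := le_min_iff.1 hc
  have hκ : 0 < κ := one_pos.trans_le hκ1
  set d := μ * κ ^ 2 with hd
  have hd0 : 0 < d := by positivity
  obtain ⟨σ, hσ0, hσd, hσ⟩ := exists_root hβ hκ hd0
  set S := κ ^ 2 + σ ^ 2 with hS
  have hS0 : 0 < S := by positivity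
  set D := S ^ 2 - β ^ 2 * σ ^ 2 + β ^ 2 * κ ^ 2 with hD
  obtain ⟨hσlow, hβS, hδκ, hδlow, hA2, hA3⟩ :=
    high_root_bounds hβ hμ hκ1 hκ2 hκ3 hκ4 hd hS hσ0 hσd hσ
  set p := κ⁻¹ with hp
  have hp0 : 0 < p := by positivity
  have hp1 : p ≤ 1 := inv_le_one_of_one_le₀ hκ1
  -- The only negative term of `D` is at most β²S, and 4β² ≤ S.
  have hDlow : S / 2 * S ≤ D := by
    have e1 : 4 * β ^ 2 * S ≤ S * S := by gcongr
    have e2 : β ^ 2 * S = β ^ 2 * κ ^ 2 + β ^ 2 * σ ^ 2 := by rw [hS]; ring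
    have e3 : 0 ≤ β ^ 2 * κ ^ 2 := by positivity
    have e4 : 0 ≤ S * S := by positivity
    have e5 : D = S * S - β ^ 2 * σ ^ 2 + β ^ 2 * κ ^ 2 := by rw [hD]; ring
    linarith only [e1, e2, e3, e4, e5]
  have hD0 : 0 < D := lt_of_lt_of_le (by positivity) hDlow
  obtain ⟨q, v, F, a, hZ, hcon, hcon', hdec, hdec', hq, hqn⟩ :=
    h.exists_decomposition_norm hσ hS hD hβ hκ hσ0 hD0
  set R := ‖u 0‖ + p ^ 2 * ‖E 0‖ + p ^ 3 * ‖b 0‖ with hR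
  set Q := p ^ 2 * ‖u 0‖ + ‖E 0‖ + ‖b 0‖ with hQ
  have hR0 : 0 ≤ R := by positivity
  have hQ0 : 0 ≤ Q := by positivity
  have hRQ : p ^ 2 * R ≤ Q := by
    have e1 : p ^ 4 * ‖E 0‖ ≤ 1 * ‖E 0‖ := by
      gcongr
      exact pow_le_one₀ hp0.le hp1
    have e2 : p ^ 5 * ‖b 0‖ ≤ 1 * ‖b 0‖ := by
      gcongr
      exact pow_le_one₀ hp0.le hp1
    rw [hR, hQ]
    linarith only [e1, e2]
  have hq0 : S * ‖q 0‖ ≤ M * R := by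
    have e1 : S / 2 * S * ‖q 0‖ ≤ S * ((1 + A) * R) := by
      calc S / 2 * S * ‖q 0‖ ≤ D * ‖q 0‖ := by gcongr
        _ ≤ _ := hq 0
        _ ≤ S * ‖u 0‖ + A * (p ^ 2 * S) * ‖E 0‖ + A * (p ^ 3 * S) * ‖b 0‖ := by gcongr
        _ = S * (‖u 0‖ + A * (p ^ 2 * ‖E 0‖ + p ^ 3 * ‖b 0‖)) := by ring
        _ ≤ S * ((1 + A) * R) := by
            gcongr
            have e2 : 0 ≤ p ^ 2 * ‖E 0‖ + p ^ 3 * ‖b 0‖ := by positivity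
            have e3 : 0 ≤ A * ‖u 0‖ := by positivity
            rw [hR]
            linarith only [e2, e3]
    have e2 : S * (S * ‖q 0‖) ≤ S * (M * R) := by
      rw [hM]
      linarith only [e1]
    exact le_of_mul_le_mul_left e2 hS0
  set e₂ := Real.exp (-(c * κ ^ 2 * t)) with he₂
  set e₃ := Real.exp (-(c * t / κ ^ 2)) with he₃
  have hqt : S * ‖q t‖ ≤ M * (e₂ * R) := by
    have hcσ : c * κ ^ 2 ≤ σ := by
      have : c * κ ^ 2 ≤ μ / 2 * κ ^ 2 := by gcongr
      linarith only [this, hσlow, hd]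
    rw [hqn t]
    calc S * (Real.exp (-(σ * t)) * ‖q 0‖) = Real.exp (-(σ * t)) * (S * ‖q 0‖) := by ring
      _ ≤ e₂ * (M * R) := by rw [he₂]; gcongr
      _ = _ := by ring
  have hslow : ∀ s (X : ℝ), S * ‖q s‖ ≤ X → β * σ * ‖q s‖ ≤ A * (p ^ 2 * X) ∧
      β * κ * ‖q s‖ ≤ A * (p ^ 3 * X) := fun s X hX => by
    constructor
    · calc β * σ * ‖q s‖ ≤ A * (p ^ 2 * S) * ‖q s‖ := by gcongr
        _ = A * (p ^ 2 * (S * ‖q s‖)) := by ring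
        _ ≤ _ := by gcongr
    · calc β * κ * ‖q s‖ ≤ A * (p ^ 3 * S) * ‖q s‖ := by gcongr
        _ = A * (p ^ 3 * (S * ‖q s‖)) := by ring
        _ ≤ _ := by gcongr
  have hp32 : p ^ 3 ≤ p ^ 2 := pow_le_pow_of_le_one hp0.le hp1 (by norm_num)
  have hW0 : ‖F 0‖ + ‖a 0‖ ≤ (1 + 2 * A * M) * Q := by
    obtain ⟨-, h3, h4⟩ := hdec' 0
    obtain ⟨h1, h2⟩ := hslow 0 _ hq0
    have e1 : A * (p ^ 3 * (M * R)) ≤ A * (p ^ 2 * (M * R)) := by gcongr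
    have e2 : A * (p ^ 2 * (M * R)) ≤ A * (M * Q) := by
      calc A * (p ^ 2 * (M * R)) = A * (M * (p ^ 2 * R)) := by ring
        _ ≤ _ := by gcongr
    have e3 : 0 ≤ p ^ 2 * ‖u 0‖ := by positivity
    have e4 : Q = p ^ 2 * ‖u 0‖ + ‖E 0‖ + ‖b 0‖ := hQ
    linarith only [h1, h2, h3, h4, e1, e2, e3, e4]
  have hW : ‖F t‖ + ‖a t‖ ≤ N * (e₃ * Q) := by
    have hexp : Real.exp (-((d - σ) / 2 * t)) ≤ e₃ := by
      rw [he₃, mul_div_right_comm]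
      have : c / κ ^ 2 ≤ (d - σ) / 2 := by
        rw [div_le_iff₀ (by positivity)]
        refine hc2.trans ?_
        rw [div_le_iff₀ (by positivity)]
        calc β ^ 2 ≤ 2 * d * (d - σ) := hδlow
          _ = _ := by rw [hd]; ring
      gcongr
    calc ‖F t‖ + ‖a t‖ ≤ 10 * (Real.exp (-((d - σ) / 2 * t)) * (‖F 0‖ + ‖a 0‖)) :=
          high_wave_mode_bound hκ hS0 hβS hσd hδκ hσ hZ hcon t
      _ ≤ 10 * (e₃ * ((1 + 2 * A * M) * Q)) := by gcongr
      _ = _ := by rw [hN]; ring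
  set X := e₂ * R with hX
  set Y := e₃ * Q with hY
  have hX0 : 0 ≤ X := by positivity
  have hY0 : 0 ≤ Y := by positivity
  have hv : ‖v t‖ ≤ A * (p ^ 2 * (N * Y)) := by
    have e1 : S * ‖v t‖ ≤ S * (A * (p ^ 2 * (N * Y))) := by
      calc S * ‖v t‖ ≤ β * σ * ‖F t‖ + β * κ * ‖a t‖ := (hcon' t).2
        _ ≤ A * (p ^ 2 * S) * ‖F t‖ + A * (p ^ 3 * S) * ‖a t‖ := by gcongr
        _ ≤ A * (p ^ 2 * S) * ‖F t‖ + A * (p ^ 2 * S) * ‖a t‖ := by gcongr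
        _ = S * (A * (p ^ 2 * (‖F t‖ + ‖a t‖))) := by ring
        _ ≤ _ := by gcongr
    exact le_of_mul_le_mul_left e1 hS0
  have hF : ‖F t‖ ≤ N * Y := by linarith only [hW, norm_nonneg (a t)]
  have ha : ‖a t‖ ≤ N * Y := by linarith only [hW, norm_nonneg (F t)]
  obtain ⟨hu, hE, hb⟩ := hdec t
  obtain ⟨h1, h2⟩ := hslow t _ hqt
  have hsum : ∀ {z z₁ z₂ : ℝ} (k₁ k₂ : ℝ), 0 ≤ k₁ → 0 ≤ k₂ →
      z₁ ≤ (1 + A) * (N * (k₂ * Y)) → z₂ ≤ (1 + A) * (M * (k₁ * X)) → z ≤ z₁ + z₂ →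
      z ≤ (1 + A) * (N + M) * (k₁ * X + k₂ * Y) := by
    intro z z₁ z₂ k₁ k₂ hk₁ hk₂ g1 g2 g3
    have e1 : 0 ≤ (1 + A) * (N * (k₁ * X)) := by positivity
    have e2 : 0 ≤ (1 + A) * (M * (k₂ * Y)) := by positivity
    linarith only [g1, g2, g3, e1, e2]
  have hle : ∀ {z x : ℝ}, 0 ≤ x → (z ≤ x ∨ z ≤ A * x) → z ≤ (1 + A) * x := fun hx hz => by
    have := mul_nonneg hA0.le hx
    rcases hz with hz | hz <;> linarith only [hz, hx, this]
  refine ⟨?_, ?_, ?_⟩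
  · have := hsum (z := ‖u t‖) 1 (p ^ 2) zero_le_one (by positivity)
      (hle (by positivity) (Or.inr (hv.trans_eq (by ring))))
      (hle (by positivity) (Or.inl (hqt.trans_eq (by ring)))) hu
    simpa only [one_mul] using this
  · have := hsum (z := ‖E t‖) (p ^ 2) 1 (by positivity) zero_le_one
      (hle (by positivity) (Or.inl (hF.trans_eq (by ring))))
      (hle (by positivity) (Or.inr (h1.trans_eq (by ring)))) hE
    simpa only [one_mul] using this
  · have := hsum (z := ‖b t‖) (p ^ 3) 1 (by positivity) zero_le_one
      (hle (by positivity) (Or.inl (ha.trans_eq (by ring))))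
      (hle (by positivity) (Or.inr (h2.trans_eq (by ring)))) hb
    simpa only [one_mul] using this

end TransverseHigh

end LinNSM

end

/-! ### The longitudinal system -/

noncomputable section

namespace LinNSM

open Filter Topology Set

section Longitudinal

/-- The system for the density and the longitudinal parts of the velocity and of the electric
field. -/
structure Longitudinal (γ β κ d : ℝ) (n a e : ℝ → ℂ) : Prop where
  deriv_n : ∀ t, HasDerivAt n (-(γ * κ * a t)) t
  deriv_a : ∀ t, HasDerivAt a (γ * κ * n t - β * e t - d * a t) t
  deriv_e : ∀ t, HasDerivAt e (β * a t) t
  gauss : ∀ t, β * n t = -(γ * κ * e t)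

theorem Longitudinal.norm_gauss {γ β κ d : ℝ} {n a e : ℝ → ℂ} (h : Longitudinal γ β κ d n a e)
    (hγ : 0 < γ) (hβ : 0 < β) (hκ : 0 < κ) (t : ℝ) : β * ‖n t‖ = γ * κ * ‖e t‖ := by
  rw [← norm_real_mul hβ.le, h.gauss, norm_neg, ← Complex.ofReal_mul,
    norm_real_mul (by positivity)]

/-- Gauss's law eliminates n, and (ωe, βa) is then a damped oscillator with ω² = β² + γ²κ². The
frequency stays at least β as κ tends to 0, so one estimate covers all κ ≤ Λ; it serves both the low
and the middle region. -/
theorem exists_longitudinal_bound {γ β μ Λ : ℝ} (hβ : 0 < β) (hμ : 0 < μ) (hΛ : 0 < Λ) :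
    ∃ c K, 0 < c ∧ 0 < K ∧ ∀ {κ : ℝ} {n a e : ℝ → ℂ}, 0 < κ → κ ≤ Λ →
      Longitudinal γ β κ (μ * κ ^ 2) n a e → ∀ t, 0 ≤ t →
      ‖e t‖ + ‖a t‖ ≤ K * (Real.exp (-(c * κ ^ 2 * t)) * (‖e 0‖ + ‖a 0‖)) := by
  set M : ℝ := μ * Λ ^ 2 + Real.sqrt (β ^ 2 + γ ^ 2 * Λ ^ 2) with hM
  have hM0 : 0 < M := by positivity
  obtain ⟨c, hc, H⟩ := exists_damped_bound hβ hM0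
  refine ⟨c * μ, 3 * (M / β), by positivity, by positivity, fun {κ n a e} hκ hκΛ h t ht => ?_⟩
  set ω := Real.sqrt (β ^ 2 + γ ^ 2 * κ ^ 2) with hω
  have hω2 : ω ^ 2 = β ^ 2 + γ ^ 2 * κ ^ 2 := Real.sq_sqrt (by positivity)
  have hω1 : β ≤ ω := Real.le_sqrt_of_sq_le (by linarith [mul_nonneg (sq_nonneg γ) (sq_nonneg κ)])
  have hωM : ω ≤ M := by
    have : ω ≤ Real.sqrt (β ^ 2 + γ ^ 2 * Λ ^ 2) := by rw [hω]; gcongr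
    have : 0 < μ * Λ ^ 2 := by positivity
    linarith
  have hβM : β ≤ M := hω1.trans hωM
  have hω0 : 0 < ω := hβ.trans_le hω1
  have key := H (δ := μ * κ ^ 2) (ω := ω) (x := fun s => ω * e s) (y := fun s => β * a s)
    (by positivity) (by
      have : μ * κ ^ 2 ≤ μ * Λ ^ 2 := by gcongr
      linarith [Real.sqrt_nonneg (β ^ 2 + γ ^ 2 * Λ ^ 2)]) hω1 hωM
    (fun s => (h.deriv_e s).const_mul _) (fun s => by
      refine ((h.deriv_a s).const_mul (β : ℂ)).congr_deriv ?_
      have e1 : (ω : ℂ) ^ 2 = β ^ 2 + γ ^ 2 * κ ^ 2 := by exact_mod_cast hω2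
      push_cast
      linear_combination γ * κ * h.gauss s + e s * e1) t ht
  simp only [norm_real_mul hω0.le, norm_real_mul hβ.le] at key
  have h1 : β * (‖e t‖ + ‖a t‖) ≤
      β * (3 * (M / β) * (Real.exp (-(c * μ * κ ^ 2 * t)) * (‖e 0‖ + ‖a 0‖))) := by
    calc β * (‖e t‖ + ‖a t‖) ≤ ω * ‖e t‖ + β * ‖a t‖ := by rw [mul_add]; gcongr
      _ ≤ _ := key
      _ ≤ 3 * (Real.exp (-(c * (μ * κ ^ 2) * t)) * (M * ‖e 0‖ + M * ‖a 0‖)) := by gcongr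
      _ = _ := by
        rw [← mul_assoc c]
        field_simp
  exact le_of_mul_le_mul_left h1 hβ

/-- Gauss's law now eliminates e, and n'' + dn' + (β² + γ²κ²)n = 0 is overdamped: one exponent stays
between positive constants and the other is comparable to κ². The velocity is n' divided by -γκ, so
it gains a factor κ⁻¹ in the slow part. -/
theorem exists_longitudinal_high_bound {γ β μ : ℝ} (hγ : 0 < γ) (hβ : 0 < β) (hμ : 0 < μ) :
    ∃ L₀ c₀ K, 0 < L₀ ∧ 0 < c₀ ∧ 0 < K ∧ ∀ {c κ : ℝ} {n a e : ℝ → ℂ}, c ≤ c₀ → L₀ ≤ κ →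
      Longitudinal γ β κ (μ * κ ^ 2) n a e → ∀ t, 0 ≤ t →
      ‖n t‖ ≤ K * (Real.exp (-(c * t)) * (‖n 0‖ + κ⁻¹ * ‖a 0‖) +
        κ⁻¹ * (Real.exp (-(c * κ ^ 2 * t)) * (κ⁻¹ * ‖n 0‖ + ‖a 0‖))) ∧
      ‖a t‖ ≤ K * (κ⁻¹ * (Real.exp (-(c * t)) * (‖n 0‖ + κ⁻¹ * ‖a 0‖)) +
        Real.exp (-(c * κ ^ 2 * t)) * (κ⁻¹ * ‖n 0‖ + ‖a 0‖)) := by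
  set K : ℝ := 2 * (γ / μ) + 2 + 8 * (γ / μ) ^ 2 + 8 * (γ / μ) with hK
  have hK0 : 0 < K := by positivity
  -- The bound κ ≥ β/γ gives W ≤ 2γ²κ², and κ ≥ 4γ/μ then gives 8W ≤ d², so the exponents differ by
  -- at least d/2. The rate entries are the lower bounds of the smaller exponent and of the larger
  -- one divided by κ².
  refine ⟨max (β / γ) (4 * γ / μ), min (γ ^ 2 / μ) (μ / 2), K, by positivity, by positivity, hK0,
    fun {c κ n a e} hc hκL h t ht => ?_⟩
  obtain ⟨hκ1, hκ2⟩ := max_le_iff.1 hκL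
  obtain ⟨hc1, hc2⟩ := le_min_iff.1 hc
  have hκ : 0 < κ := lt_of_lt_of_le (by positivity) hκ1
  rw [div_le_iff₀' hγ] at hκ1
  rw [div_le_iff₀' hμ] at hκ2
  set d := μ * κ ^ 2 with hd
  have hd0 : 0 < d := by positivity
  set W := β ^ 2 + γ ^ 2 * κ ^ 2 with hW
  have hW1 : W ≤ 2 * (γ ^ 2 * κ ^ 2) := by
    have : β ^ 2 ≤ (γ * κ) ^ 2 := by gcongr
    linarith only [this, hW]
  have hW2 : γ ^ 2 * κ ^ 2 ≤ W := by linarith only [sq_nonneg β, hW]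
  have hW0 : 0 < W := by positivity
  have hWd : 8 * W ≤ d ^ 2 := by
    have : (4 * γ) ^ 2 * κ ^ 2 ≤ (μ * κ) ^ 2 * κ ^ 2 := by gcongr
    have e1 : (μ * κ) ^ 2 * κ ^ 2 = d ^ 2 := by rw [hd]; ring
    linarith only [this, hW1, e1]
  set r := Real.sqrt (d ^ 2 - 4 * W) with hr
  have hr2 : r ^ 2 = d ^ 2 - 4 * W := Real.sq_sqrt (by linarith only [hW0, hWd])
  have hr1 : d / 2 ≤ r := Real.le_sqrt_of_sq_le (by linarith only [hWd, sq_nonneg d])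
  have hrd : r < d := Real.sqrt_lt' hd0 |>.2 (by linarith only [hW0])
  set s₁ := (d - r) / 2 with hs₁
  set s₂ := (d + r) / 2 with hs₂
  have hsum : s₁ + s₂ = d := by rw [hs₁, hs₂]; ring
  have hprod : s₁ * s₂ = W := by rw [hs₁, hs₂]; linarith only [hr2]
  have hsub : s₂ - s₁ = r := by rw [hs₁, hs₂]; ring
  have hs₁0 : 0 < s₁ := by linarith only [hrd, hs₁]
  have hs₂l : d / 2 ≤ s₂ := by linarith only [hr1, hs₂, hd0]
  have hs₂u : s₂ ≤ d := by linarith only [hrd, hs₂]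
  have hs₁l : γ ^ 2 / μ ≤ s₁ := by
    rw [div_le_iff₀ hμ]
    have : γ ^ 2 * κ ^ 2 ≤ s₁ * μ * κ ^ 2 := by
      calc γ ^ 2 * κ ^ 2 ≤ s₁ * s₂ := hW2.trans_eq hprod.symm
        _ ≤ s₁ * d := by gcongr
        _ = _ := by rw [hd]; ring
    exact le_of_mul_le_mul_right this (by positivity)
  have hs₁u : s₁ ≤ 4 * γ ^ 2 / μ := by
    rw [le_div_iff₀ hμ]
    have : s₁ * μ * κ ^ 2 ≤ 4 * γ ^ 2 * κ ^ 2 := by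
      calc s₁ * μ * κ ^ 2 = 2 * (s₁ * (d / 2)) := by rw [hd]; ring
        _ ≤ 2 * (s₁ * s₂) := by gcongr
        _ ≤ _ := by rw [hprod]; linarith only [hW1]
    exact le_of_mul_le_mul_right this (by positivity)
  have hgk : 0 ≤ γ * κ := by positivity
  have hn : ∀ s, ‖-((γ : ℂ) * κ * a s)‖ = γ * κ * ‖a s‖ := fun s => by
    rw [norm_neg, ← Complex.ofReal_mul, norm_real_mul hgk]
  obtain ⟨b1, b2⟩ := overdamped_bound (x := n) (y := fun s => -(γ * κ * a s)) hs₁0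
    (sub_pos.1 (by rw [hsub]; linarith only [hr1, hd0])) h.deriv_n (fun s => by
      refine ((h.deriv_a s).const_mul (γ * κ : ℂ)).neg.congr_deriv ?_
      rw [hsum, hprod, hW]
      push_cast
      linear_combination (β : ℂ) * h.gauss s) t
  rw [hn, hn, hsub] at b2
  rw [hn, hsub] at b1
  set e₁ := Real.exp (-(c * t)) with he₁
  set e₂ := Real.exp (-(c * κ ^ 2 * t)) with he₂
  have hexp₁ : Real.exp (-(s₁ * t)) ≤ e₁ := by
    have := hc1.trans hs₁l
    rw [he₁]
    gcongr
  have hexp₂ : Real.exp (-(s₂ * t)) ≤ e₂ := by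
    have : c * κ ^ 2 ≤ μ / 2 * κ ^ 2 := by gcongr
    have : c * κ ^ 2 ≤ s₂ := by linarith only [this, hs₂l, hd]
    rw [he₂]
    gcongr
  set p := κ⁻¹ with hp
  have hp0 : 0 < p := by positivity
  have hpκ : p * κ = 1 := inv_mul_cancel₀ hκ.ne'
  set g := γ / μ with hg
  have hg0 : 0 < g := by positivity
  have hgμ : γ = g * μ := by rw [hg]; field_simp
  set x := ‖n 0‖ with hx
  set y := ‖a 0‖ with hy
  have hx0 : 0 ≤ x := norm_nonneg _
  have hy0 : 0 ≤ y := norm_nonneg _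
  have f1 : Real.exp (-(s₁ * t)) * (γ * κ * y + s₂ * x) ≤ d * (e₁ * (x + g * (p * y))) := by
    calc _ ≤ e₁ * (γ * κ * y + d * x) := by gcongr
      _ = d * (e₁ * (x + (p * κ) * g * (p * y))) + e₁ * (γ * κ * (1 - (p * κ) ^ 2) * y) := by
          rw [hd, hgμ]; ring
      _ = _ := by rw [hpκ]; ring
  have f2 : Real.exp (-(s₂ * t)) * (γ * κ * y + s₁ * x) ≤
      d * (p * (e₂ * (g * y + 4 * g ^ 2 * (p * x)))) := by
    calc _ ≤ e₂ * (γ * κ * y + 4 * γ ^ 2 / μ * x) := by gcongr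
      _ = e₂ * (μ * κ * (g * y) + μ * (4 * g ^ 2 * x)) := by
          rw [hgμ]
          field_simp
      _ = e₂ * (μ * κ * (p * κ) * (g * y) + μ * (p * κ) ^ 2 * (4 * g ^ 2 * x)) := by
          rw [hpκ]
          ring
      _ = _ := by rw [hd]; ring
  constructor
  · have h1 : d * ‖n t‖ ≤ d * (2 * (e₁ * (x + g * (p * y))) +
        2 * (p * (e₂ * (g * y + 4 * g ^ 2 * (p * x))))) := by
      have : d / 2 * ‖n t‖ ≤ r * ‖n t‖ := by gcongr
      linarith only [this, b1, f1, f2]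
    refine (le_of_mul_le_mul_left h1 hd0).trans ?_
    rw [mul_add K]
    refine add_le_add ?_ ?_
    · calc _ = e₁ * (2 * x + 2 * g * (p * y)) := by ring
        _ ≤ e₁ * (K * x + K * (p * y)) := by
            gcongr e₁ * (?_ * x + ?_ * (p * y))
            · linarith only [hK, sq_nonneg g, hg0]
            · linarith only [hK, sq_nonneg g, hg0]
        _ = _ := by ring
    · calc _ = p * (e₂ * (8 * g ^ 2 * (p * x) + 2 * g * y)) := by ring
        _ ≤ p * (e₂ * (K * (p * x) + K * y)) := by
            gcongr p * (e₂ * (?_ * (p * x) + ?_ * y))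
            · linarith only [hK, sq_nonneg g, hg0]
            · linarith only [hK, sq_nonneg g, hg0]
        _ = _ := by ring
  · have h1 : d * (γ * κ) * ‖a t‖ ≤ d * (γ * κ) * (8 * g * (p * (e₁ * (x + g * (p * y)))) +
        2 * (e₂ * (y + 4 * g * (p * x)))) := by
      have e0 : d / 2 * (γ * κ * ‖a t‖) ≤ r * (γ * κ * ‖a t‖) := by gcongr
      have e1 : s₁ * (Real.exp (-(s₁ * t)) * (γ * κ * y + s₂ * x)) ≤
          4 * γ ^ 2 / μ * (d * (e₁ * (x + g * (p * y)))) := by gcongr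
      have e2 : s₂ * (Real.exp (-(s₂ * t)) * (γ * κ * y + s₁ * x)) ≤
          d * (d * (p * (e₂ * (g * y + 4 * g ^ 2 * (p * x))))) := by gcongr
      have e3 : 4 * γ ^ 2 / μ * (d * (e₁ * (x + g * (p * y)))) =
          d * (γ * κ) * (4 * g * (p * (e₁ * (x + g * (p * y))))) := by
        rw [hp, hg]
        field_simp
      have e4 : d * (d * (p * (e₂ * (g * y + 4 * g ^ 2 * (p * x))))) =
          d * (γ * κ) * (e₂ * (y + 4 * g * (p * x))) := by
        calc _ = d * (g * μ * (κ * (p * κ))) * (e₂ * (y + 4 * g * (p * x))) := by rw [hd]; ring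
          _ = _ := by rw [hpκ, hgμ, mul_one]
      linarith only [e0, e1, e2, e3, e4, b2]
    refine (le_of_mul_le_mul_left h1 (by positivity)).trans ?_
    rw [mul_add K]
    refine add_le_add ?_ ?_
    · calc _ = p * (e₁ * (8 * g * x + 8 * g ^ 2 * (p * y))) := by ring
        _ ≤ p * (e₁ * (K * x + K * (p * y))) := by
            gcongr p * (e₁ * (?_ * x + ?_ * (p * y)))
            · linarith only [hK, sq_nonneg g, hg0]
            · linarith only [hK, sq_nonneg g, hg0]
        _ = _ := by ring
    · calc _ = e₂ * (8 * g * (p * x) + 2 * y) := by ring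
        _ ≤ e₂ * (K * (p * x) + K * y) := by
            gcongr e₂ * (?_ * (p * x) + ?_ * y)
            · linarith only [hK, sq_nonneg g, hg0]
            · linarith only [hK, sq_nonneg g, hg0]
        _ = _ := by ring

end Longitudinal

/-! ### Splitting into longitudinal and transverse parts -/

section HelmholtzSplitting

theorem eq_of_forall_hasDerivAt_zero {f : ℝ → ℂ} (h : ∀ t, HasDerivAt f 0 t) (s t : ℝ) :
    f s = f t :=
  is_const_of_deriv_eq_zero (fun t => (h t).differentiableAt) (fun t => (h t).deriv) s t

/-- The longitudinal part of a vector at the frequency `k`. -/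
def longPart (k : R3) (w : Fin 3 → ℂ) : ℂ := (‖k‖ : ℂ)⁻¹ * (Complex.I * ∑ i, k i * w i)

/-- The transverse part of a vector at the frequency `k`, rotated by a right angle. -/
def transPart (k : R3) (w : Fin 3 → ℂ) (i : Fin 3) : ℂ :=
  (‖k‖ : ℂ)⁻¹ * (k (i + 1) * w (i + 2) - k (i + 2) * w (i + 1))

theorem norm_sq_eq_sum (k : R3) : ‖k‖ ^ 2 = ∑ i, k i ^ 2 := by
  simp [EuclideanSpace.norm_sq_eq]

theorem vecNorm_sq (w : Fin 3 → ℂ) : vecNorm w ^ 2 = ∑ i, ‖w i‖ ^ 2 :=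
  Real.sq_sqrt (by positivity)

theorem vecNorm_nonneg (w : Fin 3 → ℂ) : 0 ≤ vecNorm w := Real.sqrt_nonneg _

theorem norm_le_vecNorm (w : Fin 3 → ℂ) (i : Fin 3) : ‖w i‖ ≤ vecNorm w :=
  Real.le_sqrt_of_sq_le (Finset.single_le_sum (f := fun i => ‖w i‖ ^ 2)
    (fun _ _ => by positivity) (Finset.mem_univ i))

theorem vecNorm_le_sum (w : Fin 3 → ℂ) : vecNorm w ≤ ∑ i, ‖w i‖ :=
  Real.sqrt_le_iff.2 ⟨by positivity, Finset.sum_sq_le_sq_sum_of_nonneg fun _ _ => norm_nonneg _⟩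

/-- Lagrange's identity |k|²|w|² = |k·w|² + |k × w|² for real k and complex w. -/
theorem vecNorm_sq_eq_helmholtz {k : R3} (hk : k ≠ 0) (w : Fin 3 → ℂ) :
    vecNorm w ^ 2 = ‖longPart k w‖ ^ 2 + ∑ i, ‖transPart k w i‖ ^ 2 := by
  have hk0 : ‖k‖ ^ 2 ≠ 0 := by simpa using hk
  refine mul_left_cancel₀ hk0 ?_
  have h1 : ∀ z : ℂ, ‖k‖ ^ 2 * ‖(‖k‖ : ℂ)⁻¹ * z‖ ^ 2 = ‖z‖ ^ 2 := fun z => by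
    rw [norm_mul, norm_inv, Complex.norm_real, norm_norm, mul_pow, inv_pow,
      mul_inv_cancel_left₀ hk0]
  rw [mul_add, Finset.mul_sum]
  simp only [longPart, transPart, h1, vecNorm_sq]
  rw [norm_mul Complex.I, Complex.norm_I, one_mul]
  simp only [norm_sq_eq_sum, ← Complex.normSq_eq_norm_sq, Complex.normSq_apply, Fin.sum_univ_three]
  simp
  ring

theorem norm_longPart_le {k : R3} (hk : k ≠ 0) (w : Fin 3 → ℂ) : ‖longPart k w‖ ≤ vecNorm w :=
  le_of_sq_le_sq (by rw [vecNorm_sq_eq_helmholtz hk]; exact le_add_of_nonneg_right (by positivity))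
    (vecNorm_nonneg w)

theorem norm_transPart_le {k : R3} (hk : k ≠ 0) (w : Fin 3 → ℂ) (i : Fin 3) :
    ‖transPart k w i‖ ≤ vecNorm w := by
  refine le_of_sq_le_sq ?_ (vecNorm_nonneg w)
  rw [vecNorm_sq_eq_helmholtz hk]
  exact le_add_of_nonneg_of_le (by positivity) (Finset.single_le_sum
    (f := fun i => ‖transPart k w i‖ ^ 2) (fun _ _ => by positivity) (Finset.mem_univ i))

theorem vecNorm_le_helmholtz {k : R3} (hk : k ≠ 0) (w : Fin 3 → ℂ) :
    vecNorm w ≤ ‖longPart k w‖ + ∑ i, ‖transPart k w i‖ := by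
  refine le_of_sq_le_sq ?_ (by positivity)
  have h1 : ∑ i, ‖transPart k w i‖ ^ 2 ≤ (∑ i, ‖transPart k w i‖) ^ 2 :=
    Finset.sum_sq_le_sq_sum_of_nonneg fun _ _ => norm_nonneg _
  have h2 : 0 ≤ ‖longPart k w‖ * ∑ i, ‖transPart k w i‖ := by positivity
  rw [vecNorm_sq_eq_helmholtz hk]
  linarith

variable {γ β μ : ℝ} {k : R3} {n : ℝ → ℂ} {u E B : ℝ → Fin 3 → ℂ}

/-- The constraint propagates from time 0 because the divergence of a curl vanishes. -/
theorem FourierODE.div_B_eq_zero (h : FourierODE γ β μ k n u E B) (t : ℝ) :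
    ∑ i, k i * B t i = 0 := by
  rw [← h.div_B]
  refine eq_of_forall_hasDerivAt_zero (f := fun s => ∑ i, (k i : ℂ) * B s i) (fun s => ?_) t 0
  refine (HasDerivAt.fun_sum fun i _ => (h.deriv_B s i).const_mul (k i : ℂ)).congr_deriv ?_
  simp [Fin.sum_univ_three]
  ring

/-- Curls have no longitudinal part, so B drops out. Gauss's law propagates because βn + γκe has
zero derivative. -/
theorem FourierODE.longitudinal (h : FourierODE γ β μ k n u E B) (hγ : γ ≠ 0) (hk : k ≠ 0) :
    Longitudinal γ β ‖k‖ (μ * ‖k‖ ^ 2) n (fun t => longPart k (u t))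
      (fun t => longPart k (E t)) := by
  have hk0 : (‖k‖ : ℂ) ≠ 0 := by simpa using hk
  have hγ0 : (γ : ℂ) ≠ 0 := by simpa using hγ
  have hk2 : (‖k‖ : ℂ) ^ 2 = k 0 ^ 2 + k 1 ^ 2 + k 2 ^ 2 := by
    have := norm_sq_eq_sum k
    rw [Fin.sum_univ_three] at this
    exact_mod_cast this
  have hl : ∀ w, ‖k‖ * longPart k w = Complex.I * ∑ i, k i * w i := fun w =>
    mul_inv_cancel_left₀ hk0 _
  have hd : ∀ {w : ℝ → Fin 3 → ℂ} {w' : Fin 3 → ℂ} {t : ℝ},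
      (∀ i, HasDerivAt (fun s => w s i) (w' i) t) →
      HasDerivAt (fun s => longPart k (w s)) (longPart k w') t := fun hw =>
    ((HasDerivAt.fun_sum fun i _ => (hw i).const_mul (k i : ℂ)).const_mul Complex.I).const_mul _
  have hn : ∀ t, HasDerivAt n (-(γ * ‖k‖ * longPart k (u t))) t := fun t =>
    (h.deriv_n t).congr_deriv (by rw [mul_assoc, hl])
  have he : ∀ t, HasDerivAt (fun t => longPart k (E t)) (β * longPart k (u t)) t := fun t => by
    refine (hd (h.deriv_E t)).congr_deriv ?_
    simp [longPart, Fin.sum_univ_three]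
    ring
  refine ⟨hn, fun t => ?_, he, fun t => ?_⟩
  · refine (hd (h.deriv_u t)).congr_deriv (mul_left_cancel₀ hk0 ?_)
    have h1 : (‖k‖ : ℂ) * (γ * ‖k‖ * n t - β * longPart k (E t) -
        (μ * ‖k‖ ^ 2 : ℝ) * longPart k (u t)) = γ * ‖k‖ ^ 2 * n t - β * (‖k‖ * longPart k (E t)) -
        μ * ‖k‖ ^ 2 * (‖k‖ * longPart k (u t)) := by
      push_cast
      ring
    rw [h1, hl, hl, hl]
    simp only [Fin.sum_univ_three]
    linear_combination (-γ * n t) * hk2 -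
      γ * n t * (k 0 ^ 2 + k 1 ^ 2 + k 2 ^ 2) * Complex.I_sq
  · have h0 := eq_of_forall_hasDerivAt_zero
      (f := fun s => (β : ℂ) * n s + γ * ‖k‖ * longPart k (E s)) (fun s => by
        refine (((hn s).const_mul (β : ℂ)).add ((he s).const_mul (γ * ‖k‖ : ℂ))).congr_deriv ?_
        ring) t 0
    have h1 : (β : ℂ) * n 0 + γ * ‖k‖ * longPart k (E 0) = 0 := by
      rw [mul_assoc (γ : ℂ), hl, h.div_E]
      field_simp
      ring
    rw [h1] at h0
    exact eq_neg_of_add_eq_zero_left h0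

/-- Rotating u and E by k× while keeping B unrotated, up to the factor -i, turns both curls into
multiplication by ±κ. This uses k × (k × B) = -κ²B, valid as k·B = 0. The three components then
decouple, with real coefficients. -/
theorem FourierODE.transverse (h : FourierODE γ β μ k n u E B) (hk : k ≠ 0) (i : Fin 3) :
    Transverse β ‖k‖ (μ * ‖k‖ ^ 2) (fun t => transPart k (u t) i)
      (fun t => transPart k (E t) i) (fun t => -(Complex.I * B t i)) := by
  have hk0 : (‖k‖ : ℂ) ≠ 0 := by simpa using hk
  have hk2 : (‖k‖ : ℂ) ^ 2 = k i ^ 2 + k (i + 1) ^ 2 + k (i + 2) ^ 2 := by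
    have := norm_sq_eq_sum k
    rw [Fin.sum_univ_three] at this
    have h2 : ‖k‖ ^ 2 = k i ^ 2 + k (i + 1) ^ 2 + k (i + 2) ^ 2 := by
      fin_cases i <;> simp <;> linarith
    exact_mod_cast h2
  have hB : ∀ t, k i * B t i + k (i + 1) * B t (i + 1) + k (i + 2) * B t (i + 2) = 0 := fun t => by
    have := h.div_B_eq_zero t
    rw [Fin.sum_univ_three] at this
    fin_cases i <;> simp <;> linear_combination this
  have e1 : i + 1 + 1 = i + 2 := by fin_cases i <;> rfl
  have e2 : i + 1 + 2 = i := by fin_cases i <;> rfl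
  have e3 : i + 2 + 1 = i := by fin_cases i <;> rfl
  have e4 : i + 2 + 2 = i + 1 := by fin_cases i <;> rfl
  have ht : ∀ w, ‖k‖ * transPart k w i = k (i + 1) * w (i + 2) - k (i + 2) * w (i + 1) := fun w =>
    mul_inv_cancel_left₀ hk0 _
  have hd : ∀ {w : ℝ → Fin 3 → ℂ} {w' : Fin 3 → ℂ} {t : ℝ},
      (∀ i, HasDerivAt (fun s => w s i) (w' i) t) →
      HasDerivAt (fun s => transPart k (w s) i) (transPart k w' i) t := fun hw =>
    (((hw (i + 2)).const_mul (k (i + 1) : ℂ)).sub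
      ((hw (i + 1)).const_mul (k (i + 2) : ℂ))).const_mul _
  refine ⟨fun t => ?_, fun t => ?_, fun t => ?_⟩
  · refine (hd (h.deriv_u t)).congr_deriv ?_
    simp only [transPart]
    push_cast
    ring
  · refine (hd (h.deriv_E t)).congr_deriv (mul_left_cancel₀ hk0 ?_)
    have h1 : (‖k‖ : ℂ) * (‖k‖ * -(Complex.I * B t i) + β * transPart k (u t) i) =
        -(‖k‖ ^ 2 * (Complex.I * B t i)) + β * (‖k‖ * transPart k (u t) i) := by ring
    rw [h1, ht, ht, hk2]
    simp only [e1, e2, e3, e4]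
    linear_combination Complex.I * k i * hB t
  · refine ((h.deriv_B t i).const_mul Complex.I).neg.congr_deriv ?_
    rw [← ht]
    linear_combination ‖k‖ * transPart k (E t) i * Complex.I_sq

end HelmholtzSplitting

end LinNSM

end

/-! ### Assembling the bounds in the three frequency regions -/

noncomputable section

namespace LinNSM

open Filter Topology Set

section FrequencyRegions

theorem GLow_mulVec (c t κ n u E B : ℝ) : (GLow c t κ).mulVec ![n, u, E, B] =
    ![Real.exp (-(c * κ ^ 2 * t)) * (n + κ * u),
      Real.exp (-(c * κ ^ 2 * t)) * (κ * n + u + E + κ * B) +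
        Real.exp (-(c * κ ^ 4 * t)) * (κ ^ 2 * u + κ ^ 4 * E + κ * B),
      Real.exp (-(c * κ ^ 2 * t)) * (u + E + κ * B) +
        Real.exp (-(c * κ ^ 4 * t)) * (κ ^ 4 * u + κ ^ 6 * E + κ ^ 3 * B),
      Real.exp (-(c * κ ^ 2 * t)) * (κ * u + κ * E + κ ^ 2 * B) +
        Real.exp (-(c * κ ^ 4 * t)) * (κ * u + κ ^ 3 * E + B)] := by
  ext i
  fin_cases i <;> simp [GLow, Matrix.mulVec, dotProduct, Fin.sum_univ_four] <;> ring

theorem GMid_mulVec (c t n u E B : ℝ) : (GMid c t).mulVec ![n, u, E, B] =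
    ![Real.exp (-(c * t)) * (n + u), Real.exp (-(c * t)) * (n + u + E + B),
      Real.exp (-(c * t)) * (u + E + B), Real.exp (-(c * t)) * (u + E + B)] := by
  ext i
  fin_cases i <;> simp [GMid, Matrix.mulVec, dotProduct, Fin.sum_univ_four] <;> ring

theorem GHigh_mulVec (c t κ n u E B : ℝ) : (GHigh c t κ).mulVec ![n, u, E, B] =
    ![Real.exp (-(c * t)) * (n + κ⁻¹ * u) +
        Real.exp (-(c * κ ^ 2 * t)) * (κ⁻¹ ^ 2 * n + κ⁻¹ * u),
      Real.exp (-(c * t)) * (κ⁻¹ * n + κ⁻¹ ^ 2 * u + κ⁻¹ ^ 2 * E) +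
        Real.exp (-(c * κ ^ 2 * t)) * (κ⁻¹ * n + u + κ⁻¹ ^ 2 * E + κ⁻¹ ^ 3 * B) +
        Real.exp (-(c * t / κ ^ 2)) * (κ⁻¹ ^ 4 * u + κ⁻¹ ^ 2 * E + κ⁻¹ ^ 2 * B),
      Real.exp (-(c * t)) * (κ⁻¹ ^ 2 * u + E) +
        Real.exp (-(c * κ ^ 2 * t)) * (κ⁻¹ ^ 2 * u + κ⁻¹ ^ 2 * E + κ⁻¹ ^ 5 * B) +
        Real.exp (-(c * t / κ ^ 2)) * (κ⁻¹ ^ 2 * u + E + B),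
      Real.exp (-(c * κ ^ 2 * t)) * (κ⁻¹ ^ 3 * u + κ⁻¹ ^ 5 * E + κ⁻¹ ^ 6 * B) +
        Real.exp (-(c * t / κ ^ 2)) * (κ⁻¹ ^ 2 * u + E + B)] := by
  ext i
  fin_cases i <;> simp [GHigh, Matrix.mulVec, dotProduct, Fin.sum_univ_four] <;> ring

theorem vec_four_le_iff {x y z w x' y' z' w' C : ℝ} : ![x, y, z, w] ≤ C • ![x', y', z', w'] ↔
    x ≤ C * x' ∧ y ≤ C * y' ∧ z ≤ C * z' ∧ w ≤ C * w' := by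
  simp [Pi.le_def, Fin.forall_fin_succ]

/-- The norms of the longitudinal and transverse parts of a solution control, and are controlled
by, the lengths of the fields. -/
theorem FourierODE.exists_splitting {γ β μ : ℝ} {k : R3} {n : ℝ → ℂ} {u E B : ℝ → Fin 3 → ℂ}
    (h : FourierODE γ β μ k n u E B) (hγ : 0 < γ) (hk : k ≠ 0) :
    ∃ (a e : ℝ → ℂ) (U F b : Fin 3 → ℝ → ℂ), Longitudinal γ β ‖k‖ (μ * ‖k‖ ^ 2) n a e ∧
      (∀ i, Transverse β ‖k‖ (μ * ‖k‖ ^ 2) (U i) (F i) (b i)) ∧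
      (∀ t, vecNorm (u t) ≤ ‖a t‖ + ∑ i, ‖U i t‖ ∧ vecNorm (E t) ≤ ‖e t‖ + ∑ i, ‖F i t‖ ∧
        vecNorm (B t) ≤ ∑ i, ‖b i t‖) ∧
      ∀ t, ‖a t‖ ≤ vecNorm (u t) ∧ ‖e t‖ ≤ vecNorm (E t) ∧ ∀ i, ‖U i t‖ ≤ vecNorm (u t) ∧
        ‖F i t‖ ≤ vecNorm (E t) ∧ ‖b i t‖ ≤ vecNorm (B t) := by
  have hb : ∀ t i, ‖-(Complex.I * B t i)‖ = ‖B t i‖ := fun t i => by simp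
  refine ⟨_, _, fun i t => transPart k (u t) i, fun i t => transPart k (E t) i,
    fun i t => -(Complex.I * B t i), h.longitudinal hγ.ne' hk, h.transverse hk, fun t =>
    ⟨vecNorm_le_helmholtz hk _, vecNorm_le_helmholtz hk _, ?_⟩, fun t =>
    ⟨norm_longPart_le hk _, norm_longPart_le hk _, fun i => ⟨norm_transPart_le hk _ i,
      norm_transPart_le hk _ i, ?_⟩⟩⟩
  · simp only [hb]
    exact vecNorm_le_sum _
  · rw [hb]
    exact norm_le_vecNorm _ i

/-- The longitudinal contribution to u and E has the rate of the fast transverse modes and is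
absorbed in them. The statement allows every smaller `c`, so that one rate can later serve all
regions. -/
theorem exists_low_bound {γ β μ : ℝ} (hγ : 0 < γ) (hβ : 0 < β) (hμ : 0 < μ) :
    ∃ ε₀ c₀ C : ℝ, 0 < ε₀ ∧ 0 < c₀ ∧ 0 < C ∧ ∀ {c : ℝ} {k : R3} {n : ℝ → ℂ} {u E B : ℝ → Fin 3 → ℂ},
      c ≤ c₀ → k ≠ 0 → ‖k‖ ≤ ε₀ → FourierODE γ β μ k n u E B → ∀ t, 0 ≤ t →
      lengths (n t) (u t) (E t) (B t) ≤
        C • (GLow c t ‖k‖).mulVec (lengths (n 0) (u 0) (E 0) (B 0)) := by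
  obtain ⟨ε₀, c₁, K₁, hε₀, hc₁, hK₁, H₁⟩ := exists_transverse_low_bound hβ hμ
  obtain ⟨c₂, K₂, hc₂, hK₂, H₂⟩ := exists_longitudinal_bound (γ := γ) hβ hμ hε₀
  refine ⟨ε₀, min c₁ c₂, 3 * K₁ + K₂ * (1 + γ / β), hε₀, lt_min hc₁ hc₂, by positivity,
    fun {c k n u E B} hc hk hkε h t ht => ?_⟩
  obtain ⟨hc1, hc2⟩ := le_min_iff.1 hc
  obtain ⟨a, e, U, F, b, hL, hT, hup, hlow⟩ := h.exists_splitting hγ hk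
  set κ := ‖k‖ with hκ
  have hκ0 : 0 < κ := norm_pos_iff.2 hk
  rw [lengths, lengths, GLow_mulVec, vec_four_le_iff]
  obtain ⟨l1, l2, l3⟩ := hlow 0
  obtain ⟨g1, g2, g3⟩ := hup t
  have hl := H₂ hκ0 hkε hL t ht
  have hn0 := hL.norm_gauss hγ hβ hκ0 0
  have hnt := hL.norm_gauss hγ hβ hκ0 t
  have hexp : Real.exp (-(c₂ * κ ^ 2 * t)) ≤ Real.exp (-(c * κ ^ 2 * t)) := by gcongr
  set e₂ := Real.exp (-(c * κ ^ 2 * t)) with he₂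
  set e₁ := Real.exp (-(c * κ ^ 4 * t)) with he₁
  set x := vecNorm (u 0) with hx
  set y := vecNorm (E 0) with hy
  set z := vecNorm (B 0) with hz
  have hx0 : 0 ≤ x := vecNorm_nonneg _
  have hy0 : 0 ≤ y := vecNorm_nonneg _
  have hz0 : 0 ≤ z := vecNorm_nonneg _
  have hl' : ‖e t‖ + ‖a t‖ ≤ K₂ * (e₂ * (‖e 0‖ + x)) := hl.trans (by gcongr)
  have hly : K₂ * (e₂ * (‖e 0‖ + x)) ≤ K₂ * (e₂ * (x + y + κ * z)) := by
    gcongr K₂ * (e₂ * ?_)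
    linarith only [l2, mul_nonneg hκ0.le hz0]
  set Y := e₂ * (x + y + κ * z) with hY
  set X := e₁ * (κ * x + κ ^ 3 * y + z) with hX
  have hX0 : 0 ≤ X := by positivity
  have hY0 : 0 ≤ Y := by positivity
  have hkey : ∀ i, ‖U i t‖ ≤ K₁ * (Y + κ * X) ∧ ‖F i t‖ ≤ K₁ * (Y + κ ^ 3 * X) ∧
      ‖b i t‖ ≤ K₁ * (κ * Y + X) := fun i => by
    obtain ⟨i1, i2, i3⟩ := l3 i
    obtain ⟨j1, j2, j3⟩ := H₁ hc1 hκ0 hkε (hT i) t ht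
    have q1 : e₂ * (‖U i 0‖ + ‖F i 0‖ + κ * ‖b i 0‖) ≤ Y := by
      rw [hY]
      gcongr
    have q2 : e₁ * (κ * ‖U i 0‖ + κ ^ 3 * ‖F i 0‖ + ‖b i 0‖) ≤ X := by
      rw [hX]
      gcongr
    exact ⟨j1.trans (by gcongr), j2.trans (by gcongr), j3.trans (by gcongr)⟩
  have hs : ∀ {f : Fin 3 → ℝ} {r : ℝ}, (∀ i, f i ≤ r) → ∑ i, f i ≤ 3 * r := fun {f r} hf => by
    simpa using Finset.sum_le_card_nsmul Finset.univ f r fun i _ => hf i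
  have s1 := hs fun i => (hkey i).1
  have s2 := hs fun i => (hkey i).2.1
  have s3 := hs fun i => (hkey i).2.2
  have hgb : 0 ≤ K₂ * (γ / β) := by positivity
  -- Here `r` stands for matrix entries the estimate does not need, such as the n-entry of the
  -- velocity row.
  have hsum : ∀ {z₁ v w r : ℝ}, 0 ≤ v → 0 ≤ w → 0 ≤ r → z₁ ≤ K₂ * v + 3 * (K₁ * (v + w)) →
      z₁ ≤ (3 * K₁ + K₂ * (1 + γ / β)) * (r + v + w) := fun {z₁ v w r} hv hw hr hz => by
    have h1 := mul_nonneg hgb hv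
    have h2 := mul_nonneg hgb hw
    have h3 := mul_nonneg hgb hr
    have h4 := mul_nonneg hK₂.le hw
    have h5 := mul_nonneg hK₂.le hr
    have h6 := mul_nonneg hK₁.le hr
    linarith only [h1, h2, h3, h4, h5, h6, hz]
  refine ⟨?_, ?_, ?_, ?_⟩
  -- Gauss's law is used at both times: it converts n(t) into e(t), and the initial e back into the
  -- initial n, so no field entry appears in the density row.
  · have e1 : β * ‖n t‖ ≤ β * (K₂ * (e₂ * (‖n 0‖ + γ / β * (κ * x)))) := by
      calc β * ‖n t‖ = γ * κ * ‖e t‖ := hnt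
        _ ≤ γ * κ * (K₂ * (e₂ * (‖e 0‖ + x))) := by
            gcongr
            linarith only [hl', norm_nonneg (a t)]
        _ = K₂ * (e₂ * (γ * κ * ‖e 0‖ + γ * κ * x)) := by ring
        _ = _ := by
            rw [← hn0]
            field_simp
    refine (le_of_mul_le_mul_left e1 hβ).trans ?_
    have e3 : 0 ≤ e₂ * ‖n 0‖ := by positivity
    have e4 : 0 ≤ e₂ * (κ * x) := by positivity
    have e5 := mul_nonneg hgb e3
    have e6 := mul_nonneg hK₂.le e4
    have e7 := mul_nonneg hK₁.le e3
    have e8 := mul_nonneg hK₁.le e4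
    linarith only [e5, e6, e7, e8]
  · have := hsum (z₁ := vecNorm (u t)) (v := Y) (w := κ * X) (r := e₂ * (κ * ‖n 0‖)) hY0
      (by positivity) (by positivity) (by linarith only [g1, hl', hly, s1, norm_nonneg (e t)])
    refine this.trans_eq ?_
    rw [hX, hY]
    ring
  · have := hsum (z₁ := vecNorm (E t)) (v := Y) (w := κ ^ 3 * X) (r := 0) hY0
      (by positivity) le_rfl (by linarith only [g2, hl', hly, s2, norm_nonneg (a t)])
    refine this.trans_eq ?_
    rw [hX, hY]
    ring
  · have e1 : 0 ≤ K₂ * (κ * Y) := by positivity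
    have := hsum (z₁ := vecNorm (B t)) (v := κ * Y) (w := X) (r := 0) (by positivity)
      (by positivity) le_rfl (by linarith only [g3, s3, e1])
    refine this.trans_eq ?_
    rw [hX, hY]
    ring

/-- On the compact shell all coefficients lie between positive constants, so
`exists_transverse_bound` applies; the longitudinal rate is at least a multiple of ε². Only here do
the constants depend on `ε` and `L`. -/
theorem exists_mid_bound {γ β μ ε L : ℝ} (hγ : 0 < γ) (hβ : 0 < β) (hμ : 0 < μ) (hε : 0 < ε)
    (hεL : ε ≤ L) :
    ∃ c₀ C : ℝ, 0 < c₀ ∧ 0 < C ∧ ∀ {c : ℝ} {k : R3} {n : ℝ → ℂ} {u E B : ℝ → Fin 3 → ℂ},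
      c ≤ c₀ → k ≠ 0 → ε ≤ ‖k‖ → ‖k‖ ≤ L → FourierODE γ β μ k n u E B → ∀ t, 0 ≤ t →
      lengths (n t) (u t) (E t) (B t) ≤
        C • (GMid c t).mulVec (lengths (n 0) (u 0) (E 0) (B 0)) := by
  have hL : 0 < L := hε.trans_le hεL
  obtain ⟨c₁, hc₁, H₁⟩ := exists_transverse_bound (m := min β (min ε (μ * ε ^ 2)))
    (K := max β (max L (μ * L ^ 2))) (by positivity) (by positivity)
  obtain ⟨c₂, K₂, hc₂, hK₂, H₂⟩ := exists_longitudinal_bound (γ := γ) hβ hμ hL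
  refine ⟨min c₁ (c₂ * ε ^ 2), 9 + K₂ * (1 + β / (γ * ε)) + K₂ * (1 + γ * L / β), by positivity,
    by positivity, fun {c k n u E B} hc hk hkε hkL h t ht => ?_⟩
  obtain ⟨hc1, hc2⟩ := le_min_iff.1 hc
  obtain ⟨a, e, U, F, b, hLo, hT, hup, hlow⟩ := h.exists_splitting hγ hk
  set κ := ‖k‖ with hκ
  have hκ0 : 0 < κ := norm_pos_iff.2 hk
  rw [lengths, lengths, GMid_mulVec, vec_four_le_iff]
  obtain ⟨l1, l2, l3⟩ := hlow 0
  obtain ⟨g1, g2, g3⟩ := hup t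
  have hl := H₂ hκ0 hkL hLo t ht
  have hn0 := hLo.norm_gauss hγ hβ hκ0 0
  have hnt := hLo.norm_gauss hγ hβ hκ0 t
  set e₁ := Real.exp (-(c * t)) with he₁
  have hexp₁ : Real.exp (-(c₁ * t)) ≤ e₁ := by rw [he₁]; gcongr
  have hexp₂ : Real.exp (-(c₂ * κ ^ 2 * t)) ≤ e₁ := by
    have : c ≤ c₂ * κ ^ 2 := hc2.trans (by gcongr)
    rw [he₁]
    gcongr
  set x := vecNorm (u 0) with hx
  set y := vecNorm (E 0) with hy
  set z := vecNorm (B 0) with hz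
  have hx0 : 0 ≤ x := vecNorm_nonneg _
  have hy0 : 0 ≤ y := vecNorm_nonneg _
  have hz0 : 0 ≤ z := vecNorm_nonneg _
  have hl' : ‖e t‖ + ‖a t‖ ≤ K₂ * (e₁ * (‖e 0‖ + x)) := hl.trans (by gcongr)
  have hly : K₂ * (e₁ * (‖e 0‖ + x)) ≤ K₂ * (e₁ * (x + y + z)) := by
    gcongr K₂ * (e₁ * ?_)
    linarith only [l2, hz0]
  have hkey : ∀ i, ‖U i t‖ + ‖F i t‖ + ‖b i t‖ ≤ 3 * (e₁ * (x + y + z)) := fun i => by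
    obtain ⟨i1, i2, i3⟩ := l3 i
    refine (H₁ (min_le_left _ _) (le_max_left _ _)
      (((min_le_right _ _).trans (min_le_left _ _)).trans hkε)
      (hkL.trans ((le_max_left _ _).trans (le_max_right _ _)))
      (((min_le_right _ _).trans (min_le_right _ _)).trans (by gcongr))
      (le_trans (by gcongr) ((le_max_right _ _).trans (le_max_right _ _))) (hT i) t ht).trans ?_
    gcongr
  have hs : ∀ {f : Fin 3 → ℝ} {r : ℝ}, (∀ i, f i ≤ r) → ∑ i, f i ≤ 3 * r := fun {f r} hf => by
    simpa using Finset.sum_le_card_nsmul Finset.univ f r fun i _ => hf i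
  set Y := e₁ * (x + y + z) with hY
  have hY0 : 0 ≤ Y := by positivity
  have s1 : ∑ i, ‖U i t‖ ≤ 3 * (3 * Y) := hs fun i => by
    linarith only [hkey i, norm_nonneg (F i t), norm_nonneg (b i t)]
  have s2 : ∑ i, ‖F i t‖ ≤ 3 * (3 * Y) := hs fun i => by
    linarith only [hkey i, norm_nonneg (U i t), norm_nonneg (b i t)]
  have s3 : ∑ i, ‖b i t‖ ≤ 3 * (3 * Y) := hs fun i => by
    linarith only [hkey i, norm_nonneg (U i t), norm_nonneg (F i t)]
  have hgb : 0 ≤ K₂ * (β / (γ * ε)) + K₂ * (1 + γ * L / β) := by positivity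
  have hsum : ∀ {z₁ r : ℝ}, 0 ≤ r → z₁ ≤ K₂ * Y + 9 * Y →
      z₁ ≤ (9 + K₂ * (1 + β / (γ * ε)) + K₂ * (1 + γ * L / β)) * (r + Y) := fun {z₁ r} hr hz => by
    have h1 := mul_nonneg hgb hY0
    have h3 := mul_nonneg hgb hr
    have h5 := mul_nonneg hK₂.le hr
    linarith only [h1, h3, h5, hz, hr]
  refine ⟨?_, ?_, ?_, ?_⟩
  · have e1 : β * ‖n t‖ ≤ β * (K₂ * (e₁ * (‖n 0‖ + γ * L / β * x))) := by
      calc β * ‖n t‖ = γ * κ * ‖e t‖ := hnt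
        _ ≤ γ * κ * (K₂ * (e₁ * (‖e 0‖ + x))) := by
            gcongr
            linarith only [hl', norm_nonneg (a t)]
        _ = K₂ * (e₁ * (γ * κ * ‖e 0‖ + γ * κ * x)) := by ring
        _ ≤ K₂ * (e₁ * (γ * κ * ‖e 0‖ + γ * L * x)) := by gcongr
        _ = _ := by
            rw [← hn0]
            field_simp
    refine (le_of_mul_le_mul_left e1 hβ).trans ?_
    have e2 : 0 ≤ e₁ * ‖n 0‖ := by positivity
    have e3 : 0 ≤ e₁ * x := by positivity
    have e4 : 0 ≤ K₂ * (γ * L / β) := by positivity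
    have e5 := mul_nonneg e4 e2
    have e6 : 0 ≤ K₂ * (1 + β / (γ * ε)) := by positivity
    have e7 := mul_nonneg e6 e2
    have e8 := mul_nonneg e6 e3
    have e9 := mul_nonneg hK₂.le e3
    linarith only [e2, e3, e5, e7, e8, e9]
  · refine (hsum (z₁ := vecNorm (u t)) (r := e₁ * ‖n 0‖) (by positivity)
      (by linarith only [g1, hl', hly, s1, norm_nonneg (e t)])).trans_eq ?_
    rw [hY]
    ring
  · refine (hsum (z₁ := vecNorm (E t)) (r := 0) le_rfl
      (by linarith only [g2, hl', hly, s2, norm_nonneg (a t)])).trans_eq ?_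
    rw [hY, zero_add]
  · have e1 : 0 ≤ K₂ * Y := by positivity
    refine (hsum (z₁ := vecNorm (B t)) (r := 0) le_rfl
      (by linarith only [g3, s3, e1])).trans_eq ?_
    rw [hY, zero_add]

/-- The longitudinal electric field is κ⁻¹n up to a constant, at both times. This keeps the density
column of the electric row empty and accounts for the undamped-size entry 1 for E under exp(-ct). -/
theorem exists_high_bound {γ β μ : ℝ} (hγ : 0 < γ) (hβ : 0 < β) (hμ : 0 < μ) :
    ∃ L₀ c₀ C : ℝ, 1 ≤ L₀ ∧ 0 < c₀ ∧ 0 < C ∧ ∀ {c : ℝ} {k : R3} {n : ℝ → ℂ} {u E B : ℝ → Fin 3 → ℂ},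
      c ≤ c₀ → k ≠ 0 → L₀ ≤ ‖k‖ → FourierODE γ β μ k n u E B → ∀ t, 0 ≤ t →
      lengths (n t) (u t) (E t) (B t) ≤
        C • (GHigh c t ‖k‖).mulVec (lengths (n 0) (u 0) (E 0) (B 0)) := by
  obtain ⟨L₁, c₁, K₁, hL₁, hc₁, hK₁, H₁⟩ := exists_transverse_high_bound hβ hμ
  obtain ⟨L₂, c₂, K₂, hL₂, hc₂, hK₂, H₂⟩ := exists_longitudinal_high_bound hγ hβ hμ
  refine ⟨max L₁ L₂, min c₁ c₂, 3 * K₁ + K₂ * (1 + β / γ), hL₁.trans (le_max_left _ _),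
    lt_min hc₁ hc₂, by positivity, fun {c k n u E B} hc hk hkL h t ht => ?_⟩
  obtain ⟨hc1, hc2⟩ := le_min_iff.1 hc
  obtain ⟨hk1, hk2⟩ := max_le_iff.1 hkL
  obtain ⟨a, e, U, F, b, hL, hT, hup, hlow⟩ := h.exists_splitting hγ hk
  set κ := ‖k‖ with hκ
  have hκ0 : 0 < κ := norm_pos_iff.2 hk
  rw [lengths, lengths, GHigh_mulVec, vec_four_le_iff]
  obtain ⟨l1, l2, l3⟩ := hlow 0
  obtain ⟨g1, g2, g3⟩ := hup t
  obtain ⟨hn, ha⟩ := H₂ hc2 hk2 hL t ht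
  have hn0 := hL.norm_gauss hγ hβ hκ0 0
  have hnt := hL.norm_gauss hγ hβ hκ0 t
  set p := κ⁻¹ with hp
  have hp0 : 0 < p := by positivity
  have hp1 : p ≤ 1 := inv_le_one_of_one_le₀ (hL₁.trans hk1)
  have hpκ : p * κ = 1 := inv_mul_cancel₀ hκ0.ne'
  set e₁ := Real.exp (-(c * t)) with he₁
  set e₂ := Real.exp (-(c * κ ^ 2 * t)) with he₂
  set e₃ := Real.exp (-(c * t / κ ^ 2)) with he₃
  set x := vecNorm (u 0) with hx
  set y := vecNorm (E 0) with hy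
  set z := vecNorm (B 0) with hz
  have hx0 : 0 ≤ x := vecNorm_nonneg _
  have hy0 : 0 ≤ y := vecNorm_nonneg _
  have hz0 : 0 ≤ z := vecNorm_nonneg _
  have hw0 : 0 ≤ ‖n 0‖ := norm_nonneg _
  have hn' : ‖n t‖ ≤ K₂ * (e₁ * (‖n 0‖ + p * x) + p * (e₂ * (p * ‖n 0‖ + x))) :=
    hn.trans (by gcongr)
  have ha' : ‖a t‖ ≤ K₂ * (p * (e₁ * (‖n 0‖ + p * x)) + e₂ * (p * ‖n 0‖ + x)) :=
    ha.trans (by gcongr)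
  have hpn : p * ‖n 0‖ ≤ γ / β * y := by
    have e1 : β * (p * ‖n 0‖) ≤ β * (γ / β * y) := by
      calc β * (p * ‖n 0‖) = p * κ * (γ * ‖e 0‖) := by linear_combination p * hn0
        _ ≤ γ * y := by
            rw [hpκ, one_mul]
            gcongr
        _ = _ := by field_simp
    exact le_of_mul_le_mul_left e1 hβ
  have hpe : ‖e t‖ = β / γ * (p * ‖n t‖) := by
    have e1 : γ * ‖e t‖ = γ * (β / γ * (p * ‖n t‖)) := by
      calc γ * ‖e t‖ = p * κ * (γ * ‖e t‖) := by rw [hpκ, one_mul]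
        _ = p * (γ * κ * ‖e t‖) := by ring
        _ = _ := by
            rw [← hnt]
            field_simp
    exact mul_left_cancel₀ hγ.ne' e1
  have he' : ‖e t‖ ≤ K₂ * (1 + β / γ) * (e₁ * (p ^ 2 * x + y) + e₂ * (p ^ 2 * x + p ^ 2 * y)) := by
    set r := β / γ with hr
    have hr0 : 0 < r := by positivity
    have hrr : r * (γ / β) = 1 := by rw [hr]; field_simp
    have q1 : r * (p * ‖n 0‖) ≤ y := by
      calc r * (p * ‖n 0‖) ≤ r * (γ / β * y) := by gcongr
        _ = r * (γ / β) * y := by ring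
        _ = y := by rw [hrr, one_mul]
    calc ‖e t‖ = r * (p * ‖n t‖) := hpe
      _ ≤ r * (p * (K₂ * (e₁ * (‖n 0‖ + p * x) + p * (e₂ * (p * ‖n 0‖ + x))))) := by gcongr
      _ = K₂ * (e₁ * (r * (p * ‖n 0‖) + r * (p ^ 2 * x)) +
          e₂ * (p ^ 2 * (r * (p * ‖n 0‖)) + r * (p ^ 2 * x))) := by ring
      _ ≤ K₂ * (e₁ * (y + r * (p ^ 2 * x)) + e₂ * (p ^ 2 * y + r * (p ^ 2 * x))) := by gcongr
      _ ≤ K₂ * (e₁ * ((1 + r) * y + (1 + r) * (p ^ 2 * x)) +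
          e₂ * ((1 + r) * (p ^ 2 * y) + (1 + r) * (p ^ 2 * x))) := by
            have q2 : y ≤ (1 + r) * y := le_mul_of_one_le_left hy0 (by linarith only [hr0])
            have q3 : p ^ 2 * y ≤ (1 + r) * (p ^ 2 * y) :=
              le_mul_of_one_le_left (by positivity) (by linarith only [hr0])
            gcongr
            · linarith only
            · linarith only
      _ = _ := by ring
  set X := e₂ * (x + p ^ 2 * y + p ^ 3 * z) with hX
  set Y := e₃ * (p ^ 2 * x + y + z) with hY
  have hX0 : 0 ≤ X := by positivity
  have hY0 : 0 ≤ Y := by positivity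
  have hkey : ∀ i, ‖U i t‖ ≤ K₁ * (X + p ^ 2 * Y) ∧ ‖F i t‖ ≤ K₁ * (p ^ 2 * X + Y) ∧
      ‖b i t‖ ≤ K₁ * (p ^ 3 * X + Y) := fun i => by
    obtain ⟨i1, i2, i3⟩ := l3 i
    obtain ⟨j1, j2, j3⟩ := H₁ hc1 hk1 (hT i) t ht
    have q1 : e₂ * (‖U i 0‖ + p ^ 2 * ‖F i 0‖ + p ^ 3 * ‖b i 0‖) ≤ X := by
      rw [hX]
      gcongr
    have q2 : e₃ * (p ^ 2 * ‖U i 0‖ + ‖F i 0‖ + ‖b i 0‖) ≤ Y := by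
      rw [hY]
      gcongr
    exact ⟨j1.trans (by gcongr), j2.trans (by gcongr), j3.trans (by gcongr)⟩
  have hs : ∀ {f : Fin 3 → ℝ} {r : ℝ}, (∀ i, f i ≤ r) → ∑ i, f i ≤ 3 * r := fun {f r} hf => by
    simpa using Finset.sum_le_card_nsmul Finset.univ f r fun i _ => hf i
  have s1 := hs fun i => (hkey i).1
  have s2 := hs fun i => (hkey i).2.1
  have s3 := hs fun i => (hkey i).2.2
  have hgb : 0 ≤ K₂ * (β / γ) := by positivity
  -- The longitudinal and transverse parts are each bounded by the full matrix row `r`, so the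
  -- constants simply add.
  have hsum : ∀ {z₁ z₂ z₃ v w r : ℝ}, z₁ ≤ z₂ + z₃ → z₂ ≤ K₂ * (1 + β / γ) * v →
      z₃ ≤ 3 * (K₁ * w) → v ≤ r → w ≤ r →
      z₁ ≤ (3 * K₁ + K₂ * (1 + β / γ)) * r := fun {z₁ z₂ z₃ v w r} h1 h2 h3 h4 h5 => by
    have h6 : K₂ * (1 + β / γ) * v ≤ K₂ * (1 + β / γ) * r := by gcongr
    have h7 : K₁ * w ≤ K₁ * r := by gcongr
    linarith only [h1, h2, h3, h6, h7]
  have hone : ∀ {z₁ v : ℝ}, 0 ≤ v → z₁ ≤ K₂ * v → z₁ ≤ K₂ * (1 + β / γ) * v :=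
    fun hv hz => hz.trans (by linarith only [mul_nonneg hgb hv])
  refine ⟨?_, ?_, ?_, ?_⟩
  · exact hsum (z₃ := 0) (w := 0) (add_zero _).ge (hone (by positivity) hn') (by simp)
      (le_of_eq (by ring)) (by positivity)
  · refine hsum g1 (hone (by positivity) ha') s1 ?_ ?_
    · have q1 : 0 ≤ e₁ * (p ^ 2 * y) := by positivity
      have q2 : 0 ≤ e₂ * (p ^ 2 * y + p ^ 3 * z) := by positivity
      have q3 : 0 ≤ e₃ * (p ^ 4 * x + p ^ 2 * y + p ^ 2 * z) := by positivity
      linarith only [q1, q2, q3]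
    · have q1 : 0 ≤ e₁ * (p * ‖n 0‖ + p ^ 2 * x + p ^ 2 * y) := by positivity
      have q2 : 0 ≤ e₂ * (p * ‖n 0‖) := by positivity
      rw [hX, hY]
      linarith only [q1, q2]
  · refine hsum g2 he' s2 ?_ ?_
    · have q2 : 0 ≤ e₂ * (p ^ 5 * z) := by positivity
      have q3 : 0 ≤ e₃ * (p ^ 2 * x + y + z) := by positivity
      linarith only [q2, q3]
    · have q1 : 0 ≤ e₁ * (p ^ 2 * x + y) := by positivity
      have q2 : e₂ * (p ^ 2 * (p ^ 2 * y)) ≤ e₂ * (1 * (p ^ 2 * y)) := by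
        gcongr
        exact pow_le_one₀ hp0.le hp1
      rw [hX, hY]
      linarith only [q1, q2]
  · refine hsum (z₂ := 0) (v := 0) (g3.trans_eq (zero_add _).symm) (by simp) s3 (by positivity)
      (le_of_eq ?_)
    rw [hX, hY]
    ring

theorem lengths_nonneg (n : ℂ) (u E B : Fin 3 → ℂ) : 0 ≤ lengths n u E B := fun i => by
  fin_cases i <;> simp [lengths, vecNorm_nonneg]

/-- No sign is assumed on `w`: it is forced to be nonnegative by 0 ≤ v ≤ C • w. -/
theorem le_smul_of_le_smul {C C' : ℝ} {v w : Fin 4 → ℝ} (hv : 0 ≤ v) (hC : 0 < C) (h : v ≤ C • w)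
    (hCC' : C ≤ C') : v ≤ C' • w := fun i => (h i).trans (mul_le_mul_of_nonneg_right hCC'
  (nonneg_of_mul_nonneg_right ((hv i).trans (h i)) hC))

end FrequencyRegions

end LinNSM

end

/-! ### Choice of the constants -/

theorem theorem5p1 (γ β μ : ℝ) (hγ : 0 < γ) (hβ : 0 < β) (hμ : 0 < μ) :
    ∃ ε₀ L₀ : ℝ, 0 < ε₀ ∧ ε₀ < 1 ∧ 1 < L₀ ∧
      ∀ ε L : ℝ, 0 < ε → ε ≤ ε₀ → L₀ ≤ L →
        ∃ c C : ℝ, 0 < c ∧ 0 < C ∧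
          ∀ (U₀ : LinNSM.State) (U : ℝ → LinNSM.State), LinNSM.IsSolution γ β μ U₀ U →
            ∀ t : ℝ, 0 ≤ t →
              (∀ᵐ k : LinNSM.R3,
                LinNSM.BoundAt ε L c C t (LinNSM.amplitudes LinNSM.hatL2 (U t))
                  (LinNSM.amplitudes LinNSM.hatL2 U₀) k) ∧
              (LinNSM.AllIntegrable U₀ → LinNSM.AllIntegrable (U t) →
                ∀ k : LinNSM.R3,
                  LinNSM.BoundAt ε L c C t (LinNSM.amplitudes LinNSM.hatL1 (U t))
                    (LinNSM.amplitudes LinNSM.hatL1 U₀) k) := by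
  obtain ⟨ε₁, c₁, C₁, hε₁, hc₁, hC₁, H₁⟩ := LinNSM.exists_low_bound hγ hβ hμ
  obtain ⟨L₁, c₃, C₃, hL₁, hc₃, hC₃, H₃⟩ := LinNSM.exists_high_bound hγ hβ hμ
  -- The entries 1/2 and +1 only secure ε₀ < 1 < L₀.
  refine ⟨min ε₁ (1 / 2), L₁ + 1, by positivity, by
    linarith [min_le_right ε₁ (1 / 2)], by linarith, fun ε L hε hε₀ hL => ?_⟩
  have hεL : ε < L := by linarith [hε₀.trans (min_le_right ε₁ (1 / 2))]
  obtain ⟨c₂, C₂, hc₂, hC₂, H₂⟩ := LinNSM.exists_mid_bound hγ hβ hμ hε hεL.le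
  refine ⟨min c₁ (min c₂ c₃), C₁ + C₂ + C₃, by positivity, by positivity, fun U₀ U hU t ht =>
    LinNSM.bounds_of_fourierODE hε hεL (fun k hk n u E B h t ht => ⟨fun h1 => ?_, fun h1 h2 => ?_,
      fun h1 => ?_⟩) hU ht⟩
  · exact LinNSM.le_smul_of_le_smul (LinNSM.lengths_nonneg _ _ _ _) hC₁
      (H₁ (min_le_left _ _) hk (h1.trans (hε₀.trans (min_le_left _ _))) h t ht) (by linarith)
  · exact LinNSM.le_smul_of_le_smul (LinNSM.lengths_nonneg _ _ _ _) hC₂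
      (H₂ ((min_le_right _ _).trans (min_le_left _ _)) hk h1 h2 h t ht) (by linarith)
  · exact LinNSM.le_smul_of_le_smul (LinNSM.lengths_nonneg _ _ _ _) hC₃
      (H₃ ((min_le_right _ _).trans (min_le_right _ _)) hk (by linarith) h t ht) (by linarith)
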